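/- **Setting.** Let $Z$ be a real Hilbert space and let $A$ be a sectorial operator in $Z$ with compact resolvent that generates an exponentially stable analytic semigroup $e^{At}$. For $s\ge 0$ let $Z^{s}=\operatorname{ran}\,(-A)^{-s}$ with norm $\|\varphi\|_s=\|(-A)^s\varphi\|$, and for $0\le s\le 1$ let $Z^{-s}$ be the completion of $Z$ in the norm $\|(-A)^{-s}\varphi\|$; $A$ and $e^{At}$ are extended to these spaces in the usual way. Let $s_b,s_c,s_d\in[0,1)$ with $s_c+s_b<1$ and $s_c+s_d<1$, let $B_{\rm in}\in\mathcal L(\mathbb R,Z^{-s_b})$, $B_{\rm d}\in\mathcal L(\mathbb R,Z^{-s_d})$, $C\in\mathcal L(Z^{s_c},\mathbb R)$, and consider the linear system $$ z'=Az+B_{\rm in}u+B_{\rm d}d,\qquad z(0)\in Z,\qquad y=Cz .$$ Assume $G=C(-A)^{-1}B_{\rm in}\neq 0$ and put $B=B_{\rm in}G^{-1}$, $I_0=I+BCA^{-1}$. Let $0<\beta<1$ be such that $A_\beta=A-\frac{1-\beta}{\beta}BC$ (considered in $Z$) generates an exponentially stable strongly continuous semigroup $e^{A_\beta t}$. For $t\ge0$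 put $$K(t)=-\tfrac1\beta CA_\beta^{-1}e^{A_\beta t}B,\qquad K_d(t)=-CA_\beta^{-1}e^{A_\beta t}I_0B_{\rm d},\qquad D=\int_0^\infty|K(t)|\,dt,\qquad D_d=\int_0^\infty|K_d(t)|\,dt .$$ Let $C_b^N$ be the space of $N$ times continuously differentiable functions $[0,\infty)\to\mathbb R$ all of whose derivatives of order $0,\dots,N$ are bounded. Let $r,d\in C_b^0$ be a reference signal and a disturbance, and let $\bar z_0\in Z^{s_c}$. The $\beta$-iteration is the sequence of states $\bar z^{j}$, errors $e_j$ and controls $\bar u^{j}$ given by $$\tfrac{d}{dt}\bar z^{0}=A_\beta\bar z^{0}+I_0B_{\rm d}d+\tfrac1\beta Br,\quad \bar z^{0}(0)=\bar z_0,\quad e_0=r-C\bar z^{0},\quad \bar u^0=G^{-1}\Big[\tfrac1\beta r-\tfrac{1-\beta}{\beta}C\bar z^0+CA^{-1}B_{\rm d}d\Big],$$ $$\tfrac{d}{dt}\bar z^{j}=A_\beta\bar z^{j}+\tfrac1\beta Be_{j-1},\quad \bar z^{j}(0)=0,\quad e_j=e_{j-1}-C\bar z^{j},\quad \bar u^j=G^{-1}\Big[\tfrac1\beta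 e_{j-1}-\tfrac{1-\beta}{\beta}C\bar z^j\Big]\qquad(j\ge1),$$ and $\bar z_n=\sum_{j=0}^n\bar z^j$, $\bar u_n=\sum_{j=0}^n\bar u^j$. For $r,d\in C_b^n$ put $$C_n=\max_{0\le j\le n}\limsup_{t\to\infty}|r^{(j)}(t)|+\frac{D_d}{D}\max_{0\le j\le n}\limsup_{t\to\infty}|d^{(j)}(t)| .$$ **Theorem.** $D$ and $D_d$ are finite, $D>0$, the $\beta$-iteration has a solution, and every solution of it satisfies the following. 1. For every $n\ge0$, $e_n=r-C\bar z_n$ on $[0,\infty)$, and if $r,d\in C_b^{n+1}$, then $$\limsup_{t\to\infty}|e_n(t)|=\limsup_{t\to\infty}|r(t)-C\bar z_n(t)|\le D^{\,n+1}C_{n+1}.$$ 2. Suppose that $r,d\in C_b^N$ for every $N$ and that there are constants $\overline A,\overline\alpha\in\mathbb R$ with $C_n\le\overline A\,\overline\alpha^{\,n}$ for all $n\ge 0$ and $D\overline\alpha<1$. Then for all $n\ge 0$ $$\limsup_{t\to\infty}|e_n(t)|\le\overline A(D\overline\alpha)^{n+1}\le\overline A(D\overline\alpha)^{n},\qquad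 \overline A(D\overline\alpha)^{n}\xrightarrow[n\to\infty]{}0 .$$ Moreover, for every $\varepsilon>0$ there is $N$ such that for all $n\ge N$ the control $\bar u_n$ solves the practical regulation problem with error level $\varepsilon$: $\bar u_n$ is continuous and bounded on $[0,\infty)$, and for every initial state in $Z$ the system $z'=Az+B_{\rm in}\bar u_n+B_{\rm d}d$ has a solution on $[0,\infty)$, and along each such solution the output $Cz(t)$ is defined for $t>0$ and $\limsup_{t\to\infty}|r(t)-Cz(t)|\le\varepsilon$. -/

import Mathlib

open Set Filter Topology MeasureTheory

namespace Regulation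

noncomputable section

/-! ### Semigroups and the scale of spaces generated by `A` -/

/-- A strongly continuous semigroup on `Z`; only the values at times `t ≥ 0` are meaningful. -/
structure C0Semigroup (Z : Type*) [NormedAddCommGroup Z] [NormedSpace ℝ Z] where
  op : ℝ → Z →L[ℝ] Z
  op_zero : op 0 = ContinuousLinearMap.id ℝ Z
  op_add : ∀ s t : ℝ, 0 ≤ s → 0 ≤ t → op (s + t) = (op s).comp (op t)
  continuousOn : ∀ x : Z, ContinuousOn (fun t => op t x) (Ici 0)

namespace C0Semigroup

variable {Z : Type*} [NormedAddCommGroup Z] [NormedSpace ℝ Z]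

/-- `x` is in the domain of the infinitesimal generator and the generator maps `x` to `y`. -/
def Gen (T : C0Semigroup Z) (x y : Z) : Prop :=
  Tendsto (fun h : ℝ => h⁻¹ • (T.op h x - x)) (𝓝[>] 0) (𝓝 y)

/-- `‖T(t)‖ ≤ M e^{-ω t}` for some `M` and some `ω > 0`. -/
def ExpStable (T : C0Semigroup Z) : Prop :=
  ∃ M ω : ℝ, 0 < ω ∧ ∀ t : ℝ, 0 ≤ t → ‖T.op t‖ ≤ M * Real.exp (-ω * t)

/-- Analyticity in the form that makes sense on a real space: `T(t)` maps into the domain of the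
generator `A` for `t > 0`, and `t ‖A T(t)‖` stays bounded as `t → 0`.  (For an exponentially stable
semigroup this says that the generator is sectorial.) -/
def IsAnalytic (T : C0Semigroup Z) : Prop :=
  ∃ M : ℝ, ∀ t : ℝ, 0 < t → t ≤ 1 → ∀ x : Z, ∃ y : Z, T.Gen (T.op t x) y ∧ t * ‖y‖ ≤ M * ‖x‖

/-- The fractional power `(-A)^{-s} = Γ(s)⁻¹ ∫₀^∞ t^{s-1} e^{At} dt` for `s > 0`, and `(-A)^0 = I`,
where `A` is the generator of the (exponentially stable, analytic) semigroup `T`. -/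
def negPow (T : C0Semigroup Z) (s : ℝ) : Z →L[ℝ] Z :=
  if s = 0 then ContinuousLinearMap.id ℝ Z
  else (Real.Gamma s)⁻¹ • ∫ t in Ioi (0 : ℝ), (t ^ (s - 1)) • T.op t

/-- `A⁻¹`. -/
def inv (T : C0Semigroup Z) : Z →L[ℝ] Z := -T.negPow 1

/-- `Z^s = ran (-A)^{-s}` for `s ≥ 0`. -/
def ZPos (T : C0Semigroup Z) (s : ℝ) : Submodule ℝ Z :=
  LinearMap.range (T.negPow s : Z →ₗ[ℝ] Z)

/-- The space `Z`, to be equipped with the norm `‖φ‖_{-s} = ‖(-A)^{-s} φ‖`. -/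
def PreNeg (_T : C0Semigroup Z) (_s : ℝ) : Type _ := Z

instance (T : C0Semigroup Z) (s : ℝ) : AddCommGroup (T.PreNeg s) :=
  inferInstanceAs (AddCommGroup Z)

instance (T : C0Semigroup Z) (s : ℝ) : Module ℝ (T.PreNeg s) :=
  inferInstanceAs (Module ℝ Z)

/-- `(-A)^{-s}` as a linear map on `PreNeg`. -/
def preNegMap (T : C0Semigroup Z) (s : ℝ) : T.PreNeg s →ₗ[ℝ] Z :=
  (T.negPow s : Z →ₗ[ℝ] Z)

instance (T : C0Semigroup Z) (s : ℝ) : SeminormedAddCommGroup (T.PreNeg s) :=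
  SeminormedAddCommGroup.induced (T.PreNeg s) Z (T.preNegMap s)

instance (T : C0Semigroup Z) (s : ℝ) : NormedSpace ℝ (T.PreNeg s) :=
  NormedSpace.induced ℝ (T.PreNeg s) Z (T.preNegMap s)

/-- `Z^{-s}`, the completion of `Z` in the norm `‖φ‖_{-s} = ‖(-A)^{-s} φ‖`. -/
abbrev ZNeg (T : C0Semigroup Z) (s : ℝ) : Type _ := UniformSpace.Completion (T.PreNeg s)

/-- `A⁻¹` on `Z`, with its domain read as `PreNeg`. -/
def preInv (T : C0Semigroup Z) (s : ℝ) : T.PreNeg s → Z := fun x => T.inv (x : Z)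

/-- The continuous extension `A⁻¹ : Z^{-s} → Z`, for `0 ≤ s ≤ 1`. -/
def invExt (T : C0Semigroup Z) (s : ℝ) : T.ZNeg s → Z :=
  UniformSpace.Completion.extension (T.preInv s)

end C0Semigroup

/-! ### The control system `z' = A z + b u + b_d d`, `y = C z` -/

/-- The data of a linear single input single output system. `T` is the semigroup `e^{At}`; the input
and disturbance operators are `B_in v = v b` and `B_d v = v b_d`. -/
structure Plant (Z : Type*) [NormedAddCommGroup Z] [NormedSpace ℝ Z] where
  T : C0Semigroup Z
  sb : ℝ
  sc : ℝ
  sd : ℝ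
  b : T.ZNeg sb
  bd : T.ZNeg sd
  C : T.ZPos sc →ₗ[ℝ] ℝ

namespace Plant

variable {Z : Type*} [NormedAddCommGroup Z] [NormedSpace ℝ Z] (P : Plant Z)

open Classical in
/-- `C z` for `z ∈ Z^{s_c}` (and the irrelevant value `0` for other `z`). -/
def out (z : Z) : ℝ := if hz : z ∈ P.T.ZPos P.sc then P.C ⟨z, hz⟩ else 0

/-- `A⁻¹ B_in`, as a vector of `Z`. -/
def invBin : Z := P.T.invExt P.sb P.b

/-- `A⁻¹ B_d`, as a vector of `Z`. -/
def invBd : Z := P.T.invExt P.sd P.bd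

/-- `G = C (-A⁻¹) B_in`, the transfer function at `0`. -/
def G : ℝ := P.out (-P.invBin)

/-- `B = B_in G⁻¹`, an element of `Z^{-s_b}`. -/
def B : P.T.ZNeg P.sb := P.G⁻¹ • P.b

/-- `A⁻¹ B`. -/
def invB : Z := P.T.invExt P.sb P.B

/-- `A⁻¹ I₀ B_d`, where `I₀ = I + B C A⁻¹`. -/
def invI0Bd : Z := P.invBd + P.out P.invBd • P.invB

/-- The assumptions on the system: `A` is sectorial with compact resolvent and generates an
exponentially stable analytic semigroup; `B_in ∈ L(ℝ, Z^{-s_b})`, `B_d ∈ L(ℝ, Z^{-s_d})`,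
`C ∈ L(Z^{s_c}, ℝ)` with exponents in `[0, 1)` and `s_c + s_b < 1`, `s_c + s_d < 1`;
and `G` is invertible. -/
structure Standing : Prop where
  expStable : P.T.ExpStable
  analytic : P.T.IsAnalytic
  compact_resolvent : IsCompactOperator P.T.inv
  sb_nonneg : 0 ≤ P.sb
  sc_nonneg : 0 ≤ P.sc
  sd_nonneg : 0 ≤ P.sd
  sb_lt : P.sb < 1
  sc_lt : P.sc < 1
  sd_lt : P.sd < 1
  sc_add_sb : P.sc + P.sb < 1
  sc_add_sd : P.sc + P.sd < 1
  /-- Boundedness of `C` for the norm `‖φ‖_{s_c} = ‖(-A)^{s_c} φ‖` of `φ = (-A)^{-s_c} h`. -/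
  C_bounded : ∃ M : ℝ, ∀ h : Z, |P.out (P.T.negPow P.sc h)| ≤ M * ‖h‖
  G_ne_zero : P.G ≠ 0

/-- A solution in `Z` of the control system `z' = A z + B_in u + B_d d`, `z(0) = z₀`, on `[0, ∞)`.
The equation holds in the extrapolation space `Z^{-1}`, onto which `A` extends to an isomorphism from
`Z`; it is stated after applying `A⁻¹`. -/
structure IsSolution (u d : ℝ → ℝ) (z₀ : Z) (z : ℝ → Z) : Prop where
  continuousOn : ContinuousOn z (Ici 0)
  initial : z 0 = z₀
  equation : ∀ t : ℝ, 0 ≤ t → HasDerivWithinAt (fun τ => P.T.inv (z τ))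
    (z t + u t • P.invBin + d t • P.invBd) (Ici 0) t

/-- The control `u` solves the practical regulation problem with error level `ε`: it is continuous and
bounded on `[0, ∞)`, and from every initial state `z₀ ∈ Z` the control system driven by `u` and `d` has
a solution, and along any solution the output `y = C z` is defined for `t > 0` and satisfies
`limsup_{t → ∞} |r(t) - y(t)| ≤ ε`. -/
def SolvesPracticalRegulation (r d : ℝ → ℝ) (ε : ℝ) (u : ℝ → ℝ) : Prop :=
  ContinuousOn u (Ici 0) ∧ (∃ M : ℝ, ∀ t : ℝ, 0 ≤ t → |u t| ≤ M) ∧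
  ∀ z₀ : Z, (∃ z : ℝ → Z, P.IsSolution u d z₀ z) ∧
    ∀ z : ℝ → Z, P.IsSolution u d z₀ z →
      (∀ t : ℝ, 0 < t → z t ∈ P.T.ZPos P.sc) ∧
      IsBoundedUnder (· ≤ ·) atTop (fun t => |r t - P.out (z t)|) ∧
      limsup (fun t => |r t - P.out (z t)|) atTop ≤ ε

/-! ### The regularized operator `A_β = A - ζ B C`, `ζ = (1 - β) / β` -/

/-- The graph of `A_β` as an operator in `Z`: `x ∈ Z^{s_c}` and `A x - ζ B C x = y`.
The equation between elements of `Z^{-1}` is stated after applying `A⁻¹`. -/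
def BetaGraph (β : ℝ) (x y : Z) : Prop :=
  x ∈ P.T.ZPos P.sc ∧ x - ((1 - β) / β * P.out x) • P.invB = P.T.inv y

/-- `S` is the semigroup `e^{A_β t}` generated by `A_β`. -/
def IsBetaSemigroup (β : ℝ) (S : C0Semigroup Z) : Prop :=
  ∀ x y : Z, S.Gen x y ↔ P.BetaGraph β x y

/-- `A_β⁻¹ v = A⁻¹ (I + (1 - β) B C A⁻¹) v` for `v ∈ Z^{-1}` given through `g = A⁻¹ v`. -/
def betaInv (β : ℝ) (g : Z) : Z := g + ((1 - β) * P.out g) • P.invB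

/-- `K(t) = -(1/β) C A_β⁻¹ e^{A_β t} B`. -/
def K (β : ℝ) (S : C0Semigroup Z) (t : ℝ) : ℝ :=
  -(1 / β) * P.out (S.op t (P.betaInv β P.invB))

/-- `K_d(t) = -C A_β⁻¹ e^{A_β t} I₀ B_d`. -/
def Kd (β : ℝ) (S : C0Semigroup Z) (t : ℝ) : ℝ :=
  -P.out (S.op t (P.betaInv β P.invI0Bd))

/-- `D = ∫₀^∞ |K(t)| dt`. -/
def D (β : ℝ) (S : C0Semigroup Z) : ℝ := ∫ t in Ioi (0 : ℝ), |P.K β S t|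

/-- `D_d = ∫₀^∞ |K_d(t)| dt`. -/
def Dd (β : ℝ) (S : C0Semigroup Z) : ℝ := ∫ t in Ioi (0 : ℝ), |P.Kd β S t|

/-! ### The β-iteration -/

/-- A solution on `[0, ∞)` of the regularized system
`z' = A_β z + (1/β) B v + I₀ B_d w`, `z(0) = z₀`, with values in `Z^{s_c}` and with continuous output.
As above, the equation is stated after applying `A⁻¹`. -/
structure IsBetaSolution (β : ℝ) (v w : ℝ → ℝ) (z₀ : Z) (z : ℝ → Z) : Prop where
  continuousOn : ContinuousOn z (Ici 0)
  mem : ∀ t : ℝ, 0 ≤ t → z t ∈ P.T.ZPos P.sc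
  out_continuousOn : ContinuousOn (fun t => P.out (z t)) (Ici 0)
  initial : z 0 = z₀
  equation : ∀ t : ℝ, 0 ≤ t → HasDerivWithinAt (fun τ => P.T.inv (z τ))
    ((z t - ((1 - β) / β * P.out (z t)) • P.invB) + (1 / β * v t) • P.invB + w t • P.invI0Bd)
    (Ici 0) t

/-- The errors `e₀ = r - C z⁰` and `e_j = e_{j-1} - C z^j`. -/
def err (r : ℝ → ℝ) (z : ℕ → ℝ → Z) : ℕ → ℝ → ℝ
  | 0 => fun t => r t - P.out (z 0 t)
  | j + 1 => fun t => err r z j t - P.out (z (j + 1) t)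

/-- `z⁰, z¹, z², …` are the states of the β-iteration in the linear case: `z⁰` solves
`z' = A_β z + (1/β) B r + I₀ B_d d`, `z(0) = z₀`, and `z^j` for `j ≥ 1` solves
`z' = A_β z + (1/β) B e_{j-1}`, `z(0) = 0`. -/
structure IsBetaIteration (β : ℝ) (r d : ℝ → ℝ) (z₀ : Z) (z : ℕ → ℝ → Z) : Prop where
  zero : P.IsBetaSolution β r d z₀ (z 0)
  succ : ∀ j : ℕ, P.IsBetaSolution β (P.err r z j) (fun _ => 0) 0 (z (j + 1))

/-- The controls `u⁰ = G⁻¹ [r/β - ((1-β)/β) C z⁰ + C A⁻¹ B_d d]` and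
`u^j = G⁻¹ [e_{j-1}/β - ((1-β)/β) C z^j]` for `j ≥ 1`. -/
def ctrl (β : ℝ) (r d : ℝ → ℝ) (z : ℕ → ℝ → Z) : ℕ → ℝ → ℝ
  | 0 => fun t =>
      P.G⁻¹ * (1 / β * r t - (1 - β) / β * P.out (z 0 t) + P.out P.invBd * d t)
  | j + 1 => fun t =>
      P.G⁻¹ * (1 / β * P.err r z j t - (1 - β) / β * P.out (z (j + 1) t))

/-- The control `u_n = u⁰ + ⋯ + u^n` produced by the β-iteration. -/
def totalCtrl (β : ℝ) (r d : ℝ → ℝ) (z : ℕ → ℝ → Z) (n : ℕ) (t : ℝ) : ℝ :=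
  ∑ j ∈ Finset.range (n + 1), P.ctrl β r d z j t

end Plant

/-! ### Signals -/

/-- `φ ∈ C_b^N([0, ∞))`: `N` times continuously differentiable, with bounded derivatives. -/
def IsCb (N : ℕ) (φ : ℝ → ℝ) : Prop :=
  ContDiffOn ℝ N φ (Ici 0) ∧
    ∀ j ≤ N, ∃ M : ℝ, ∀ t : ℝ, 0 ≤ t → |iteratedDerivWithin j φ (Ici 0) t| ≤ M

/-- `max_{0 ≤ j ≤ n} limsup_{t → ∞} |φ^{(j)}(t)|`. -/
def maxLimsup (n : ℕ) (φ : ℝ → ℝ) : ℝ :=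
  (Finset.range (n + 1)).sup' Finset.nonempty_range_add_one
    (fun j => limsup (fun t => |iteratedDerivWithin j φ (Ici 0) t|) atTop)

/-- `C_n = max_{j ≤ n} limsup |r^{(j)}| + (D_d / D) max_{j ≤ n} limsup |d^{(j)}|`. -/
def Plant.Cn {Z : Type*} [NormedAddCommGroup Z] [NormedSpace ℝ Z] (P : Plant Z)
    (β : ℝ) (S : C0Semigroup Z) (r d : ℝ → ℝ) (n : ℕ) : ℝ :=
  maxLimsup n r + P.Dd β S / P.D β S * maxLimsup n d

end

end Regulation

/-! Let R be the map v ↦ v - Cz, where z solves z' = A_β z + (1/β)Bv with z(0) = 0. Then e_n = Rⁿ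
e₀, so everything rests on how powers of R act on smooth signals. The normalization B = B_in G⁻¹
gives CA⁻¹B = -1. Hence -A⁻¹B is a stationary state for the constant input 1, with output exactly 1,
and adding the free orbit of A⁻¹B makes the initial state zero: the response to the constant 1 is 1
- K. Duhamel's formula then yields Rφ = φ(0)K + K * φ' (`IsBetaSolution.sub_out_eq`): one step of
the iteration trades a signal for its derivative, at the price of a convolution with K and a term
that decays.

R is causal and time invariant, so it commutes with convolutions (`Standing.commute_errMap_convL`),
and it preserves signals that tend to 0 (`Standing.evLe_errMap_pow`). Therefore Rⁿ⁺¹φ = φ(0)RⁿK + K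
* Rⁿφ', and induction gives limsup |Rⁿφ| ≤ Dⁿ limsup |φ⁽ⁿ⁾| (`Standing.evLe_errMap_pow_of_isCb`). In
the same way CA⁻¹I₀B_d = 0 gives e₀ = Rr + d(0)K_d + K_d * d' minus the output of the free orbit of
the initial state. Applying Rⁿ leaves the bounds Dⁿ⁺¹ limsup |r⁽ⁿ⁺¹⁾| and D_d Dⁿ limsup |d⁽ⁿ⁺¹⁾|,
whose sum is at most Dⁿ⁺¹ C_{n+1}.

The analytic work makes these formulas legitimate although B and C are unbounded. The condition s_c
+ s_b < 1 makes (-A)^{s_c} e^{At}B integrable near 0 (`Standing.exists_adm_invExt`), so the output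
of the regularized system solves a scalar Volterra equation with an L¹ kernel. Stability of e^{A_β
t} is assumed only in Z. Smoothing over a unit of time lifts it to Z^{s_c}, where C is bounded
(`Standing.exists_decay`), and this gives integrable K and K_d, bounded responses to bounded inputs
and vanishing responses to vanishing inputs.

For practical regulation, the sum of the iterates solves the original system under the total
control. Any other solution differs from it by an orbit of e^{At}, whose output tends to 0. -/

namespace Regulation

noncomputable section

/-! ### Causal convolutions on `[0, ∞)` -/

section Convolution

variable {E : Type*} [NormedAddCommGroup E]

/-- The function is integrable on every interval `[0, t]`. -/
def LocInt (p : ℝ → E) : Prop := ∀ t : ℝ, 0 ≤ t → IntervalIntegrable p volume 0 t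

/-- Signals are controlled only on [0, ∞). Composing with max(·, 0) replaces the values at negative
times by the value at 0 and gives a continuous function on the whole line. -/
theorem continuous_comp_max {X : Type*} [TopologicalSpace X] {f : ℝ → X}
    (hf : ContinuousOn f (Ici 0)) : Continuous fun t => f (max t 0) :=
  hf.comp_continuous (by fun_prop) fun _ => mem_Ici.2 (le_max_right _ _)

theorem LocInt.of_integrableOn {p : ℝ → E} (hp : IntegrableOn p (Ioi 0)) : LocInt p :=
  fun _ ht => (intervalIntegrable_iff_integrableOn_Ioc_of_le ht).2
    (hp.mono_set Ioc_subset_Ioi_self)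

theorem LocInt.of_continuousOn {p : ℝ → E} (hp : ContinuousOn p (Ici 0)) : LocInt p :=
  fun t ht => (hp.mono (by rw [uIcc_of_le ht]; exact Icc_subset_Ici_self)).intervalIntegrable

variable [NormedSpace ℝ E]

/-- The causal convolution `∫₀ᵗ f(t - τ) p(τ) dτ`. -/
def cv (p : ℝ → E) (f : ℝ → ℝ) (t : ℝ) : E := ∫ τ in (0 : ℝ)..t, f (t - τ) • p τ

theorem continuousOn_comp_sub {f : ℝ → ℝ} (hf : ContinuousOn f (Ici 0)) {t : ℝ} (ht : 0 ≤ t) :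
    ContinuousOn (fun τ => f (t - τ)) (uIcc 0 t) := by
  rw [uIcc_of_le ht]
  exact hf.comp (by fun_prop) fun τ hτ => sub_nonneg.2 hτ.2

theorem LocInt.intervalIntegrable_cv {p : ℝ → E} (hp : LocInt p) {f : ℝ → ℝ}
    (hf : ContinuousOn f (Ici 0)) {t : ℝ} (ht : 0 ≤ t) :
    IntervalIntegrable (fun τ => f (t - τ) • p τ) volume 0 t :=
  (hp t ht).continuousOn_smul (continuousOn_comp_sub hf ht)

theorem cv_zero_time (p : ℝ → E) (f : ℝ → ℝ) : cv p f 0 = 0 := by simp [cv]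

theorem cv_congr {p : ℝ → E} {f f' : ℝ → ℝ} (h : ∀ t, 0 ≤ t → f t = f' t) {t : ℝ} (ht : 0 ≤ t) :
    cv p f t = cv p f' t := by
  refine intervalIntegral.integral_congr fun τ hτ => ?_
  rw [uIcc_of_le ht] at hτ
  simp only [h (t - τ) (sub_nonneg.2 hτ.2)]

theorem cv_congr_left {p p' : ℝ → E} {f : ℝ → ℝ} (h : ∀ t, 0 < t → p t = p' t) {t : ℝ}
    (ht : 0 ≤ t) : cv p f t = cv p' f t := by
  refine intervalIntegral.integral_congr_ae (Eventually.of_forall fun τ hτ => ?_)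
  rw [uIoc_of_le ht] at hτ
  simp only [h τ hτ.1]

theorem cv_add {p : ℝ → E} (hp : LocInt p) {f f' : ℝ → ℝ} (hf : ContinuousOn f (Ici 0))
    (hf' : ContinuousOn f' (Ici 0)) {t : ℝ} (ht : 0 ≤ t) :
    cv p (fun s => f s + f' s) t = cv p f t + cv p f' t := by
  simp only [cv, add_smul]
  exact intervalIntegral.integral_add (hp.intervalIntegrable_cv hf ht)
    (hp.intervalIntegrable_cv hf' ht)

theorem cv_const_mul (p : ℝ → E) (a : ℝ) (f : ℝ → ℝ) (t : ℝ) :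
    cv p (fun s => a * f s) t = a • cv p f t := by
  simp only [cv, mul_smul]
  exact intervalIntegral.integral_smul _ _

theorem map_cv [CompleteSpace E] {F : Type*} [NormedAddCommGroup F] [NormedSpace ℝ F]
    [CompleteSpace F] (L : E →L[ℝ] F) {p : ℝ → E} (hp : LocInt p) {f : ℝ → ℝ}
    (hf : ContinuousOn f (Ici 0)) {t : ℝ} (ht : 0 ≤ t) :
    L (cv p f t) = cv (fun τ => L (p τ)) f t := by
  rw [cv, ← L.intervalIntegral_comp_comm (hp.intervalIntegrable_cv hf ht)]
  simp [cv]

theorem cv_comm (k f : ℝ → ℝ) (t : ℝ) : cv k f t = cv f k t := by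
  have := intervalIntegral.integral_comp_sub_left (a := 0) (b := t)
    (fun x => f x * k (t - x)) t
  simp only [sub_zero, sub_self, sub_sub_cancel] at this
  simp only [cv, smul_eq_mul]
  rw [this]
  exact intervalIntegral.integral_congr fun τ _ => mul_comm _ _

theorem norm_cv_le {p : ℝ → E} (hp : LocInt p) {f : ℝ → ℝ} {t M : ℝ} (ht : 0 ≤ t)
    (hM : ∀ s, 0 ≤ s → s ≤ t → |f s| ≤ M) :
    ‖cv p f t‖ ≤ (∫ τ in (0 : ℝ)..t, ‖p τ‖) * M := by
  rw [← intervalIntegral.integral_mul_const]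
  refine intervalIntegral.norm_integral_le_of_norm_le ht (Eventually.of_forall fun τ hτ => ?_)
    ((hp t ht).norm.mul_const _)
  rw [norm_smul, mul_comm]
  exact mul_le_mul_of_nonneg_left (hM _ (by linarith [hτ.2]) (by linarith [hτ.1])) (norm_nonneg _)

theorem exists_bound_Icc {X : Type*} [SeminormedAddCommGroup X] {f : ℝ → X}
    (hf : ContinuousOn f (Ici 0)) (t : ℝ) :
    ∃ M, 0 ≤ M ∧ ∀ s, 0 ≤ s → s ≤ t → ‖f s‖ ≤ M := by
  obtain ⟨M, hM⟩ := isCompact_Icc.exists_bound_of_continuousOn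
    (hf.mono (Icc_subset_Ici_self : Icc 0 t ⊆ Ici 0))
  exact ⟨max M 0, le_max_right _ _, fun s h0 h1 => (hM s ⟨h0, h1⟩).trans (le_max_left _ _)⟩

/-- The kernel is merely integrable, so continuity comes from dominated convergence, with a bound of
the signal on a compact interval times the norm of the kernel. -/
theorem continuousOn_cv {p : ℝ → E} (hp : LocInt p) {f : ℝ → ℝ}
    (hf : ContinuousOn f (Ici 0)) : ContinuousOn (cv p f) (Ici 0) := by
  intro t₀ ht₀
  have ht₀' : (0 : ℝ) ≤ t₀ := ht₀
  set R := t₀ + 1 with hR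
  obtain ⟨M, hM0, hM⟩ := exists_bound_Icc hf R
  -- The variable end point moves into an indicator, so that the domain (0, R] is fixed. The
  -- integrand can jump in t only where τ equals t, which at t₀ concerns a single τ, a null set.
  let F : ℝ → ℝ → E := fun t τ => (Iic t).indicator (fun τ => f (max (t - τ) 0) • p τ) τ
  have hpR : IntegrableOn p (Ioc 0 R) :=
    (intervalIntegrable_iff_integrableOn_Ioc_of_le (by linarith)).1 (hp R (by linarith))
  have hfc := continuous_comp_max hf
  have key : ∀ t ∈ Ico 0 R, cv p f t = ∫ τ in Ioc 0 R, F t τ := by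
    intro t ht
    have e1 : (Ioc 0 R ∩ Iic t) = Ioc 0 t := by
      ext τ
      simp only [mem_inter_iff, mem_Ioc, mem_Iic]
      constructor
      · rintro ⟨⟨a, b⟩, c⟩
        exact ⟨a, c⟩
      · rintro ⟨a, c⟩
        exact ⟨⟨a, c.trans ht.2.le⟩, c⟩
    rw [cv, intervalIntegral.integral_of_le ht.1, setIntegral_indicator measurableSet_Iic, e1]
    refine setIntegral_congr_fun measurableSet_Ioc fun τ hτ => ?_
    simp only [max_eq_left (sub_nonneg.2 hτ.2)]
  have hnb : Ico 0 R ∈ 𝓝[Ici 0] t₀ := by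
    have : Iio R ∈ 𝓝 t₀ := Iio_mem_nhds (by linarith)
    filter_upwards [mem_nhdsWithin_of_mem_nhds this, self_mem_nhdsWithin] with t h1 h2
    exact ⟨h2, h1⟩
  have hc : ContinuousWithinAt (fun t => ∫ τ in Ioc 0 R, F t τ) (Ici 0) t₀ := by
    refine continuousWithinAt_of_dominated (bound := fun τ => M * ‖p τ‖) ?_ ?_
      (hpR.norm.const_mul M) ?_
    · refine Eventually.of_forall fun t => ?_
      refine AEStronglyMeasurable.indicator ?_ measurableSet_Iic
      exact ((hfc.comp (continuous_const.sub continuous_id)).aestronglyMeasurable).smul hpR.aestronglyMeasurable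
    · filter_upwards [hnb] with t ht
      refine (ae_restrict_iff' measurableSet_Ioc).2 (Eventually.of_forall fun τ hτ => ?_)
      simp only [F]
      by_cases h : τ ∈ Iic t
      · rw [indicator_of_mem h, norm_smul]
        exact mul_le_mul_of_nonneg_right (hM _ (le_max_right _ _)
          (max_le (by linarith [hτ.1, ht.2]) (by linarith))) (norm_nonneg _)
      · rw [indicator_of_notMem h, norm_zero]
        positivity
    · have : ∀ᵐ τ ∂(volume.restrict (Ioc 0 R)), τ ≠ t₀ :=
        ae_restrict_of_ae (by simp [ae_iff, measure_singleton])
      filter_upwards [this] with τ hτ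
      refine ContinuousAt.continuousWithinAt ?_
      rcases lt_or_gt_of_ne hτ with h | h
      · have : (fun t => F t τ) =ᶠ[𝓝 t₀] fun t => f (max (t - τ) 0) • p τ := by
          filter_upwards [Ioi_mem_nhds h] with t ht
          exact indicator_of_mem (mem_Iic.2 (le_of_lt ht)) _
        refine ContinuousAt.congr ?_ this.symm
        exact (Continuous.smul (hfc.comp (continuous_id.sub continuous_const))
          continuous_const).continuousAt
      · have : (fun t => F t τ) =ᶠ[𝓝 t₀] fun _ => 0 := by
          filter_upwards [Iio_mem_nhds h] with t ht
          exact indicator_of_notMem (by simpa using ht) _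
        exact continuousAt_const.congr this.symm
  refine hc.congr_of_eventuallyEq ?_ (key t₀ ⟨ht₀', by linarith⟩)
  filter_upwards [hnb] with t ht using key t ht

/-- Fubini on the triangle `{τ, σ ≥ 0, τ + σ ≤ t}`. -/
theorem cv_cv [CompleteSpace E] {p : ℝ → E} (hp : LocInt p) {F f : ℝ → ℝ}
    (hF : ContinuousOn F (Ici 0)) (hf : ContinuousOn f (Ici 0)) {t : ℝ} (ht : 0 ≤ t) :
    cv p (cv F f) t = ∫ σ in (0 : ℝ)..t, F σ • cv p f (t - σ) := by
  have hpt : IntegrableOn p (Ioc 0 t) :=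
    (intervalIntegrable_iff_integrableOn_Ioc_of_le ht).1 (hp t ht)
  obtain ⟨M, hM0, hM⟩ := exists_bound_Icc hf t
  obtain ⟨M', hM0', hM'⟩ := exists_bound_Icc hF t
  -- Cutting f off by zero at negative arguments encodes the triangle in the integrand, so Fubini
  -- can be used on the square (0, t]². For F an extension suffices, as σ is positive there.
  let fp : ℝ → ℝ := (Ici 0).indicator fun s => f (max s 0)
  have hfp : Measurable fp := (continuous_comp_max hf).measurable.indicator measurableSet_Ici
  let Fp : ℝ → ℝ := fun s => F (max s 0)
  have hFp : Measurable Fp := (continuous_comp_max hF).measurable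
  have hint : Integrable (Function.uncurry fun τ σ => (Fp σ * fp (t - τ - σ)) • p τ)
      ((volume.restrict (Ioc 0 t)).prod (volume.restrict (Ioc 0 t))) := by
    have h1 := Integrable.comp_fst hpt (volume.restrict (Ioc (0 : ℝ) t))
    have h2 : AEStronglyMeasurable (fun x : ℝ × ℝ => Fp x.2 * fp (t - x.1 - x.2))
        ((volume.restrict (Ioc 0 t)).prod (volume.restrict (Ioc 0 t))) :=
      ((hFp.comp measurable_snd).mul (hfp.comp
        ((measurable_const.sub measurable_fst).sub measurable_snd))).aestronglyMeasurable
    refine h1.bdd_smul (M' * M) h2 ?_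
    rw [Measure.prod_restrict]
    refine (ae_restrict_iff' (measurableSet_Ioc.prod measurableSet_Ioc)).2
      (Eventually.of_forall fun x hx => ?_)
    rw [norm_mul]
    refine mul_le_mul (hM' _ (le_max_right _ _) (max_le hx.2.2 ht)) ?_ (norm_nonneg _) hM0'
    simp only [fp]
    by_cases h : t - x.1 - x.2 ∈ Ici (0 : ℝ)
    · rw [indicator_of_mem h]
      exact hM _ (le_max_right _ _) (max_le (by linarith [hx.1.1, hx.2.1]) ht)
    · rw [indicator_of_notMem h, norm_zero]
      exact hM0
  have restr : ∀ s ∈ Ioc 0 t, ∀ (G : ℝ → E), (∀ σ, t - s < σ → G σ = 0) →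
      ∫ σ in Ioc 0 t, G σ = ∫ σ in (0 : ℝ)..(t - s), G σ := by
    intro s hs G hG
    rw [intervalIntegral.integral_of_le (by linarith [hs.2])]
    refine setIntegral_eq_of_subset_of_forall_sdiff_eq_zero measurableSet_Ioc
      (Ioc_subset_Ioc_right (by linarith [hs.1])) fun σ hσ => hG σ ?_
    by_contra hc
    exact hσ.2 ⟨hσ.1.1, not_lt.1 hc⟩
  have hfp_neg : ∀ u, u < 0 → fp u = 0 := fun u hu => indicator_of_notMem (by simpa using hu) _
  have hfp_pos : ∀ u, 0 ≤ u → fp u = f u := fun u hu => by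
    simp only [fp]
    rw [indicator_of_mem (mem_Ici.2 hu), max_eq_left hu]
  have hswap := integral_integral_swap hint
  have lhs : cv p (cv F f) t =
      ∫ τ in Ioc 0 t, ∫ σ in Ioc 0 t, (Fp σ * fp (t - τ - σ)) • p τ := by
    rw [cv, intervalIntegral.integral_of_le ht]
    refine setIntegral_congr_fun measurableSet_Ioc fun τ hτ => ?_
    rw [restr τ hτ _ fun σ hσ => by simp [hfp_neg (t - τ - σ) (by linarith)],
      intervalIntegral.integral_smul_const]
    congr 1
    refine intervalIntegral.integral_congr fun σ hσ => ?_
    rw [uIcc_of_le (by linarith [hτ.2])] at hσ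
    simp only [Fp, max_eq_left hσ.1, hfp_pos (t - τ - σ) (by linarith [hσ.2]), smul_eq_mul]
    ring
  have rhs : ∫ σ in (0 : ℝ)..t, F σ • cv p f (t - σ) =
      ∫ σ in Ioc 0 t, ∫ τ in Ioc 0 t, (Fp σ * fp (t - τ - σ)) • p τ := by
    rw [intervalIntegral.integral_of_le ht]
    refine setIntegral_congr_fun measurableSet_Ioc fun σ hσ => ?_
    rw [restr σ hσ _ fun τ hτ => by simp [hfp_neg (t - τ - σ) (by linarith)], cv,
      ← intervalIntegral.integral_smul]
    refine intervalIntegral.integral_congr fun τ hτ => ?_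
    rw [uIcc_of_le (by linarith [hσ.2])] at hτ
    simp only [Fp, max_eq_left hσ.1.le, hfp_pos (t - τ - σ) (by linarith [hτ.2]), mul_smul,
      sub_right_comm t σ τ]
  rw [lhs, hswap, rhs]

theorem cv_cv_comm {k F f : ℝ → ℝ} (hk : LocInt k)
    (hF : ContinuousOn F (Ici 0)) (hf : ContinuousOn f (Ici 0)) {t : ℝ} (ht : 0 ≤ t) :
    cv k (cv F f) t = cv F (cv k f) t := by
  rw [cv_cv hk hF hf ht, cv]
  exact intervalIntegral.integral_congr fun τ _ => mul_comm _ _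

/-- Integration is convolution with the constant 1, so this is an instance of `cv_cv`. -/
theorem integral_cv [CompleteSpace E] {p : ℝ → E} (hp : LocInt p) {f : ℝ → ℝ} (hf : ContinuousOn f (Ici 0))
    {t : ℝ} (ht : 0 ≤ t) :
    ∫ s in (0 : ℝ)..t, cv p f s = cv p (fun s => ∫ σ in (0 : ℝ)..s, f σ) t := by
  have h1 : ∀ s, 0 ≤ s → ∫ σ in (0 : ℝ)..s, f σ = cv (fun _ => (1 : ℝ)) f s := by
    intro s _
    have := intervalIntegral.integral_comp_sub_left (a := 0) (b := s) f s
    simp only [sub_zero, sub_self] at this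
    simp [cv, this]
  rw [cv_congr h1 ht, cv_cv hp continuousOn_const hf ht]
  have := intervalIntegral.integral_comp_sub_left (a := 0) (b := t) (cv p f) t
  simp only [sub_zero, sub_self] at this
  simp [this]

/-- Young's inequality on `[0, t]`. -/
theorem integral_norm_cv_le {p : ℝ → E} (hp : LocInt p) {f : ℝ → ℝ} (hf : ContinuousOn f (Ici 0))
    {t : ℝ} (ht : 0 ≤ t) :
    ∫ s in (0 : ℝ)..t, ‖cv p f s‖ ≤
      (∫ s in (0 : ℝ)..t, ‖p s‖) * ∫ s in (0 : ℝ)..t, |f s| := by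
  have hpn : LocInt fun s => ‖p s‖ := fun s hs => (hp s hs).norm
  have h1 : ∫ s in (0 : ℝ)..t, ‖cv p f s‖ ≤
      ∫ s in (0 : ℝ)..t, cv (fun s => ‖p s‖) (fun s => |f s|) s := by
    refine intervalIntegral.integral_mono_on ht
      (LocInt.of_continuousOn (continuousOn_cv hp hf).norm t ht)
      (LocInt.of_continuousOn (continuousOn_cv hpn hf.abs) t ht) fun s hs => ?_
    refine intervalIntegral.norm_integral_le_of_norm_le hs.1 (Eventually.of_forall fun τ hτ => ?_)
      (hpn.intervalIntegrable_cv hf.abs hs.1)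
    rw [norm_smul, smul_eq_mul, Real.norm_eq_abs]
  refine h1.trans ?_
  rw [integral_cv hpn hf.abs ht]
  have hI : ∀ s, 0 ≤ s → s ≤ t →
      |∫ σ in (0 : ℝ)..s, (|f σ|)| ≤ ∫ s in (0 : ℝ)..t, |f s| := by
    intro s h0 h1
    rw [abs_of_nonneg (intervalIntegral.integral_nonneg h0 fun _ _ => abs_nonneg _)]
    exact intervalIntegral.integral_mono_interval le_rfl h0 h1
      (Eventually.of_forall fun _ => abs_nonneg _) (LocInt.of_continuousOn hf.abs t ht)
  have := norm_cv_le hpn ht hI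
  simp only [norm_norm] at this
  exact (le_abs_self _).trans this

theorem hasDerivWithinAt_primitive [CompleteSpace E] {f : ℝ → E} (hf : ContinuousOn f (Ici 0))
    {t : ℝ} (ht : 0 ≤ t) :
    HasDerivWithinAt (fun t => ∫ s in (0 : ℝ)..t, f s) (f t) (Ici 0) t := by
  have hc := continuous_comp_max hf
  have h1 := (intervalIntegral.integral_hasDerivAt_right (hc.intervalIntegrable 0 t)
    (hc.stronglyMeasurableAtFilter _ _) hc.continuousAt).hasDerivWithinAt (s := Ici 0)
  have h2 : ∀ s ∈ Ici (0 : ℝ),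
      ∫ s in (0 : ℝ)..s, f s = ∫ s in (0 : ℝ)..s, f (max s 0) := by
    intro s hs
    refine intervalIntegral.integral_congr fun τ hτ => ?_
    rw [uIcc_of_le hs] at hτ
    simp only [max_eq_left hτ.1]
  simp only [max_eq_left ht] at h1
  exact h1.congr h2 (h2 t ht)

theorem integral_derivWithin_Ici [CompleteSpace E] {f f' : ℝ → E}
    (hf : ∀ t, 0 ≤ t → HasDerivWithinAt f (f' t) (Ici 0) t) (hf' : ContinuousOn f' (Ici 0))
    {t : ℝ} (ht : 0 ≤ t) : ∫ s in (0 : ℝ)..t, f' s = f t - f 0 := by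
  refine intervalIntegral.integral_eq_sub_of_hasDeriv_right_of_le ht
    (fun s hs => ((hf s hs.1).continuousWithinAt).mono Icc_subset_Ici_self)
    (fun s hs => (hf s hs.1.le).mono fun u hu => ?_) (LocInt.of_continuousOn hf' t ht)
  exact hs.1.le.trans (le_of_lt hu)

end Convolution

/-! ### Volterra equations -/

section Volterra

variable {E : Type*} [NormedAddCommGroup E] [NormedSpace ℝ E]

/-- The weight factors as e^{-l(t-τ)} e^{-lτ}, so an exponential weight is compatible with
convolution. This turns a Volterra equation with an arbitrary L¹ kernel into one with a kernel of
small norm. -/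
theorem exp_smul_cv (l : ℝ) (p : ℝ → E) (f : ℝ → ℝ) (t : ℝ) :
    Real.exp (-l * t) • cv p f t =
      cv (fun s => Real.exp (-l * s) • p s) (fun s => Real.exp (-l * s) * f s) t := by
  rw [cv, cv, ← intervalIntegral.integral_smul]
  refine intervalIntegral.integral_congr fun τ _ => ?_
  simp only [smul_smul]
  congr 1
  rw [show -l * t = -l * (t - τ) + -l * τ by ring, Real.exp_add]
  ring

theorem exists_exp_weight {k : ℝ → ℝ} (hk : IntegrableOn k (Ioi 0)) {ε : ℝ} (hε : 0 < ε) :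
    ∃ l : ℝ, 0 ≤ l ∧ ∫ τ in Ioi (0 : ℝ), ‖Real.exp (-l * τ) • k τ‖ < ε := by
  have h : Tendsto (fun n : ℕ => ∫ τ in Ioi (0 : ℝ), ‖Real.exp (-(n : ℝ) * τ) • k τ‖) atTop
      (𝓝 (∫ τ in Ioi (0 : ℝ), (0 : ℝ))) := by
    refine tendsto_integral_of_dominated_convergence (fun τ => ‖k τ‖) (fun n => ?_) hk.norm
      (fun n => ?_) ?_
    · have : Continuous fun τ : ℝ => Real.exp (-(n : ℝ) * τ) := by fun_prop
      exact (this.aestronglyMeasurable.smul hk.aestronglyMeasurable).norm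
    · refine (ae_restrict_iff' measurableSet_Ioi).2 (Eventually.of_forall fun τ hτ => ?_)
      rw [norm_norm, norm_smul, Real.norm_of_nonneg (Real.exp_pos _).le]
      refine mul_le_of_le_one_left (norm_nonneg _) (Real.exp_le_one_iff.2 ?_)
      have : (0 : ℝ) ≤ n * τ := mul_nonneg n.cast_nonneg (le_of_lt hτ)
      linarith
    · refine (ae_restrict_iff' measurableSet_Ioi).2 (Eventually.of_forall fun τ hτ => ?_)
      have h1 : Tendsto (fun n : ℕ => Real.exp (-(n : ℝ) * τ)) atTop (𝓝 0) := by
        refine Real.tendsto_exp_atBot.comp ?_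
        have : Tendsto (fun n : ℕ => (n : ℝ) * τ) atTop atTop :=
          tendsto_natCast_atTop_atTop.atTop_mul_const hτ
        refine (tendsto_neg_atTop_atBot.comp this).congr fun n => ?_
        simp
      have h2 := (h1.smul_const (k τ)).norm
      simpa using h2
  simp only [integral_zero] at h
  obtain ⟨n, hn⟩ := (h.eventually (gt_mem_nhds hε)).exists
  exact ⟨n, n.cast_nonneg, hn⟩

theorem integrableOn_exp_smul {k : ℝ → E} (hk : IntegrableOn k (Ioi 0)) {l : ℝ} (hl : 0 ≤ l) :
    IntegrableOn (fun τ => Real.exp (-l * τ) • k τ) (Ioi 0) := by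
  refine Integrable.mono' hk.norm
    ((Continuous.aestronglyMeasurable (by fun_prop)).smul hk.aestronglyMeasurable) ?_
  refine (ae_restrict_iff' measurableSet_Ioi).2 (Eventually.of_forall fun τ hτ => ?_)
  rw [norm_smul, Real.norm_of_nonneg (Real.exp_pos _).le]
  refine mul_le_of_le_one_left (norm_nonneg _) (Real.exp_le_one_iff.2 ?_)
  have : (0 : ℝ) ≤ l * τ := mul_nonneg hl (le_of_lt hτ)
  linarith

theorem intervalIntegral_norm_le_Ioi {E : Type*} [NormedAddCommGroup E] {k : ℝ → E} (hk : IntegrableOn k (Ioi 0)) {t : ℝ}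
    (ht : 0 ≤ t) : ∫ τ in (0 : ℝ)..t, ‖k τ‖ ≤ ∫ τ in Ioi (0 : ℝ), ‖k τ‖ := by
  rw [intervalIntegral.integral_of_le ht]
  exact setIntegral_mono_set hk.norm (Eventually.of_forall fun _ => norm_nonneg _)
    Ioc_subset_Ioi_self.eventuallyLE

theorem norm_cv_le_Ioi {p : ℝ → E} (hp : IntegrableOn p (Ioi 0)) {f : ℝ → ℝ} {t M : ℝ}
    (ht : 0 ≤ t) (hM0 : 0 ≤ M) (hM : ∀ s, 0 ≤ s → s ≤ t → |f s| ≤ M) :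
    ‖cv p f t‖ ≤ (∫ τ in Ioi (0 : ℝ), ‖p τ‖) * M :=
  (norm_cv_le (LocInt.of_integrableOn hp) ht hM).trans
    (mul_le_mul_of_nonneg_right (intervalIntegral_norm_le_Ioi hp ht) hM0)

/-- A weight that makes the convolution with `z k` a contraction. -/
theorem exists_contracting_weight {k : ℝ → ℝ} (hk : IntegrableOn k (Ioi 0)) (z : ℝ) :
    ∃ l : ℝ, 0 ≤ l ∧ |z| * ∫ τ in Ioi (0 : ℝ), ‖Real.exp (-l * τ) • k τ‖ ≤ 1 / 2 := by
  obtain ⟨l, hl, h⟩ := exists_exp_weight hk (ε := 1 / (2 * (|z| + 1))) (by positivity)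
  refine ⟨l, hl, ?_⟩
  calc |z| * ∫ τ in Ioi (0 : ℝ), ‖Real.exp (-l * τ) • k τ‖
      ≤ |z| * (1 / (2 * (|z| + 1))) := mul_le_mul_of_nonneg_left h.le (abs_nonneg z)
    _ ≤ 1 / 2 := by
      rw [mul_one_div, div_le_iff₀ (by positivity)]
      linarith [abs_nonneg z]

theorem exp_neg_mul_le_one {l t : ℝ} (hl : 0 ≤ l) (ht : 0 ≤ t) : Real.exp (-l * t) ≤ 1 :=
  Real.exp_le_one_iff.2 (by nlinarith [mul_nonneg hl ht])

theorem le_exp_mul_of_weighted {l t T y m : ℝ} (hl : 0 ≤ l) (htT : t ≤ T)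
    (h : Real.exp (-l * t) * |y| ≤ m) : |y| ≤ Real.exp (l * T) * m := by
  have h1 : |y| = Real.exp (l * t) * (Real.exp (-l * t) * |y|) := by
    rw [← mul_assoc, ← Real.exp_add]
    simp
  have hm : 0 ≤ m := (mul_nonneg (Real.exp_pos _).le (abs_nonneg _)).trans h
  calc |y| = Real.exp (l * t) * (Real.exp (-l * t) * |y|) := h1
    _ ≤ Real.exp (l * t) * m := mul_le_mul_of_nonneg_left h (Real.exp_pos _).le
    _ ≤ Real.exp (l * T) * m := mul_le_mul_of_nonneg_right
        (Real.exp_le_exp.2 (mul_le_mul_of_nonneg_left htT hl)) hm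

/-- Solutions of a Volterra equation depend continuously on the data, in the supremum norm and in the
`L¹` norm. -/
theorem volterra_bounds {k : ℝ → ℝ} (hk : IntegrableOn k (Ioi 0)) (z : ℝ) :
    ∃ c : ℝ → ℝ, (∀ T, 0 ≤ c T) ∧ ∀ a y : ℝ → ℝ, ContinuousOn a (Ici 0) → ContinuousOn y (Ici 0) →
      (∀ t, 0 ≤ t → y t = a t + z * cv k y t) → ∀ T, 0 ≤ T →
        (∀ A, (∀ t, 0 ≤ t → t ≤ T → |a t| ≤ A) → ∀ t, 0 ≤ t → t ≤ T → |y t| ≤ c T * A) ∧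
        ∫ t in (0 : ℝ)..T, |y t| ≤ c T * ∫ t in (0 : ℝ)..T, |a t| := by
  obtain ⟨l, hl, hz⟩ := exists_contracting_weight hk z
  -- The factor 2 is 1/(1 - 1/2) for the weighted equation, and the exponential removes the weight
  -- on [0, T].
  refine ⟨fun T => Real.exp (l * T) * 2, fun T => by positivity, fun a y ha hy heq T hT => ?_⟩
  have hkl := integrableOn_exp_smul hk hl
  have hkL := LocInt.of_integrableOn hkl
  have hexp : ContinuousOn (fun t => Real.exp (-l * t)) (Ici (0 : ℝ)) :=
    Continuous.continuousOn (by fun_prop)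
  have hyl : ContinuousOn (fun t => Real.exp (-l * t) * y t) (Ici 0) := hexp.mul hy
  have hal : ContinuousOn (fun t => Real.exp (-l * t) * a t) (Ici 0) := hexp.mul ha
  have hweq : ∀ t, 0 ≤ t → Real.exp (-l * t) * y t = Real.exp (-l * t) * a t +
      z * cv (fun s => Real.exp (-l * s) • k s) (fun s => Real.exp (-l * s) * y s) t := by
    intro t ht
    rw [← exp_smul_cv, heq t ht, smul_eq_mul]
    ring
  have habs : ∀ t x, |Real.exp (-l * t) * x| = Real.exp (-l * t) * |x| := fun t x => by
    rw [abs_mul, abs_of_pos (Real.exp_pos _)]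
  constructor
  · intro A hA t ht0 htT
    -- At a maximum point s of the weighted solution on [0, T], the convolution sees only times
    -- before s, where the solution is at most the maximum m. This gives m ≤ A + m/2.
    obtain ⟨s, hs, hmax⟩ := isCompact_Icc.exists_isMaxOn (nonempty_Icc.2 hT)
      (hyl.abs.mono (Icc_subset_Ici_self : Icc 0 T ⊆ Ici 0))
    set m := |Real.exp (-l * s) * y s| with hm
    have hmax' : ∀ u, 0 ≤ u → u ≤ s → |Real.exp (-l * u) * y u| ≤ m :=
      fun u h0 h1 => hmax ⟨h0, h1.trans hs.2⟩
    have h1 := norm_cv_le hkL hs.1 hmax'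
    have h2 : (∫ τ in (0 : ℝ)..s, ‖Real.exp (-l * τ) • k τ‖) * m ≤
        (∫ τ in Ioi (0 : ℝ), ‖Real.exp (-l * τ) • k τ‖) * m :=
      mul_le_mul_of_nonneg_right (intervalIntegral_norm_le_Ioi hkl hs.1) (abs_nonneg _)
    have h3 : m ≤ A + 1 / 2 * m := by
      calc m ≤ |Real.exp (-l * s) * a s| + |z * cv (fun s => Real.exp (-l * s) • k s)
            (fun s => Real.exp (-l * s) * y s) s| := by
            rw [hm, hweq s hs.1]
            exact abs_add_le _ _
        _ ≤ A + |z| * ((∫ τ in Ioi (0 : ℝ), ‖Real.exp (-l * τ) • k τ‖) * m) := by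
            rw [abs_mul z]
            refine add_le_add ?_ (mul_le_mul_of_nonneg_left (h1.trans h2) (abs_nonneg z))
            rw [habs]
            exact (mul_le_of_le_one_left (abs_nonneg _) (exp_neg_mul_le_one hl hs.1)).trans
              (hA s hs.1 hs.2)
        _ ≤ A + 1 / 2 * m := by
            rw [← mul_assoc]
            gcongr
    have h4 : Real.exp (-l * t) * |y t| ≤ 2 * A := by
      rw [← habs]
      have := hmax (⟨ht0, htT⟩ : t ∈ Icc 0 T)
      simp only [mem_ofPred_eq] at this
      linarith
    rw [mul_assoc]
    exact le_exp_mul_of_weighted hl htT h4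
  -- The same absorption argument in L¹, with Young's inequality in place of the bound at a maximum.
  · set I := ∫ t in (0 : ℝ)..T, |Real.exp (-l * t) * y t| with hI
    have hI0 : 0 ≤ I := intervalIntegral.integral_nonneg hT fun _ _ => abs_nonneg _
    have iy := LocInt.of_continuousOn hyl.abs T hT
    have ia := LocInt.of_continuousOn hal.abs T hT
    have hcv := continuousOn_cv hkL hyl
    have icv := LocInt.of_continuousOn (hcv.abs.const_mul |z|) T hT
    have h1 := integral_norm_cv_le hkL hyl hT
    have h2 : I ≤ (∫ t in (0 : ℝ)..T, |Real.exp (-l * t) * a t|) + 1 / 2 * I := by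
      calc I ≤ ∫ t in (0 : ℝ)..T, (|Real.exp (-l * t) * a t| + |z| *
              |cv (fun s => Real.exp (-l * s) • k s) (fun s => Real.exp (-l * s) * y s) t|) := by
            refine intervalIntegral.integral_mono_on hT iy (ia.add icv) fun t ht => ?_
            rw [hweq t ht.1, ← abs_mul z]
            exact abs_add_le _ _
        _ = (∫ t in (0 : ℝ)..T, |Real.exp (-l * t) * a t|) + |z| * ∫ t in (0 : ℝ)..T,
              |cv (fun s => Real.exp (-l * s) • k s) (fun s => Real.exp (-l * s) * y s) t| := by
            rw [intervalIntegral.integral_add ia icv, intervalIntegral.integral_const_mul]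
        _ ≤ (∫ t in (0 : ℝ)..T, |Real.exp (-l * t) * a t|) +
              |z| * ((∫ τ in Ioi (0 : ℝ), ‖Real.exp (-l * τ) • k τ‖) * I) := by
            refine add_le_add_right (mul_le_mul_of_nonneg_left (h1.trans ?_) (abs_nonneg z)) _
            exact mul_le_mul_of_nonneg_right (intervalIntegral_norm_le_Ioi hkl hT) hI0
        _ ≤ _ := by
            rw [← mul_assoc]
            gcongr
    have h3 : ∫ t in (0 : ℝ)..T, |Real.exp (-l * t) * a t| ≤ ∫ t in (0 : ℝ)..T, |a t| := by
      refine intervalIntegral.integral_mono_on hT ia (LocInt.of_continuousOn ha.abs T hT)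
        fun t ht => ?_
      rw [habs]
      exact mul_le_of_le_one_left (abs_nonneg _) (exp_neg_mul_le_one hl ht.1)
    have h4 : ∫ t in (0 : ℝ)..T, |y t| ≤ Real.exp (l * T) * I := by
      rw [hI, ← intervalIntegral.integral_const_mul]
      refine intervalIntegral.integral_mono_on hT (LocInt.of_continuousOn hy.abs T hT)
        (iy.const_mul _) fun t ht => ?_
      refine le_exp_mul_of_weighted hl ht.2 ?_
      rw [habs]
    rw [mul_assoc]
    refine h4.trans (mul_le_mul_of_nonneg_left ?_ (Real.exp_pos _).le)
    linarith

/-- Continuous and bounded on `[0, ∞)`. -/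
def Bc (f : ℝ → ℝ) : Prop := ContinuousOn f (Ici 0) ∧ ∃ M : ℝ, ∀ t : ℝ, 0 ≤ t → |f t| ≤ M

theorem Bc.add {f f' : ℝ → ℝ} (hf : Bc f) (hf' : Bc f') : Bc fun t => f t + f' t := by
  obtain ⟨h, M, hM⟩ := hf
  obtain ⟨h', M', hM'⟩ := hf'
  exact ⟨h.add h', M + M', fun t ht => (abs_add_le _ _).trans (add_le_add (hM t ht) (hM' t ht))⟩

theorem Bc.const_mul {f : ℝ → ℝ} (hf : Bc f) (a : ℝ) : Bc fun t => a * f t := by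
  obtain ⟨h, M, hM⟩ := hf
  refine ⟨h.const_mul a, |a| * M, fun t ht => ?_⟩
  rw [abs_mul]
  exact mul_le_mul_of_nonneg_left (hM t ht) (abs_nonneg a)

theorem Bc.sub {f f' : ℝ → ℝ} (hf : Bc f) (hf' : Bc f') : Bc fun t => f t - f' t := by
  simpa [sub_eq_add_neg] using hf.add (hf'.const_mul (-1))

theorem Bc.congr {f f' : ℝ → ℝ} (hf : Bc f) (h : ∀ t, 0 ≤ t → f' t = f t) : Bc f' := by
  obtain ⟨hc, M, hM⟩ := hf
  exact ⟨hc.congr h, M, fun t ht => by rw [h t ht]; exact hM t ht⟩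

theorem Bc.const (a : ℝ) : Bc fun _ => a := ⟨continuousOn_const, |a|, fun _ _ => le_rfl⟩

theorem Bc.cv {k f : ℝ → ℝ} (hk : IntegrableOn k (Ioi 0)) (hf : Bc f) : Bc (cv k f) := by
  obtain ⟨hc, M, hM⟩ := hf
  have hM0 : 0 ≤ M := (abs_nonneg _).trans (hM 0 le_rfl)
  exact ⟨continuousOn_cv (LocInt.of_integrableOn hk) hc, (∫ τ in Ioi (0 : ℝ), ‖k τ‖) * M,
    fun t ht => norm_cv_le_Ioi hk ht hM0 fun s h0 _ => hM s h0⟩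

/-! ### Signals as elements of a Banach space; existence for Volterra equations -/

open scoped NNReal BoundedContinuousFunction

/-- A bounded continuous function on `[0, ∞)`, extended to `ℝ`. -/
def ext (φ : ℝ≥0 →ᵇ ℝ) (t : ℝ) : ℝ := φ t.toNNReal

theorem bc_ext (φ : ℝ≥0 →ᵇ ℝ) : Bc (ext φ) :=
  ⟨(φ.continuous.comp continuous_real_toNNReal).continuousOn, ‖φ‖, fun _ _ => φ.norm_coe_le_norm _⟩

/-- A continuous and bounded function as an element of the Banach space. -/
def Bc.toBCF {f : ℝ → ℝ} (hf : Bc f) : ℝ≥0 →ᵇ ℝ :=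
  BoundedContinuousFunction.ofNormedAddCommGroup (fun t : ℝ≥0 => f t)
    (hf.1.comp_continuous NNReal.continuous_coe fun t => t.2) hf.2.choose
    fun t => hf.2.choose_spec t t.2

theorem Bc.toBCF_apply {f : ℝ → ℝ} (hf : Bc f) (t : ℝ≥0) : hf.toBCF t = f t := rfl

theorem Bc.ext_toBCF {f : ℝ → ℝ} (hf : Bc f) {t : ℝ} (ht : 0 ≤ t) : ext hf.toBCF t = f t := by
  simp only [ext, Bc.toBCF_apply, Real.coe_toNNReal t ht]

/-- Banach's fixed point theorem is applied to the weighted unknown e^{-lt} y(t) among bounded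
continuous functions. The solution y itself may grow at this stage. -/
theorem exists_volterra_solution {k : ℝ → ℝ} (hk : IntegrableOn k (Ioi 0)) (z : ℝ) {a : ℝ → ℝ}
    (ha : Bc a) : ∃ y : ℝ → ℝ, ContinuousOn y (Ici 0) ∧
      ∀ t, 0 ≤ t → y t = a t + z * cv k y t := by
  obtain ⟨l, hl, hz⟩ := exists_contracting_weight hk z
  have hkl := integrableOn_exp_smul hk hl
  have hkL := LocInt.of_integrableOn hkl
  have hal : Bc fun t => Real.exp (-l * t) * a t := by
    obtain ⟨hc, M, hM⟩ := ha
    refine ⟨ContinuousOn.mul (Continuous.continuousOn (by fun_prop)) hc, M, fun t ht => ?_⟩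
    rw [abs_mul, abs_of_pos (Real.exp_pos _)]
    exact (mul_le_of_le_one_left (abs_nonneg _) (exp_neg_mul_le_one hl ht)).trans (hM t ht)
  have hΨ : ∀ φ : ℝ≥0 →ᵇ ℝ, Bc fun t => Real.exp (-l * t) * a t +
      z * cv (fun s => Real.exp (-l * s) • k s) (ext φ) t := fun φ =>
    hal.add ((Bc.cv hkl (bc_ext φ)).const_mul z)
  let Ψ : (ℝ≥0 →ᵇ ℝ) → (ℝ≥0 →ᵇ ℝ) := fun φ => (hΨ φ).toBCF
  have hcontr : ContractingWith (1 / 2) Ψ := by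
    refine ⟨by rw [← NNReal.coe_lt_coe]; norm_num, LipschitzWith.of_dist_le_mul fun φ χ => ?_⟩
    refine (BoundedContinuousFunction.dist_le (by positivity)).2 fun t => ?_
    have h1 : cv (fun s => Real.exp (-l * s) • k s) (ext φ) t -
        cv (fun s => Real.exp (-l * s) • k s) (ext χ) t =
        cv (fun s => Real.exp (-l * s) • k s) (fun s => ext φ s - ext χ s) t := by
      have := cv_add hkL (bc_ext φ).1 ((bc_ext χ).const_mul (-1)).1 t.coe_nonneg
      rw [cv_const_mul] at this
      have e : (fun s => ext φ s - ext χ s) = fun s => ext φ s + -1 * ext χ s := by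
        funext s
        ring
      rw [e, this, smul_eq_mul]
      ring
    have h2 := norm_cv_le hkL t.2 (f := fun s => ext φ s - ext χ s) (M := dist φ χ)
      fun s _ _ => BoundedContinuousFunction.dist_coe_le_dist (f := φ) (g := χ) s.toNNReal
    simp only [Ψ, Bc.toBCF_apply]
    rw [Real.dist_eq, add_sub_add_left_eq_sub, ← mul_sub, h1, abs_mul]
    calc |z| * |cv (fun s => Real.exp (-l * s) • k s) (fun s => ext φ s - ext χ s) t|
        ≤ |z| * ((∫ τ in Ioi (0 : ℝ), ‖Real.exp (-l * τ) • k τ‖) * dist φ χ) :=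
          mul_le_mul_of_nonneg_left (h2.trans (mul_le_mul_of_nonneg_right
            (intervalIntegral_norm_le_Ioi hkl t.2) dist_nonneg)) (abs_nonneg z)
      _ ≤ 1 / 2 * dist φ χ := by
          rw [← mul_assoc]
          exact mul_le_mul_of_nonneg_right hz dist_nonneg
      _ = _ := by norm_num
  let φ := ContractingWith.fixedPoint Ψ hcontr
  have hφ : Ψ φ = φ := hcontr.fixedPoint_isFixedPt
  have hφt : ∀ t, 0 ≤ t → ext φ t = Real.exp (-l * t) * a t +
      z * cv (fun s => Real.exp (-l * s) • k s) (ext φ) t := fun t ht => by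
    conv_lhs => rw [← hφ]
    exact (hΨ φ).ext_toBCF ht
  refine ⟨fun t => Real.exp (l * t) * ext φ t,
    ContinuousOn.mul (Continuous.continuousOn (by fun_prop)) (bc_ext φ).1, fun t ht => ?_⟩
  have e1 : ∀ s x, Real.exp (-l * s) * (Real.exp (l * s) * x) = x := fun s x => by
    rw [← mul_assoc, ← Real.exp_add]
    simp
  have h1 := exp_smul_cv l k (fun t => Real.exp (l * t) * ext φ t) t
  simp only [e1] at h1
  simp only []
  rw [hφt t ht, ← h1, smul_eq_mul, mul_add, ← mul_assoc, ← Real.exp_add]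
  have e2 : ∀ x, Real.exp (l * t) * (z * (Real.exp (-l * t) * x)) = z * x := fun x => by
    rw [show Real.exp (l * t) * (z * (Real.exp (-l * t) * x)) =
      z * (Real.exp (l * t) * Real.exp (-l * t) * x) by ring, ← Real.exp_add]
    simp
  rw [e2]
  simp

end Volterra

/-! ### Eventual bounds -/

/-- `limsup |f| ≤ c`. -/
def EvLe (f : ℝ → ℝ) (c : ℝ) : Prop := ∀ ε, 0 < ε → ∀ᶠ t in atTop, |f t| ≤ c + ε

theorem EvLe.add {f f' : ℝ → ℝ} {c c' : ℝ} (h : EvLe f c) (h' : EvLe f' c') :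
    EvLe (fun t => f t + f' t) (c + c') := fun ε hε => by
  filter_upwards [h (ε / 2) (by positivity), h' (ε / 2) (by positivity)] with t h1 h2
  linarith [abs_add_le (f t) (f' t)]

theorem EvLe.const_mul_zero {f : ℝ → ℝ} (h : EvLe f 0) (a : ℝ) : EvLe (fun t => a * f t) 0 :=
  fun ε hε => by
  filter_upwards [h (ε / (|a| + 1)) (by positivity)] with t h1
  rw [abs_mul, zero_add]
  rw [zero_add, le_div_iff₀ (by positivity)] at h1
  nlinarith [abs_nonneg (f t)]

theorem EvLe.congr {f f' : ℝ → ℝ} {c : ℝ} (h : EvLe f c) (he : ∀ t, 0 ≤ t → f' t = f t) :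
    EvLe f' c := fun ε hε => by
  filter_upwards [h ε hε, eventually_ge_atTop 0] with t h1 h2
  rwa [he t h2]

theorem EvLe.of_tendsto {f : ℝ → ℝ} (h : Tendsto f atTop (𝓝 0)) : EvLe f 0 := fun ε hε => by
  filter_upwards [(Metric.tendsto_nhds.1 h) ε hε] with t ht
  rw [Real.dist_0_eq_abs] at ht
  linarith

theorem EvLe.isBoundedUnder {f : ℝ → ℝ} {c : ℝ} (h : EvLe f c) :
    IsBoundedUnder (· ≤ ·) atTop fun t => |f t| := ⟨c + 1, h 1 one_pos⟩

theorem isCoboundedUnder_abs (f : ℝ → ℝ) : IsCoboundedUnder (· ≤ ·) atTop fun t => |f t| :=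
  isCoboundedUnder_le_of_le atTop (x := 0) fun t => abs_nonneg (f t)

theorem EvLe.limsup_le {f : ℝ → ℝ} {c : ℝ} (h : EvLe f c) :
    limsup (fun t => |f t|) atTop ≤ c :=
  le_of_forall_pos_le_add fun ε hε => limsup_le_of_le (isCoboundedUnder_abs f) (h ε hε)

/-- Boundedness matters: for a function unbounded at infinity the real-valued `limsup` is a default
value and bounds nothing. -/
theorem EvLe.of_bounded {f : ℝ → ℝ} {M : ℝ} (h : ∀ t, 0 ≤ t → |f t| ≤ M) :
    EvLe f (limsup (fun t => |f t|) atTop) := fun ε hε => by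
  have hb : IsBoundedUnder (· ≤ ·) atTop fun t => |f t| :=
    ⟨M, (eventually_ge_atTop 0).mono fun t ht => h t ht⟩
  filter_upwards [eventually_lt_of_limsup_lt
    (lt_add_of_pos_right (limsup (fun t => |f t|) atTop) hε) hb] with t ht using ht.le

theorem limsup_abs_nonneg {f : ℝ → ℝ} {M : ℝ} (h : ∀ t, 0 ≤ t → |f t| ≤ M) :
    0 ≤ limsup (fun t => |f t|) atTop := by
  refine le_limsup_of_frequently_le (Eventually.frequently (Eventually.of_forall
    fun t => abs_nonneg (f t))) ⟨M, (eventually_ge_atTop 0).mono fun t ht => h t ht⟩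

/-- The integral is split at τ = t - t₀. Before it the signal is evaluated after t₀, where it is
nearly bounded by c. After it the signal is only bounded by M, but the kernel contributes just a
piece of its tail. -/
theorem EvLe.cv {k f : ℝ → ℝ} (hk : IntegrableOn k (Ioi 0)) (hf : Bc f) {c : ℝ} (hc : 0 ≤ c)
    (h : EvLe f c) : EvLe (cv k f) ((∫ τ in Ioi (0 : ℝ), |k τ|) * c) := by
  intro ε hε
  set I := ∫ τ in Ioi (0 : ℝ), |k τ| with hI
  have hI0 : 0 ≤ I := integral_nonneg fun _ => abs_nonneg _
  obtain ⟨hfc, M, hM⟩ := hf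
  have hM0 : 0 ≤ M := (abs_nonneg _).trans (hM 0 le_rfl)
  -- The tolerances here and in `htail'` make each of the two parts exceed its limit by at most ε/2.
  -- Adding 1 to I and M avoids division by zero.
  obtain ⟨t₀, ht₀0, ht₀⟩ : ∃ t₀, 0 ≤ t₀ ∧ ∀ t, t₀ ≤ t → |f t| ≤ c + ε / (2 * (I + 1)) := by
    obtain ⟨t₀, ht₀⟩ := eventually_atTop.1 (h (ε / (2 * (I + 1))) (by positivity))
    exact ⟨max t₀ 0, le_max_right _ _, fun t ht => ht₀ t ((le_max_left _ _).trans ht)⟩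
  have hkL := LocInt.of_integrableOn hk
  have htail : Tendsto (fun t => ∫ τ in (0 : ℝ)..t, |k τ|) atTop (𝓝 I) :=
    intervalIntegral_tendsto_integral_Ioi 0 hk.norm tendsto_id
  have htail' : ∀ᶠ t in atTop, I - ε / (2 * (M + 1)) < ∫ τ in (0 : ℝ)..(t - t₀), |k τ| :=
    (htail.comp (tendsto_atTop_add_const_right _ (-t₀) tendsto_id)).eventually
      (lt_mem_nhds (sub_lt_self _ (by positivity)))
  filter_upwards [htail', eventually_ge_atTop t₀] with t h1 h2
  have ht : 0 ≤ t := ht₀0.trans h2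
  have hb : 0 ≤ t - t₀ := sub_nonneg.2 h2
  have ik : ∀ a b, 0 ≤ a → a ≤ b → IntervalIntegrable (fun τ => |k τ|) volume a b :=
    fun a b ha hab => ((hkL b (ha.trans hab)).mono_set
      (by rw [uIcc_of_le hab, uIcc_of_le (ha.trans hab)]; exact Icc_subset_Icc_left ha)).norm
  have ic := hkL.intervalIntegrable_cv hfc ht
  have hs1 : IntervalIntegrable (fun τ => f (t - τ) • k τ) volume 0 (t - t₀) :=
    ic.mono_set (by
      rw [uIcc_of_le hb, uIcc_of_le ht]
      exact Icc_subset_Icc_right (by linarith))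
  have hs2 : IntervalIntegrable (fun τ => f (t - τ) • k τ) volume (t - t₀) t :=
    ic.mono_set (by
      rw [uIcc_of_le (by linarith), uIcc_of_le ht]
      exact Icc_subset_Icc_left hb)
  have e1 : ‖∫ τ in (0 : ℝ)..(t - t₀), f (t - τ) • k τ‖ ≤
      (∫ τ in (0 : ℝ)..(t - t₀), |k τ|) * (c + ε / (2 * (I + 1))) := by
    rw [← intervalIntegral.integral_mul_const]
    refine intervalIntegral.norm_integral_le_of_norm_le hb (Eventually.of_forall fun τ hτ => ?_)
      ((ik _ _ le_rfl hb).mul_const _)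
    rw [norm_smul, mul_comm]
    exact mul_le_mul_of_nonneg_left (ht₀ _ (by linarith [hτ.2])) (norm_nonneg _)
  have e2 : ‖∫ τ in (t - t₀)..t, f (t - τ) • k τ‖ ≤ (∫ τ in (t - t₀)..t, |k τ|) * M := by
    rw [← intervalIntegral.integral_mul_const]
    refine intervalIntegral.norm_integral_le_of_norm_le (sub_le_self t ht₀0)
      (Eventually.of_forall fun τ hτ => ?_) ((ik _ _ hb (sub_le_self t ht₀0)).mul_const _)
    rw [norm_smul, mul_comm]
    exact mul_le_mul_of_nonneg_left (hM _ (by linarith [hτ.2])) (norm_nonneg _)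
  have e3 : (∫ τ in (0 : ℝ)..(t - t₀), |k τ|) + ∫ τ in (t - t₀)..t, |k τ| =
      ∫ τ in (0 : ℝ)..t, |k τ| :=
    intervalIntegral.integral_add_adjacent_intervals (ik _ _ le_rfl hb) (ik _ _ hb (by linarith))
  have e4 : ∫ τ in (0 : ℝ)..t, |k τ| ≤ I := intervalIntegral_norm_le_Ioi hk ht
  have e5 : 0 ≤ ∫ τ in (t - t₀)..t, |k τ| :=
    intervalIntegral.integral_nonneg (by linarith) fun _ _ => abs_nonneg _
  rw [Regulation.cv, ← intervalIntegral.integral_add_adjacent_intervals hs1 hs2,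
    ← Real.norm_eq_abs]
  have e6 : (∫ τ in (0 : ℝ)..(t - t₀), |k τ|) * (c + ε / (2 * (I + 1))) ≤ I * c + ε / 2 := by
    have : (∫ τ in (0 : ℝ)..(t - t₀), |k τ|) * (c + ε / (2 * (I + 1))) ≤
        I * (c + ε / (2 * (I + 1))) := mul_le_mul_of_nonneg_right (by linarith) (by positivity)
    have h3 : I * (ε / (2 * (I + 1))) ≤ ε / 2 := by
      rw [mul_div_assoc', div_le_div_iff₀ (by positivity) (by positivity)]
      nlinarith
    linarith
  have e7 : (∫ τ in (t - t₀)..t, |k τ|) * M ≤ ε / 2 := by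
    have h3 : (∫ τ in (t - t₀)..t, |k τ|) ≤ ε / (2 * (M + 1)) := by linarith
    refine (mul_le_mul_of_nonneg_right h3 hM0).trans ?_
    rw [div_mul_eq_mul_div, div_le_div_iff₀ (by positivity) (by positivity)]
    nlinarith
  have := norm_add_le (∫ τ in (0 : ℝ)..(t - t₀), f (t - τ) • k τ)
    (∫ τ in (t - t₀)..t, f (t - τ) • k τ)
  linarith

/-! ### Generators of exponentially stable semigroups -/

section RightDerivative

variable {E : Type*} [NormedAddCommGroup E] [NormedSpace ℝ E]

theorem hasDerivWithinAt_Ici_iff_tendsto {f : ℝ → E} {y : E} {t : ℝ} :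
    HasDerivWithinAt f y (Ici t) t ↔
      Tendsto (fun h : ℝ => h⁻¹ • (f (t + h) - f t)) (𝓝[>] 0) (𝓝 y) := by
  rw [← hasDerivWithinAt_Ioi_iff_Ici, hasDerivWithinAt_iff_tendsto_slope' (by simp)]
  have h1 : map (fun h : ℝ => t + h) (𝓝[>] 0) = 𝓝[>] t := by
    simp
  rw [← h1, tendsto_map'_iff]
  refine tendsto_congr fun h => ?_
  simp [slope, Function.comp]

end RightDerivative

namespace C0Semigroup

variable {Z : Type*} [NormedAddCommGroup Z] [NormedSpace ℝ Z] {T : C0Semigroup Z}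

theorem op_add_apply (T : C0Semigroup Z) {s t : ℝ} (hs : 0 ≤ s) (ht : 0 ≤ t) (x : Z) :
    T.op (s + t) x = T.op s (T.op t x) := by
  rw [T.op_add s t hs ht]
  rfl

theorem op_zero_apply (T : C0Semigroup Z) (x : Z) : T.op 0 x = x := by
  rw [T.op_zero]
  rfl

theorem op_comm_apply (T : C0Semigroup Z) {s t : ℝ} (hs : 0 ≤ s) (ht : 0 ≤ t) (x : Z) :
    T.op s (T.op t x) = T.op t (T.op s x) := by
  rw [← T.op_add_apply hs ht, ← T.op_add_apply ht hs, add_comm]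

theorem ExpStable.exists_bound (h : T.ExpStable) : ∃ M ω : ℝ, 0 ≤ M ∧ 0 < ω ∧
    ∀ t : ℝ, 0 ≤ t → ‖T.op t‖ ≤ M * Real.exp (-ω * t) := by
  obtain ⟨M, ω, hω, hM⟩ := h
  refine ⟨M, ω, ?_, hω, hM⟩
  have := (norm_nonneg _).trans (hM 0 le_rfl)
  simpa using this

theorem ExpStable.exists_uniform_bound (h : T.ExpStable) : ∃ M : ℝ, 0 ≤ M ∧
    ∀ t : ℝ, 0 ≤ t → ‖T.op t‖ ≤ M := by
  obtain ⟨M, ω, hM0, hω, hM⟩ := h.exists_bound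
  exact ⟨M, hM0, fun t ht => (hM t ht).trans
    (mul_le_of_le_one_right hM0 (exp_neg_mul_le_one hω.le ht))⟩

/-- Joint continuity: strong continuity handles the fixed vector x₀, and the uniform bound on the
operators handles the rest. -/
theorem ExpStable.tendsto_op_apply (h : T.ExpStable) {ι : Type*} {l : Filter ι} {s : ι → ℝ}
    {x : ι → Z} {t₀ : ℝ} {x₀ : Z} (ht₀ : 0 ≤ t₀) (hs : Tendsto s l (𝓝[Ici 0] t₀))
    (hx : Tendsto x l (𝓝 x₀)) : Tendsto (fun i => T.op (s i) (x i)) l (𝓝 (T.op t₀ x₀)) := by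
  obtain ⟨M, hM0, hM⟩ := h.exists_uniform_bound
  have h1 : Tendsto (fun i => T.op (s i) x₀) l (𝓝 (T.op t₀ x₀)) :=
    (T.continuousOn x₀ t₀ ht₀).tendsto.comp hs
  have h2 : Tendsto (fun i => T.op (s i) (x i - x₀)) l (𝓝 0) := by
    have h3 : Tendsto (fun i => M * ‖x i - x₀‖) l (𝓝 0) := by
      have := (hx.sub_const x₀).norm.const_mul M
      simpa using this
    refine squeeze_zero_norm' ?_ h3
    filter_upwards [hs.eventually self_mem_nhdsWithin] with i hi
    exact ((T.op (s i)).le_opNorm _).trans (mul_le_mul_of_nonneg_right (hM _ hi) (norm_nonneg _))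
  have := h2.add h1
  simpa [map_sub] using this

theorem ExpStable.tendsto_op_atTop (h : T.ExpStable) (x : Z) :
    Tendsto (fun t => T.op t x) atTop (𝓝 0) := by
  obtain ⟨M, ω, hM0, hω, hM⟩ := h.exists_bound
  have h1 : Tendsto (fun t : ℝ => M * Real.exp (-ω * t) * ‖x‖) atTop (𝓝 0) := by
    have : Tendsto (fun t : ℝ => Real.exp (-ω * t)) atTop (𝓝 0) :=
      Real.tendsto_exp_atBot.comp (tendsto_id.const_mul_atTop_of_neg (neg_lt_zero.2 hω))
    simpa using (this.const_mul M).mul_const ‖x‖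
  refine squeeze_zero_norm' ?_ h1
  filter_upwards [eventually_ge_atTop 0] with t ht
  exact ((T.op t).le_opNorm _).trans (mul_le_mul_of_nonneg_right (hM t ht) (norm_nonneg _))

theorem Gen.unique {x y y' : Z} (h : T.Gen x y) (h' : T.Gen x y') : y = y' :=
  tendsto_nhds_unique h h'

theorem Gen.add {x y x' y' : Z} (h : T.Gen x y) (h' : T.Gen x' y') : T.Gen (x + x') (y + y') := by
  refine (Tendsto.add h h').congr fun s => ?_
  rw [← smul_add, map_add]
  abel_nf

theorem Gen.smul {x y : Z} (h : T.Gen x y) (c : ℝ) : T.Gen (c • x) (c • y) := by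
  refine (Tendsto.const_smul h c).congr fun s => ?_
  rw [map_smul, ← smul_sub, smul_comm]

theorem Gen.sub {x y x' y' : Z} (h : T.Gen x y) (h' : T.Gen x' y') : T.Gen (x - x') (y - y') := by
  simpa [sub_eq_add_neg] using h.add (h'.smul (-1))

theorem Gen.map_op {x y : Z} (h : T.Gen x y) {t : ℝ} (ht : 0 ≤ t) :
    T.Gen (T.op t x) (T.op t y) := by
  refine (((T.op t).continuous.tendsto y).comp h).congr' ?_
  filter_upwards [self_mem_nhdsWithin] with s hs
  simp only [Function.comp, map_smul, map_sub]
  rw [T.op_comm_apply ht (le_of_lt hs)]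

theorem Gen.hasDerivWithinAt_right {x y : Z} (h : T.Gen x y) {t : ℝ} (ht : 0 ≤ t) :
    HasDerivWithinAt (fun s => T.op s x) (T.op t y) (Ici t) t := by
  rw [hasDerivWithinAt_Ici_iff_tendsto]
  refine (((T.op t).continuous.tendsto y).comp h).congr' ?_
  filter_upwards [self_mem_nhdsWithin] with s hs
  simp only [Function.comp, map_smul, map_sub]
  rw [T.op_add_apply ht (le_of_lt hs)]

theorem ExpStable.integrableOn_op_apply (hT : T.ExpStable) (x : Z) :
    IntegrableOn (fun t => T.op t x) (Ioi 0) := by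
  obtain ⟨M, ω, hM0, hω, hM⟩ := hT.exists_bound
  refine Integrable.mono' (((exp_neg_integrableOn_Ioi 0 hω).const_mul M).mul_const ‖x‖)
    (((T.continuousOn x).mono Ioi_subset_Ici_self).aestronglyMeasurable measurableSet_Ioi) ?_
  refine (ae_restrict_iff' measurableSet_Ioi).2 (Eventually.of_forall fun t ht => ?_)
  exact ((T.op t).le_opNorm _).trans (mul_le_mul_of_nonneg_right (hM t (le_of_lt ht))
    (norm_nonneg _))

variable [CompleteSpace Z]

/-- The definition of the generator yields only right derivatives along an orbit. A continuous
function with vanishing right derivative is constant, and the resulting integral formula then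
supplies derivatives within [0, ∞). -/
theorem Gen.op_sub_eq_integral {x y : Z} (h : T.Gen x y) {t : ℝ} (ht : 0 ≤ t) :
    T.op t x - x = ∫ s in (0 : ℝ)..t, T.op s y := by
  have hc := T.continuousOn y
  have h1 : ∀ s ∈ Icc 0 t, T.op s x - ∫ σ in (0 : ℝ)..s, T.op σ y =
      T.op 0 x - ∫ σ in (0 : ℝ)..0, T.op σ y := by
    refine constant_of_has_deriv_right_zero (ContinuousOn.sub
      ((T.continuousOn x).mono Icc_subset_Ici_self) fun s hs =>
      ((hasDerivWithinAt_primitive hc hs.1).continuousWithinAt).mono Icc_subset_Ici_self)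
      fun s hs => ?_
    have h2 := (h.hasDerivWithinAt_right hs.1).sub
      ((hasDerivWithinAt_primitive hc hs.1).mono (Ici_subset_Ici.2 hs.1))
    rw [sub_self] at h2
    exact h2
  have h3 := h1 t ⟨ht, le_rfl⟩
  rw [intervalIntegral.integral_same, sub_zero, T.op_zero_apply] at h3
  rw [sub_eq_iff_eq_add, add_comm, ← sub_eq_iff_eq_add, h3]

theorem Gen.hasDerivWithinAt {x y : Z} (h : T.Gen x y) {t : ℝ} (ht : 0 ≤ t) :
    HasDerivWithinAt (fun s => T.op s x) (T.op t y) (Ici 0) t := by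
  have h1 := (hasDerivWithinAt_primitive (T.continuousOn y) ht).add_const x
  have h2 : ∀ s ∈ Ici (0 : ℝ), T.op s x = (∫ σ in (0 : ℝ)..s, T.op σ y) + x := fun s hs => by
    rw [← h.op_sub_eq_integral hs]
    abel
  exact h1.congr h2 (h2 t ht)

/-- The homogeneous Cauchy problem has only the trivial solution with initial value `0`. -/
theorem ExpStable.eq_zero_of_hasDerivWithinAt (hT : T.ExpStable) {W a : ℝ → Z}
    (hW : ∀ s, 0 ≤ s → HasDerivWithinAt W (a s) (Ici 0) s) (hg : ∀ s, 0 ≤ s → T.Gen (W s) (a s))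
    (h0 : W 0 = 0) {t : ℝ} (ht : 0 ≤ t) : W t = 0 := by
  have hWc : ContinuousOn W (Ici 0) := fun s hs => (hW s hs).continuousWithinAt
  -- The classical interpolation s ↦ T(t - s)W(s) joins T(t)W(0) = 0 to W(t). Its right derivative
  -- vanishes, since the increments of W and of the semigroup, `d1` and `d3`, cancel in the limit.
  have h1 : ∀ s ∈ Icc 0 t, T.op (t - s) (W s) = T.op (t - 0) (W 0) := by
    refine constant_of_has_deriv_right_zero (fun s hs => ?_) fun s hs => ?_
    · refine hT.tendsto_op_apply (sub_nonneg.2 hs.2) ?_ ((hWc s hs.1).mono Icc_subset_Ici_self)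
      refine tendsto_nhdsWithin_of_tendsto_nhds_of_eventually_within _ ?_ ?_
      · exact (Continuous.tendsto (by fun_prop) s).mono_left nhdsWithin_le_nhds
      · filter_upwards [self_mem_nhdsWithin] with u hu using sub_nonneg.2 hu.2
    · rw [hasDerivWithinAt_Ici_iff_tendsto]
      have hpos : 0 < t - s := sub_pos.2 hs.2
      have d1 : Tendsto (fun h : ℝ => T.op (t - (s + h)) (h⁻¹ • (W (s + h) - W s))) (𝓝[>] 0)
          (𝓝 (T.op (t - s) (a s))) := by
        refine hT.tendsto_op_apply hpos.le ?_
          (hasDerivWithinAt_Ici_iff_tendsto.1 ((hW s hs.1).mono (Ici_subset_Ici.2 hs.1)))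
        have hc : Tendsto (fun h : ℝ => t - (s + h)) (𝓝[>] 0) (𝓝 (t - s)) := by
          have : Tendsto (fun h : ℝ => t - (s + h)) (𝓝 0) (𝓝 (t - (s + 0))) :=
            Continuous.tendsto (by fun_prop) 0
          rw [add_zero] at this
          exact this.mono_left nhdsWithin_le_nhds
        exact tendsto_nhdsWithin_of_tendsto_nhds_of_eventually_within _ hc
          ((hc.eventually (lt_mem_nhds hpos)).mono fun u hu => le_of_lt hu)
      have d2 : HasDerivAt (fun u => T.op (t - u) (W s)) (-T.op (t - s) (a s)) s := by
        have := ((hg s hs.1).hasDerivWithinAt hpos.le).hasDerivAt (Ici_mem_nhds hpos)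
        have h2 := HasDerivAt.scomp s this ((hasDerivAt_id s).const_sub t)
        simpa [Function.comp_def] using h2
      have d3 := hasDerivWithinAt_Ici_iff_tendsto.1 (d2.hasDerivWithinAt (s := Ici s))
      have d4 := d1.add d3
      rw [add_neg_cancel] at d4
      refine d4.congr fun h => ?_
      rw [map_smul, ← smul_add, map_sub]
      abel_nf
  have h2 := h1 t ⟨ht, le_rfl⟩
  rwa [sub_self, T.op_zero_apply, h0, map_zero] at h2

/-- T(h) shifts the interval of integration from [0, t] to [h, t + h]. Dividing by h and letting h →
0 identifies the generator on integrals of orbits, and letting t → ∞ does so on integrals over [0,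
∞). -/
theorem op_integral (T : C0Semigroup Z) (x : Z) {t h : ℝ} (ht : 0 ≤ t) (hh : 0 ≤ h) :
    T.op h (∫ s in (0 : ℝ)..t, T.op s x) - ∫ s in (0 : ℝ)..t, T.op s x =
      (∫ s in (0 : ℝ)..(t + h), T.op s x) - (∫ s in (0 : ℝ)..t, T.op s x) -
        ∫ s in (0 : ℝ)..h, T.op s x := by
  have hi := LocInt.of_continuousOn (T.continuousOn x)
  have h1 : T.op h (∫ s in (0 : ℝ)..t, T.op s x) = ∫ s in h..(t + h), T.op s x := by
    rw [← ContinuousLinearMap.intervalIntegral_comp_comm _ (hi t ht)]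
    have := intervalIntegral.integral_comp_add_right (a := 0) (b := t) (fun s => T.op s x) h
    rw [zero_add] at this
    rw [← this]
    refine intervalIntegral.integral_congr fun s hs => ?_
    rw [uIcc_of_le ht] at hs
    rw [add_comm, T.op_add_apply hh hs.1]
  have h2 : (∫ s in (0 : ℝ)..(t + h), T.op s x) - ∫ s in (0 : ℝ)..h, T.op s x =
      ∫ s in h..(t + h), T.op s x :=
    intervalIntegral.integral_interval_sub_left (hi _ (add_nonneg ht hh)) (hi h hh)
  rw [h1, ← h2]
  abel

theorem gen_integral (T : C0Semigroup Z) (x : Z) {t : ℝ} (ht : 0 ≤ t) :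
    T.Gen (∫ s in (0 : ℝ)..t, T.op s x) (T.op t x - x) := by
  have hd : ∀ t, 0 ≤ t → HasDerivWithinAt (fun t => ∫ s in (0 : ℝ)..t, T.op s x) (T.op t x)
      (Ici t) t := fun t ht =>
    (hasDerivWithinAt_primitive (T.continuousOn x) ht).mono (Ici_subset_Ici.2 ht)
  have h1 := hasDerivWithinAt_Ici_iff_tendsto.1 (hd t ht)
  have h2 := hasDerivWithinAt_Ici_iff_tendsto.1 (hd 0 le_rfl)
  rw [T.op_zero_apply] at h2
  refine (h1.sub h2).congr' ?_
  filter_upwards [self_mem_nhdsWithin] with h hh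
  rw [T.op_integral x ht (le_of_lt hh), zero_add, intervalIntegral.integral_same, sub_zero,
    ← smul_sub]

/-- Exponential stability makes the Laplace transform at 0 converge, and it inverts the generator.
One direction lets t → ∞ in T(t)x - x = ∫₀ᵗ T(s)y ds, the other lets t → ∞ in `op_integral`. -/
theorem ExpStable.gen_iff_eq_integral (hT : T.ExpStable) {x y : Z} :
    T.Gen x y ↔ x = -∫ t in Ioi (0 : ℝ), T.op t y := by
  have hlim : Tendsto (fun t => ∫ s in (0 : ℝ)..t, T.op s y) atTop
      (𝓝 (∫ t in Ioi (0 : ℝ), T.op t y)) :=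
    intervalIntegral_tendsto_integral_Ioi 0 (hT.integrableOn_op_apply y) tendsto_id
  constructor
  · intro h
    have h1 : Tendsto (fun t => T.op t x - x) atTop (𝓝 (∫ t in Ioi (0 : ℝ), T.op t y)) := by
      refine hlim.congr' ?_
      filter_upwards [eventually_ge_atTop 0] with t ht
      exact (h.op_sub_eq_integral ht).symm
    have h2 := (hT.tendsto_op_atTop x).sub_const x
    rw [tendsto_nhds_unique h1 h2]
    simp
  · rintro rfl
    have h1 : ∀ h : ℝ, 0 ≤ h → T.op h (∫ t in Ioi (0 : ℝ), T.op t y) -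
        (∫ t in Ioi (0 : ℝ), T.op t y) = -∫ s in (0 : ℝ)..h, T.op s y := by
      intro h hh
      have l1 := (((T.op h).continuous.tendsto _).comp hlim).sub hlim
      have l2 := ((hlim.comp (tendsto_atTop_add_const_right _ h tendsto_id)).sub hlim).sub_const
        (∫ s in (0 : ℝ)..h, T.op s y)
      rw [sub_self, zero_sub] at l2
      refine tendsto_nhds_unique l1 (l2.congr' ?_)
      filter_upwards [eventually_ge_atTop 0] with t ht
      exact (T.op_integral y ht hh).symm
    have h2 := hasDerivWithinAt_Ici_iff_tendsto.1
      (hasDerivWithinAt_primitive (T.continuousOn y) le_rfl)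
    rw [T.op_zero_apply] at h2
    refine h2.congr' ?_
    filter_upwards [self_mem_nhdsWithin] with h hh
    rw [zero_add, intervalIntegral.integral_same, sub_zero, map_neg, ← neg_sub_neg, neg_neg,
      neg_neg, ← neg_sub, h1 h (le_of_lt hh), neg_neg]

end C0Semigroup

/-! ### Analytic semigroups and fractional powers -/

/-- The scaled Beta integral, transferred from the complex version. It is the scalar content of the
addition law for fractional powers. -/
theorem integral_rpow_mul_sub_rpow {s r x : ℝ} (hs : 0 < s) (hr : 0 < r) (hx : 0 < x) :
    ∫ t in (0 : ℝ)..x, t ^ (s - 1) * (x - t) ^ (r - 1) =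
      x ^ (s + r - 1) * (Real.Gamma s * Real.Gamma r / Real.Gamma (s + r)) := by
  have h1 := Complex.betaIntegral_scaled (s : ℂ) (r : ℂ) hx
  have h2 := Complex.Gamma_mul_Gamma_eq_betaIntegral (s := (s : ℂ)) (t := (r : ℂ))
    (by simpa using hs) (by simpa using hr)
  have h3 : Complex.Gamma ((s : ℂ) + r) ≠ 0 :=
    Complex.Gamma_ne_zero_of_re_pos (by simpa using add_pos hs hr)
  have h4 : Complex.betaIntegral s r =
      ((Real.Gamma s * Real.Gamma r / Real.Gamma (s + r) : ℝ) : ℂ) := by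
    push_cast
    rw [← Complex.Gamma_ofReal, ← Complex.Gamma_ofReal, ← Complex.Gamma_ofReal, h2]
    push_cast
    rw [mul_comm, mul_div_assoc, div_self h3, mul_one]
  have h5 : ∫ t in (0 : ℝ)..x, (t : ℂ) ^ ((s : ℂ) - 1) * ((x : ℂ) - t) ^ ((r : ℂ) - 1) =
      ((∫ t in (0 : ℝ)..x, t ^ (s - 1) * (x - t) ^ (r - 1) : ℝ) : ℂ) := by
    rw [← intervalIntegral.integral_ofReal]
    refine intervalIntegral.integral_congr fun t ht => ?_
    rw [uIcc_of_le hx.le] at ht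
    rw [Complex.ofReal_mul, Complex.ofReal_cpow ht.1, Complex.ofReal_cpow (sub_nonneg.2 ht.2)]
    push_cast
    rfl
  rw [h5, h4, show ((s : ℂ) + r - 1) = ((s + r - 1 : ℝ) : ℂ) by push_cast; rfl,
    ← Complex.ofReal_cpow hx.le, ← Complex.ofReal_mul] at h1
  exact_mod_cast h1

theorem integrableOn_rpow_mul_exp {s ω : ℝ} (hs : 0 < s) (hω : 0 < ω) :
    IntegrableOn (fun t : ℝ => t ^ (s - 1) * Real.exp (-ω * t)) (Ioi 0) := by
  simpa using integrableOn_rpow_mul_exp_neg_mul_rpow (s := s - 1) (p := 1) (b := ω)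
    (by linarith) one_pos hω

/-- This splits the singularity of ‖A e^{A(t+τ)}‖ between t and τ, leaving a power of τ that can be
integrated against τ^{-s}. -/
theorem inv_add_le_rpow {t τ θ : ℝ} (ht : 0 < t) (hτ : 0 < τ) (h0 : 0 ≤ θ) (h1 : θ ≤ 1) :
    (t + τ)⁻¹ ≤ t ^ (-θ) * τ ^ (θ - 1) := by
  have h2 : t ^ θ * τ ^ (1 - θ) ≤ t + τ := by
    calc t ^ θ * τ ^ (1 - θ) ≤ (t + τ) ^ θ * (t + τ) ^ (1 - θ) :=
          mul_le_mul (Real.rpow_le_rpow ht.le (by linarith) h0)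
            (Real.rpow_le_rpow hτ.le (by linarith) (by linarith)) (by positivity) (by positivity)
      _ = t + τ := by
          rw [← Real.rpow_add (by positivity)]
          simp
  rw [Real.rpow_neg ht.le, show θ - 1 = -(1 - θ) by ring, Real.rpow_neg hτ.le, ← mul_inv]
  exact inv_anti₀ (by positivity) h2

namespace C0Semigroup

variable {Z : Type*} [NormedAddCommGroup Z] [NormedSpace ℝ Z] {T : C0Semigroup Z}

theorem Gen.map_of_commute {x y : Z} (h : T.Gen x y) (L : Z →L[ℝ] Z)
    (hL : ∀ t, 0 ≤ t → ∀ x, L (T.op t x) = T.op t (L x)) : T.Gen (L x) (L y) := by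
  refine ((L.continuous.tendsto y).comp h).congr' ?_
  filter_upwards [self_mem_nhdsWithin] with s hs
  simp only [Function.comp, map_smul, map_sub]
  rw [hL s (le_of_lt hs)]

/-- Analyticity is assumed only on (0, 1]. For general t it is used at time ε = min(t/2, 1) after
the semigroup has run for t - ε ≥ t/2, which contributes exponential decay. -/
theorem exists_gen_op (hT : T.ExpStable) (hA : T.IsAnalytic) : ∃ c ω : ℝ, 0 ≤ c ∧ 0 < ω ∧
    ∀ t, 0 < t → ∀ x, ∃ y, T.Gen (T.op t x) y ∧ ‖y‖ ≤ c * t⁻¹ * Real.exp (-ω * t) * ‖x‖ := by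
  obtain ⟨M, ω, hM0, hω, hM⟩ := hT.exists_bound
  obtain ⟨Ma, hMa⟩ := hA
  refine ⟨|Ma| * M * (2 + 4 / ω), ω / 4, by positivity, by positivity, fun t ht x => ?_⟩
  set ε := min (t / 2) 1 with hε
  have hε0 : 0 < ε := lt_min (by linarith) one_pos
  have hεt : ε ≤ t / 2 := min_le_left _ _
  obtain ⟨y, hy, hyn⟩ := hMa ε hε0 (min_le_right _ _) (T.op (t - ε) x)
  refine ⟨y, ?_, ?_⟩
  · rwa [← T.op_add_apply hε0.le (by linarith), add_sub_cancel] at hy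
  have h1 : ‖T.op (t - ε) x‖ ≤ M * Real.exp (-ω * (t / 2)) * ‖x‖ := by
    refine ((T.op _).le_opNorm x).trans (mul_le_mul_of_nonneg_right ?_ (norm_nonneg _))
    refine (hM _ (by linarith)).trans (mul_le_mul_of_nonneg_left ?_ hM0)
    refine Real.exp_le_exp.2 ?_
    nlinarith
  have h2 : ε⁻¹ ≤ (2 + t) * t⁻¹ := by
    rw [← div_eq_mul_inv, inv_le_comm₀ hε0 (by positivity), inv_div]
    refine le_min ?_ ?_
    · rw [div_le_div_iff₀ (by positivity) (by positivity)]
      nlinarith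
    · rw [div_le_one (by positivity)]
      linarith
  -- Half of the available decay rate ω/2 absorbs the linear factor 2 + t, through t e^{-ωt/4} ≤
  -- 4/ω. The rate ω/4 remains.
  have h3 : (2 + t) * Real.exp (-ω * (t / 2)) ≤ (2 + 4 / ω) * Real.exp (-(ω / 4) * t) := by
    rw [show -ω * (t / 2) = -(ω / 4) * t + -(ω / 4) * t by ring, Real.exp_add, ← mul_assoc]
    refine mul_le_mul_of_nonneg_right ?_ (Real.exp_pos _).le
    have e1 : Real.exp (-(ω / 4) * t) ≤ 1 := exp_neg_mul_le_one (by positivity) ht.le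
    have e2 : ω / 4 * t * Real.exp (-(ω / 4) * t) ≤ 1 := by
      have := Real.add_one_le_exp (ω / 4 * t)
      have e3 : Real.exp (ω / 4 * t) * Real.exp (-(ω / 4) * t) = 1 := by
        rw [← Real.exp_add]
        simp
      nlinarith [Real.exp_pos (-(ω / 4) * t)]
    have e4 : t * Real.exp (-(ω / 4) * t) ≤ 4 / ω := by
      rw [le_div_iff₀ hω]
      linarith
    nlinarith
  have h4 : ‖y‖ ≤ ε⁻¹ * (|Ma| * ‖T.op (t - ε) x‖) := by
    rw [inv_mul_eq_div, le_div_iff₀ hε0, mul_comm]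
    exact hyn.trans (mul_le_mul_of_nonneg_right (le_abs_self _) (norm_nonneg _))
  calc ‖y‖ ≤ ε⁻¹ * (|Ma| * ‖T.op (t - ε) x‖) := h4
    _ ≤ ((2 + t) * t⁻¹) * (|Ma| * (M * Real.exp (-ω * (t / 2)) * ‖x‖)) := by gcongr
    _ = |Ma| * M * t⁻¹ * ‖x‖ * ((2 + t) * Real.exp (-ω * (t / 2))) := by ring
    _ ≤ |Ma| * M * t⁻¹ * ‖x‖ * ((2 + 4 / ω) * Real.exp (-(ω / 4) * t)) :=
        mul_le_mul_of_nonneg_left h3 (by positivity)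
    _ = _ := by ring

/-- The bounded operator `A e^{At}`, for `t > 0`. -/
def aop (T : C0Semigroup Z) (t : ℝ) : Z →L[ℝ] Z :=
  Classical.epsilon fun L : Z →L[ℝ] Z => ∀ x, T.Gen (T.op t x) (L x)

theorem gen_aop (hT : T.ExpStable) (hA : T.IsAnalytic) {t : ℝ} (ht : 0 < t) (x : Z) :
    T.Gen (T.op t x) (T.aop t x) := by
  obtain ⟨c, ω, hc, hω, h⟩ := exists_gen_op hT hA
  choose f hf hfn using h t ht
  let L : Z →ₗ[ℝ] Z :=
    { toFun := f
      map_add' := fun x y => (hf (x + y)).unique (by rw [map_add]; exact (hf x).add (hf y))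
      map_smul' := fun a x => (hf (a • x)).unique (by rw [map_smul]; exact (hf x).smul a) }
  have : ∃ L : Z →L[ℝ] Z, ∀ x, T.Gen (T.op t x) (L x) := ⟨L.mkContinuous _ hfn, hf⟩
  exact Classical.epsilon_spec this x

theorem exists_norm_aop_le (hT : T.ExpStable) (hA : T.IsAnalytic) : ∃ c ω : ℝ, 0 ≤ c ∧ 0 < ω ∧
    ∀ t, 0 < t → ‖T.aop t‖ ≤ c * t⁻¹ * Real.exp (-ω * t) := by
  obtain ⟨c, ω, hc, hω, h⟩ := exists_gen_op hT hA
  refine ⟨c, ω, hc, hω, fun t ht => ContinuousLinearMap.opNorm_le_bound _ (by positivity)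
    fun x => ?_⟩
  obtain ⟨y, hy, hyn⟩ := h t ht x
  rwa [(gen_aop hT hA ht x).unique hy]

theorem aop_add (hT : T.ExpStable) (hA : T.IsAnalytic) {s t : ℝ} (hs : 0 ≤ s) (ht : 0 < t) :
    T.aop (s + t) = (T.op s).comp (T.aop t) := by
  ext x
  refine (gen_aop hT hA (by linarith) x).unique ?_
  rw [T.op_add_apply hs ht.le]
  exact (gen_aop hT hA ht x).map_op hs

theorem aop_op (hT : T.ExpStable) (hA : T.IsAnalytic) {s t : ℝ} (hs : 0 ≤ s) (ht : 0 < t) (x : Z) :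
    T.aop t (T.op s x) = T.aop (t + s) x := by
  refine (gen_aop hT hA ht _).unique ?_
  rw [← T.op_add_apply ht.le hs]
  exact gen_aop hT hA (by linarith) x

theorem aop_commute (hT : T.ExpStable) (hA : T.IsAnalytic) {t : ℝ} (ht : 0 < t) (L : Z →L[ℝ] Z)
    (hL : ∀ t, 0 ≤ t → ∀ x, L (T.op t x) = T.op t (L x)) (x : Z) :
    L (T.aop t x) = T.aop t (L x) := by
  refine (Gen.unique ?_ ((gen_aop hT hA ht x).map_of_commute L hL)).symm
  rw [hL t ht.le]
  exact gen_aop hT hA ht _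

/-- T(t) - T(s) = T(s - a) ∫₀^{t-s} T(σ) A T(a) dσ, so the semigroup is Lipschitz in operator norm
on [a, ∞). This supplies the measurability that the operator-valued integral in `negPow` needs; a
non-integrable integrand would give the default value 0. -/
theorem continuousOn_op [CompleteSpace Z] (hT : T.ExpStable) (hA : T.IsAnalytic) :
    ContinuousOn T.op (Ioi 0) := by
  obtain ⟨M, hM0, hM⟩ := hT.exists_uniform_bound
  intro t₀ ht₀
  have ht₀' : (0 : ℝ) < t₀ := ht₀
  set a := t₀ / 2 with ha
  have ha0 : 0 < a := by positivity
  have key : ∀ s t, a ≤ s → s ≤ t → ‖T.op t - T.op s‖ ≤ M * (M * ‖T.aop a‖) * (t - s) := by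
    intro s t hs hst
    refine ContinuousLinearMap.opNorm_le_bound _
      (mul_nonneg (by positivity) (sub_nonneg.2 hst)) fun x => ?_
    have e1 : T.op s x = T.op (s - a) (T.op a x) := by
      rw [← T.op_add_apply (sub_nonneg.2 hs) ha0.le, sub_add_cancel]
    have e2 : T.op t x = T.op (s - a) (T.op (t - s) (T.op a x)) := by
      rw [← T.op_add_apply (sub_nonneg.2 hst) ha0.le,
        ← T.op_add_apply (sub_nonneg.2 hs) (by linarith)]
      congr 2
      ring
    rw [sub_apply, e1, e2, ← map_sub,
      (gen_aop hT hA ha0 x).op_sub_eq_integral (sub_nonneg.2 hst)]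
    have e3 : ‖∫ σ in (0 : ℝ)..(t - s), T.op σ (T.aop a x)‖ ≤
        M * (‖T.aop a‖ * ‖x‖) * |t - s - 0| := by
      refine intervalIntegral.norm_integral_le_of_norm_le_const fun σ hσ => ?_
      rw [uIoc_of_le (sub_nonneg.2 hst)] at hσ
      exact ((T.op σ).le_opNorm _).trans (mul_le_mul (hM σ hσ.1.le) ((T.aop a).le_opNorm x)
        (norm_nonneg _) hM0)
    rw [sub_zero, abs_of_nonneg (sub_nonneg.2 hst)] at e3
    refine ((T.op _).le_opNorm _).trans ((mul_le_mul (hM _ (sub_nonneg.2 hs)) e3 (norm_nonneg _)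
      hM0).trans_eq ?_)
    ring
  refine ContinuousAt.continuousWithinAt ?_
  rw [ContinuousAt, tendsto_iff_norm_sub_tendsto_zero]
  have h2 : Tendsto (fun t => M * (M * ‖T.aop a‖) * |t - t₀|) (𝓝 t₀) (𝓝 0) := by
    have : Tendsto (fun t => M * (M * ‖T.aop a‖) * |t - t₀|) (𝓝 t₀)
      (𝓝 (M * (M * ‖T.aop a‖) * |t₀ - t₀|)) := Continuous.tendsto (by fun_prop) t₀
    simpa using this
  refine squeeze_zero' (Eventually.of_forall fun _ => norm_nonneg _) ?_ h2
  filter_upwards [Ioi_mem_nhds (show a < t₀ by linarith)] with t ht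
  have ht' : a < t := ht
  rcases le_total t₀ t with h | h
  · rw [abs_of_nonneg (sub_nonneg.2 h)]
    exact key t₀ t (by linarith) h
  · rw [abs_of_nonpos (sub_nonpos.2 h), norm_sub_rev, neg_sub]
    exact key t t₀ ht'.le h

theorem continuousOn_aop [CompleteSpace Z] (hT : T.ExpStable) (hA : T.IsAnalytic) :
    ContinuousOn T.aop (Ioi 0) := by
  intro t₀ ht₀
  have ht₀' : (0 : ℝ) < t₀ := ht₀
  set a := t₀ / 2 with ha
  have ha0 : 0 < a := by positivity
  have h1 : ContinuousAt T.op (t₀ - a) :=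
    (continuousOn_op hT hA).continuousAt (Ioi_mem_nhds (by linarith))
  have h2 : ContinuousAt (fun t => (T.op (t - a)).comp (T.aop a)) t₀ :=
    (ContinuousAt.comp (f := fun t => t - a) h1 (by fun_prop)).clm_comp continuousAt_const
  refine (h2.congr ?_).continuousWithinAt
  filter_upwards [Ioi_mem_nhds (show a < t₀ by linarith)] with t ht
  rw [← aop_add hT hA (sub_nonneg.2 (le_of_lt ht)) ha0, sub_add_cancel]

/-! ### Fractional powers and the extrapolation spaces -/

section NegPow

theorem uniformContinuous_preNegMap (T : C0Semigroup Z) (s : ℝ) :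
    UniformContinuous (T.preNegMap s) :=
  ((T.preNegMap s).mkContinuous 1 fun x => (one_mul ‖x‖).symm.le).uniformContinuous

theorem negPow_zero (T : C0Semigroup Z) (x : Z) : T.negPow 0 x = x := by simp [negPow]

variable [CompleteSpace Z]

theorem integrableOn_rpow_smul_op (hT : T.ExpStable) (hA : T.IsAnalytic) {s : ℝ} (hs : 0 < s) :
    IntegrableOn (fun t : ℝ => t ^ (s - 1) • T.op t) (Ioi 0) := by
  obtain ⟨M, ω, hM0, hω, hM⟩ := hT.exists_bound
  refine Integrable.mono' ((integrableOn_rpow_mul_exp hs hω).const_mul M) ?_ ?_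
  · have h1 : ContinuousOn (fun t : ℝ => t ^ (s - 1)) (Ioi 0) :=
      continuousOn_id.rpow_const fun t ht => Or.inl (ne_of_gt ht)
    exact (h1.smul (continuousOn_op hT hA)).aestronglyMeasurable measurableSet_Ioi
  · refine (ae_restrict_iff' measurableSet_Ioi).2 (Eventually.of_forall fun t ht => ?_)
    have ht' : (0 : ℝ) < t := ht
    rw [norm_smul, Real.norm_of_nonneg (by positivity)]
    calc t ^ (s - 1) * ‖T.op t‖ ≤ t ^ (s - 1) * (M * Real.exp (-ω * t)) :=
          mul_le_mul_of_nonneg_left (hM t ht'.le) (by positivity)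
      _ = _ := by ring

theorem negPow_apply (hT : T.ExpStable) (hA : T.IsAnalytic) {s : ℝ} (hs : 0 < s) (x : Z) :
    T.negPow s x = (Real.Gamma s)⁻¹ • ∫ t in Ioi (0 : ℝ), t ^ (s - 1) • T.op t x := by
  rw [negPow, if_neg hs.ne', smul_apply,
    ContinuousLinearMap.integral_apply (integrableOn_rpow_smul_op hT hA hs)]
  rfl

theorem integrableOn_rpow_smul_op_apply (hT : T.ExpStable) (hA : T.IsAnalytic) {s : ℝ} (hs : 0 < s)
    (x : Z) : IntegrableOn (fun t : ℝ => t ^ (s - 1) • T.op t x) (Ioi 0) :=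
  (integrableOn_rpow_smul_op hT hA hs).apply_continuousLinearMap x

theorem map_negPow (hT : T.ExpStable) (hA : T.IsAnalytic) {s : ℝ} (hs : 0 < s) (L : Z →L[ℝ] Z)
    (x : Z) : L (T.negPow s x) =
      (Real.Gamma s)⁻¹ • ∫ t in Ioi (0 : ℝ), t ^ (s - 1) • L (T.op t x) := by
  rw [negPow_apply hT hA hs, map_smul,
    ← L.integral_comp_comm (integrableOn_rpow_smul_op_apply hT hA hs x)]
  simp only [map_smul]

theorem negPow_op (hT : T.ExpStable) (hA : T.IsAnalytic) {s : ℝ} (hs : 0 ≤ s) {t : ℝ} (ht : 0 ≤ t)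
    (x : Z) : T.negPow s (T.op t x) = T.op t (T.negPow s x) := by
  rcases hs.eq_or_lt with rfl | hs
  · simp [negPow_zero]
  rw [map_negPow hT hA hs, negPow_apply hT hA hs]
  congr 1
  refine setIntegral_congr_fun measurableSet_Ioi fun τ hτ => ?_
  rw [T.op_comm_apply ht (le_of_lt hτ)]

/-- The convolution of t^{s-1} T(t) and t^{r-1} T(t) is a Beta factor times u^{s+r-1} T(u), and the
Gamma functions cancel that factor. -/
theorem negPow_negPow (hT : T.ExpStable) (hA : T.IsAnalytic) {s r : ℝ} (hs : 0 ≤ s) (hr : 0 ≤ r)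
    (x : Z) : T.negPow s (T.negPow r x) = T.negPow (s + r) x := by
  rcases hs.eq_or_lt with rfl | hs
  · simp [negPow_zero]
  rcases hr.eq_or_lt with rfl | hr
  · simp [negPow_zero]
  have h1 := integral_posConvolution (integrableOn_rpow_smul_op hT hA hs)
    (integrableOn_rpow_smul_op hT hA hr) (ContinuousLinearMap.compL ℝ Z Z Z)
  have h2 : ∀ u ∈ Ioi (0 : ℝ), (∫ t in (0 : ℝ)..u, (ContinuousLinearMap.compL ℝ Z Z Z
      (t ^ (s - 1) • T.op t)) ((u - t) ^ (r - 1) • T.op (u - t))) =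
      (Real.Gamma s * Real.Gamma r / Real.Gamma (s + r)) • u ^ (s + r - 1) • T.op u := by
    intro u hu
    have hu' : (0 : ℝ) < u := hu
    have e1 : ∀ t ∈ uIcc 0 u, (ContinuousLinearMap.compL ℝ Z Z Z
        (t ^ (s - 1) • T.op t)) ((u - t) ^ (r - 1) • T.op (u - t)) =
        (t ^ (s - 1) * (u - t) ^ (r - 1)) • T.op u := by
      intro t ht
      rw [uIcc_of_le hu'.le] at ht
      rw [ContinuousLinearMap.compL_apply, ContinuousLinearMap.smul_comp,
        ContinuousLinearMap.comp_smul, ← T.op_add t (u - t) ht.1 (sub_nonneg.2 ht.2),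
        add_sub_cancel, smul_smul]
    rw [intervalIntegral.integral_congr e1, intervalIntegral.integral_smul_const,
      integral_rpow_mul_sub_rpow hs hr hu', smul_smul, mul_comm]
  rw [setIntegral_congr_fun measurableSet_Ioi h2, integral_smul] at h1
  have hΓs := (Real.Gamma_pos_of_pos hs).ne'
  have hΓr := (Real.Gamma_pos_of_pos hr).ne'
  have h3 : (T.negPow s).comp (T.negPow r) = T.negPow (s + r) := by
    simp only [negPow, if_neg hs.ne', if_neg hr.ne', if_neg (add_pos hs hr).ne']
    rw [ContinuousLinearMap.smul_comp, ContinuousLinearMap.comp_smul,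
      ← ContinuousLinearMap.compL_apply, ← h1, smul_smul, smul_smul]
    congr 1
    field_simp
  exact DFunLike.congr_fun h3 x

theorem inv_apply (hT : T.ExpStable) (hA : T.IsAnalytic) (x : Z) :
    T.inv x = -∫ t in Ioi (0 : ℝ), T.op t x := by
  rw [inv, neg_apply, negPow_apply hT hA one_pos]
  simp

theorem gen_iff (hT : T.ExpStable) (hA : T.IsAnalytic) {x y : Z} : T.Gen x y ↔ x = T.inv y := by
  rw [inv_apply hT hA, hT.gen_iff_eq_integral]

theorem inv_injective (hT : T.ExpStable) (hA : T.IsAnalytic) : Function.Injective T.inv :=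
  fun _ _ h => ((gen_iff hT hA).2 rfl).unique ((gen_iff hT hA).2 h)

theorem inv_op (hT : T.ExpStable) (hA : T.IsAnalytic) {t : ℝ} (ht : 0 ≤ t) (x : Z) :
    T.inv (T.op t x) = T.op t (T.inv x) := by
  simp only [inv, neg_apply, map_neg, negPow_op hT hA zero_le_one ht]

theorem inv_aop (hT : T.ExpStable) (hA : T.IsAnalytic) {t : ℝ} (ht : 0 < t) (x : Z) :
    T.inv (T.aop t x) = T.op t x := ((gen_iff hT hA).1 (gen_aop hT hA ht x)).symm

theorem negPow_injective (hT : T.ExpStable) (hA : T.IsAnalytic) {s : ℝ} (h0 : 0 ≤ s) (h1 : s ≤ 1) :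
    Function.Injective (T.negPow s) := by
  intro x y h
  refine inv_injective hT hA ?_
  have e : ∀ x, T.inv x = -T.negPow (1 - s) (T.negPow s x) := fun x => by
    rw [negPow_negPow hT hA (sub_nonneg.2 h1) h0, sub_add_cancel]
    rfl
  rw [e, e, h]

/-- The bounded operator `(-A)^s e^{At}`, for `0 ≤ s < 1` and `t > 0`. -/
def powOp (T : C0Semigroup Z) (s t : ℝ) : Z →L[ℝ] Z := -(T.aop t).comp (T.negPow (1 - s))

theorem negPow_powOp (hT : T.ExpStable) (hA : T.IsAnalytic) {s t : ℝ} (h0 : 0 ≤ s) (h1 : s ≤ 1)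
    (ht : 0 < t) (x : Z) : T.negPow s (T.powOp s t x) = T.op t x := by
  rw [powOp, neg_apply, ContinuousLinearMap.comp_apply,
    ← aop_commute hT hA ht (T.negPow (1 - s)) fun t ht x => negPow_op hT hA (sub_nonneg.2 h1) ht x,
    map_neg, negPow_negPow hT hA h0 (sub_nonneg.2 h1), add_sub_cancel]
  exact inv_aop hT hA ht x

theorem continuousOn_powOp (hT : T.ExpStable) (hA : T.IsAnalytic) (s : ℝ) :
    ContinuousOn (T.powOp s) (Ioi 0) :=
  ((continuousOn_aop hT hA).clm_comp continuousOn_const).neg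

/-- Writing (-A)^s e^{At} as -A e^{At} (-A)^{-(1-s)} leads to the integral of τ^{-s} ‖A e^{A(t+τ)}‖.
`inv_add_le_rpow` bounds it by t^{-θ} times the integral of τ^{θ-s-1} e^{-ωτ}, which converges
because θ > s. The exponent is not sharp, but the strict inequalities between the exponents of the
system leave room for it. -/
theorem exists_norm_powOp_le (hT : T.ExpStable) (hA : T.IsAnalytic) {s θ : ℝ} (h0 : 0 ≤ s)
    (hθ : s < θ) (h1 : θ < 1) : ∃ c ω : ℝ, 0 ≤ c ∧ 0 < ω ∧
      ∀ t, 0 < t → ‖T.powOp s t‖ ≤ c * t ^ (-θ) * Real.exp (-ω * t) := by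
  obtain ⟨c, ω, hc, hω, h⟩ := exists_norm_aop_le hT hA
  have hs1 : 0 < 1 - s := by linarith
  have hΓ := Real.Gamma_pos_of_pos hs1
  have hI := integrableOn_rpow_mul_exp (s := θ - s) (by linarith) hω
  set I := ∫ τ in Ioi (0 : ℝ), τ ^ (θ - s - 1) * Real.exp (-ω * τ) with hIdef
  have hI0 : 0 ≤ I := setIntegral_nonneg measurableSet_Ioi fun τ hτ => by
    have : (0 : ℝ) < τ := hτ
    positivity
  refine ⟨(Real.Gamma (1 - s))⁻¹ * c * I, ω, by positivity, hω, fun t ht => ?_⟩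
  refine ContinuousLinearMap.opNorm_le_bound _ (by positivity) fun x => ?_
  rw [powOp, neg_apply, norm_neg, ContinuousLinearMap.comp_apply,
    map_negPow hT hA hs1, norm_smul, Real.norm_of_nonneg (by positivity)]
  have hb : ‖∫ τ in Ioi (0 : ℝ), τ ^ (1 - s - 1) • T.aop t (T.op τ x)‖ ≤
      ∫ τ in Ioi (0 : ℝ), c * t ^ (-θ) * Real.exp (-ω * t) * ‖x‖ *
        (τ ^ (θ - s - 1) * Real.exp (-ω * τ)) := by
    refine norm_integral_le_of_norm_le (hI.const_mul _) ?_
    refine (ae_restrict_iff' measurableSet_Ioi).2 (Eventually.of_forall fun τ hτ => ?_)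
    have hτ' : (0 : ℝ) < τ := hτ
    rw [aop_op hT hA hτ'.le ht, norm_smul, Real.norm_of_nonneg (by positivity)]
    calc τ ^ (1 - s - 1) * ‖T.aop (t + τ) x‖
        ≤ τ ^ (1 - s - 1) * (c * (t + τ)⁻¹ * Real.exp (-ω * (t + τ)) * ‖x‖) := by
          refine mul_le_mul_of_nonneg_left ?_ (by positivity)
          exact ((T.aop _).le_opNorm x).trans
            (mul_le_mul_of_nonneg_right (h _ (by positivity)) (norm_nonneg _))
      _ ≤ τ ^ (1 - s - 1) * (c * (t ^ (-θ) * τ ^ (θ - 1)) * Real.exp (-ω * (t + τ)) * ‖x‖) := by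
          gcongr
          exact inv_add_le_rpow ht hτ' (by linarith) h1.le
      _ = _ := by
          rw [show θ - s - 1 = (1 - s - 1) + (θ - 1) by ring, Real.rpow_add hτ',
            show -ω * (t + τ) = -ω * t + -ω * τ by ring, Real.exp_add]
          ring
  rw [integral_const_mul, ← hIdef] at hb
  calc (Real.Gamma (1 - s))⁻¹ * ‖∫ τ in Ioi (0 : ℝ), τ ^ (1 - s - 1) • T.aop t (T.op τ x)‖
      ≤ (Real.Gamma (1 - s))⁻¹ * (c * t ^ (-θ) * Real.exp (-ω * t) * ‖x‖ * I) :=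
        mul_le_mul_of_nonneg_left hb (by positivity)
    _ = _ := by ring

/-- A⁻¹ factors through (-A)^{-s}, which is isometric for the norm of Z^{-s}. This is what makes A⁻¹
uniformly continuous there, so that its extension to the completion is the genuine continuous one.
-/
theorem preInv_eq (hT : T.ExpStable) (hA : T.IsAnalytic) {s : ℝ} (h0 : 0 ≤ s) (h1 : s ≤ 1)
    (x : T.PreNeg s) : T.preInv s x = (-T.negPow (1 - s)) (T.preNegMap s x) := by
  have := negPow_negPow hT hA (sub_nonneg.2 h1) h0 x
  rw [sub_add_cancel] at this
  exact congrArg Neg.neg this.symm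

theorem uniformContinuous_preInv (hT : T.ExpStable) (hA : T.IsAnalytic) {s : ℝ} (h0 : 0 ≤ s)
    (h1 : s ≤ 1) : UniformContinuous (T.preInv s) := by
  rw [funext (preInv_eq hT hA h0 h1)]
  exact (-T.negPow (1 - s)).uniformContinuous.comp (T.uniformContinuous_preNegMap s)

/-- `A⁻¹` maps `Z^{-s}` into `Z^{1-s}`. -/
theorem exists_invExt_eq (hT : T.ExpStable) (hA : T.IsAnalytic) {s : ℝ} (h0 : 0 ≤ s) (h1 : s ≤ 1)
    (b : T.ZNeg s) : ∃ h : Z, T.invExt s b = T.negPow (1 - s) h := by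
  have hu := T.uniformContinuous_preNegMap s
  refine ⟨-UniformSpace.Completion.extension (T.preNegMap s) b, ?_⟩
  rw [map_neg, invExt, UniformSpace.Completion.extension_unique
    (uniformContinuous_preInv hT hA h0 h1)
    ((-T.negPow (1 - s)).uniformContinuous.comp UniformSpace.Completion.uniformContinuous_extension)
    fun a => by
      rw [Function.comp_apply, UniformSpace.Completion.extension_coe hu]
      exact preInv_eq hT hA h0 h1 a]
  rfl

theorem invExt_smul (hT : T.ExpStable) (hA : T.IsAnalytic) {s : ℝ} (h0 : 0 ≤ s) (h1 : s ≤ 1)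
    (c : ℝ) (b : T.ZNeg s) : T.invExt s (c • b) = c • T.invExt s b := by
  have hu := uniformContinuous_preInv hT hA h0 h1
  have hc : Continuous (T.invExt s) := UniformSpace.Completion.continuous_extension
  induction b using UniformSpace.Completion.induction_on with
  | hp => exact isClosed_eq (hc.comp (continuous_const_smul c)) (hc.const_smul c)
  | ih a =>
    rw [← UniformSpace.Completion.coe_smul, invExt, UniformSpace.Completion.extension_coe hu,
      UniformSpace.Completion.extension_coe hu]
    exact map_smul T.inv c a

end NegPow

end C0Semigroup

namespace Plant

variable {Z : Type*} [NormedAddCommGroup Z] [NormedSpace ℝ Z] {P : Plant Z}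

/-! ### The output operator and the admissible input vectors -/

/-- `(-A)^{-s_c}`. -/
def N (P : Plant Z) : Z →L[ℝ] Z := P.T.negPow P.sc

/-- `(-A)^{s_c}` on `Z^{s_c}`. -/
def unN (P : Plant Z) : Z → Z := Function.invFun P.N

/-- The bounded functional `C (-A)^{-s_c}` on `Z`. -/
def Standing.obs (hP : P.Standing) : Z →L[ℝ] ℝ :=
  (P.C ∘ₗ (P.T.negPow P.sc : Z →ₗ[ℝ] Z).rangeRestrict).mkContinuous hP.C_bounded.choose fun h => by
    have h1 := hP.C_bounded.choose_spec h
    have h2 : P.T.negPow P.sc h ∈ P.T.ZPos P.sc := LinearMap.mem_range_self _ h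
    rw [out, dif_pos h2] at h1
    exact h1

theorem N_mem (P : Plant Z) (h : Z) : P.N h ∈ P.T.ZPos P.sc := LinearMap.mem_range_self _ h

theorem mem_iff {z : Z} : z ∈ P.T.ZPos P.sc ↔ ∃ h, P.N h = z := LinearMap.mem_range

theorem Standing.out_N (hP : P.Standing) (h : Z) : P.out (P.N h) = hP.obs h := by
  rw [out, dif_pos (P.N_mem h)]
  rfl

theorem Standing.out_add (hP : P.Standing) {z z' : Z} (hz : z ∈ P.T.ZPos P.sc)
    (hz' : z' ∈ P.T.ZPos P.sc) : P.out (z + z') = P.out z + P.out z' := by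
  obtain ⟨h, rfl⟩ := mem_iff.1 hz
  obtain ⟨h', rfl⟩ := mem_iff.1 hz'
  rw [← map_add, hP.out_N, hP.out_N, hP.out_N, map_add]

theorem Standing.out_smul (hP : P.Standing) {z : Z} (hz : z ∈ P.T.ZPos P.sc) (a : ℝ) :
    P.out (a • z) = a * P.out z := by
  obtain ⟨h, rfl⟩ := mem_iff.1 hz
  rw [← map_smul, hP.out_N, hP.out_N, map_smul, smul_eq_mul]

theorem Standing.out_neg (hP : P.Standing) {z : Z} (hz : z ∈ P.T.ZPos P.sc) :
    P.out (-z) = -P.out z := by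
  rw [← neg_one_smul ℝ z, hP.out_smul hz, neg_one_mul]

theorem Standing.out_sum (hP : P.Standing) {z : ℕ → Z} (hz : ∀ j, z j ∈ P.T.ZPos P.sc) (n : ℕ) :
    P.out (∑ j ∈ Finset.range (n + 1), z j) = ∑ j ∈ Finset.range (n + 1), P.out (z j) := by
  induction n with
  | zero => simp
  | succ n ih =>
    rw [Finset.sum_range_succ, hP.out_add (Submodule.sum_mem _ fun j _ => hz j) (hz _), ih,
      Finset.sum_range_succ _ (n + 1)]

theorem N_unN {z : Z} (hz : z ∈ P.T.ZPos P.sc) : P.N (P.unN z) = z :=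
  Function.invFun_eq (mem_iff.1 hz)

/-- `p` is an integrable kernel with `e^{Aτ} A g = (-A)^{-s_c} p(τ)`. -/
def Adm (P : Plant Z) (g : Z) (p : ℝ → Z) : Prop :=
  IntegrableOn p (Ioi 0) ∧ ∀ τ, 0 < τ → P.T.inv (P.N (p τ)) = P.T.op τ g

theorem Adm.add {g g' : Z} {p p' : ℝ → Z} (h : P.Adm g p) (h' : P.Adm g' p') :
    P.Adm (g + g') fun τ => p τ + p' τ :=
  ⟨h.1.add h'.1, fun τ hτ => by rw [map_add, map_add, map_add, h.2 τ hτ, h'.2 τ hτ]⟩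

theorem Adm.smul {g : Z} {p : ℝ → Z} (h : P.Adm g p) (a : ℝ) : P.Adm (a • g) fun τ => a • p τ :=
  ⟨h.1.smul a, fun τ hτ => by rw [map_smul, map_smul, map_smul, h.2 τ hτ]⟩

/-- The kernel `τ ↦ (-A)^{s_c} e^{Aτ} A g` of an admissible vector `g`. -/
def ker (P : Plant Z) (g : Z) : ℝ → Z := Classical.epsilon fun p => P.Adm g p

theorem adm_ker {g : Z} {p : ℝ → Z} (h : P.Adm g p) : P.Adm g (P.ker g) :=
  Classical.epsilon_spec (p := fun p => P.Adm g p) ⟨p, h⟩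

/-- The mild solution with two admissible input channels. -/
def mild (P : Plant Z) (g₁ g₂ : Z) (f₁ f₂ : ℝ → ℝ) (z₀ : Z) (t : ℝ) : Z :=
  P.T.op t z₀ + P.N (cv (P.ker g₁) f₁ t + cv (P.ker g₂) f₂ t)

theorem mild_zero (P : Plant Z) (g₁ g₂ : Z) (f₁ f₂ : ℝ → ℝ) (z₀ : Z) :
    P.mild g₁ g₂ f₁ f₂ z₀ 0 = z₀ := by
  simp [mild, cv_zero_time, P.T.op_zero_apply]

theorem continuousOn_mild {g₁ g₂ : Z} (h₁ : P.Adm g₁ (P.ker g₁))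
    (h₂ : P.Adm g₂ (P.ker g₂)) {f₁ f₂ : ℝ → ℝ} (hf₁ : ContinuousOn f₁ (Ici 0))
    (hf₂ : ContinuousOn f₂ (Ici 0)) (z₀ : Z) : ContinuousOn (P.mild g₁ g₂ f₁ f₂ z₀) (Ici 0) :=
  (P.T.continuousOn z₀).add (P.N.continuous.comp_continuousOn
    ((continuousOn_cv (LocInt.of_integrableOn h₁.1) hf₁).add
      (continuousOn_cv (LocInt.of_integrableOn h₂.1) hf₂)))

variable [CompleteSpace Z]

theorem Standing.N_injective (hP : P.Standing) : Function.Injective P.N :=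
  C0Semigroup.negPow_injective hP.expStable hP.analytic hP.sc_nonneg hP.sc_lt.le

theorem Standing.unN_N (hP : P.Standing) (h : Z) : P.unN (P.N h) = h :=
  Function.leftInverse_invFun hP.N_injective h

theorem Standing.unN_zero (hP : P.Standing) : P.unN 0 = 0 := by
  simpa using hP.unN_N 0

theorem Standing.N_op (hP : P.Standing) {t : ℝ} (ht : 0 ≤ t) (x : Z) :
    P.N (P.T.op t x) = P.T.op t (P.N x) :=
  C0Semigroup.negPow_op hP.expStable hP.analytic hP.sc_nonneg ht x

/-- With g = (-A)^{-(1-s)}h the required kernel is -(-A)^{s_c} e^{Aτ/2} (-A)^s e^{Aτ/2} h. Each half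
of the time pays for one fractional power, and the combined singularity is integrable because s_c +
s < 1. -/
theorem Standing.exists_adm_invExt (hP : P.Standing) {s : ℝ} (h0 : 0 ≤ s) (h1 : s < 1)
    (hs : P.sc + s < 1) (b : P.T.ZNeg s) : ∃ p, P.Adm (P.T.invExt s b) p := by
  have hT := hP.expStable
  have hA := hP.analytic
  have hc0 := hP.sc_nonneg
  obtain ⟨h, hh⟩ := C0Semigroup.exists_invExt_eq hT hA h0 h1.le b
  rw [hh]
  -- Both factors lose δ in the exponent; the total θ = s_c + s + 2δ equals (1 + s_c + s)/2, still
  -- below 1.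
  set δ := (1 - P.sc - s) / 4 with hδ
  have hδ0 : 0 < δ := by linarith
  obtain ⟨c₁, ω₁, hc₁, hω₁, hb₁⟩ := C0Semigroup.exists_norm_powOp_le hT hA hc0
    (θ := P.sc + δ) (by linarith) (by linarith)
  obtain ⟨c₂, ω₂, hc₂, hω₂, hb₂⟩ := C0Semigroup.exists_norm_powOp_le hT hA h0
    (θ := s + δ) (by linarith) (by linarith)
  refine ⟨fun τ => -P.T.powOp P.sc (τ / 2) (P.T.powOp s (τ / 2) h), ?_, fun τ hτ => ?_⟩
  · set θ := P.sc + s + 2 * δ with hθ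
    have hint := (integrableOn_rpow_mul_exp (s := 1 - θ) (ω := (ω₁ + ω₂) / 2) (by linarith)
      (by positivity)).const_mul (c₁ * c₂ * 2 ^ θ * ‖h‖)
    refine Integrable.mono' hint ?_ ?_
    · refine ContinuousOn.aestronglyMeasurable (ContinuousOn.neg ?_) measurableSet_Ioi
      have hm : MapsTo (fun τ : ℝ => τ / 2) (Ioi 0) (Ioi 0) := fun τ hτ => mem_Ioi.2 (half_pos hτ)
      have hc : ContinuousOn (fun τ : ℝ => τ / 2) (Ioi 0) := by fun_prop
      exact ((C0Semigroup.continuousOn_powOp hT hA P.sc).comp hc hm).clm_apply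
        (((C0Semigroup.continuousOn_powOp hT hA s).comp hc hm).clm_apply continuousOn_const)
    · refine (ae_restrict_iff' measurableSet_Ioi).2 (Eventually.of_forall fun τ hτ => ?_)
      have hτ0 : (0 : ℝ) < τ := hτ
      have hτ2 : 0 < τ / 2 := half_pos hτ0
      have e1 : (τ / 2) ^ (-(P.sc + δ)) * (τ / 2) ^ (-(s + δ)) = 2 ^ θ * τ ^ (1 - θ - 1) := by
        rw [← Real.rpow_add hτ2, show -(P.sc + δ) + -(s + δ) = -θ by rw [hθ]; ring,
          Real.div_rpow hτ0.le zero_le_two, Real.rpow_neg zero_le_two, div_inv_eq_mul,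
          show 1 - θ - 1 = -θ by ring, mul_comm]
      have e2 : Real.exp (-ω₁ * (τ / 2)) * Real.exp (-ω₂ * (τ / 2)) =
          Real.exp (-((ω₁ + ω₂) / 2) * τ) := by
        rw [← Real.exp_add]
        congr 1
        ring
      rw [norm_neg]
      calc ‖P.T.powOp P.sc (τ / 2) (P.T.powOp s (τ / 2) h)‖
          ≤ ‖P.T.powOp P.sc (τ / 2)‖ * (‖P.T.powOp s (τ / 2)‖ * ‖h‖) :=
            ((P.T.powOp P.sc _).le_opNorm _).trans
              (mul_le_mul_of_nonneg_left ((P.T.powOp s _).le_opNorm h) (norm_nonneg _))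
        _ ≤ (c₁ * (τ / 2) ^ (-(P.sc + δ)) * Real.exp (-ω₁ * (τ / 2))) *
            ((c₂ * (τ / 2) ^ (-(s + δ)) * Real.exp (-ω₂ * (τ / 2))) * ‖h‖) := by
            have := hb₁ _ hτ2
            have := hb₂ _ hτ2
            gcongr
        _ = c₁ * c₂ * ‖h‖ * ((τ / 2) ^ (-(P.sc + δ)) * (τ / 2) ^ (-(s + δ))) *
            (Real.exp (-ω₁ * (τ / 2)) * Real.exp (-ω₂ * (τ / 2))) := by ring
        _ = _ := by
            rw [e1, e2]
            ring
  · have hτ2 : 0 < τ / 2 := half_pos hτ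
    have e1 : P.N (P.T.powOp P.sc (τ / 2) (P.T.powOp s (τ / 2) h)) =
        P.T.op (τ / 2) (P.T.powOp s (τ / 2) h) :=
      C0Semigroup.negPow_powOp hT hA hc0 hP.sc_lt.le hτ2 _
    have e2 := C0Semigroup.aop_add hT hA hτ2.le hτ2
    rw [add_halves] at e2
    rw [map_neg, e1, C0Semigroup.powOp, neg_apply, map_neg, map_neg, map_neg, neg_neg,
      ContinuousLinearMap.comp_apply, ← ContinuousLinearMap.comp_apply (P.T.op _), ← e2]
    exact C0Semigroup.inv_aop hT hA hτ _

theorem Standing.invExt_mem (hP : P.Standing) {s : ℝ} (h0 : 0 ≤ s) (h1 : s < 1)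
    (hs : P.sc + s < 1) (b : P.T.ZNeg s) : P.T.invExt s b ∈ P.T.ZPos P.sc := by
  obtain ⟨h, hh⟩ := C0Semigroup.exists_invExt_eq hP.expStable hP.analytic h0 h1.le b
  have := C0Semigroup.negPow_negPow hP.expStable hP.analytic hP.sc_nonneg
    (show 0 ≤ 1 - s - P.sc by linarith) h
  rw [show P.sc + (1 - s - P.sc) = 1 - s by ring] at this
  rw [hh, ← this]
  exact P.N_mem _

theorem Standing.adm_invBin (hP : P.Standing) : P.Adm P.invBin (P.ker P.invBin) :=
  adm_ker (hP.exists_adm_invExt hP.sb_nonneg hP.sb_lt hP.sc_add_sb P.b).choose_spec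

theorem Standing.adm_invBd (hP : P.Standing) : P.Adm P.invBd (P.ker P.invBd) :=
  adm_ker (hP.exists_adm_invExt hP.sd_nonneg hP.sd_lt hP.sc_add_sd P.bd).choose_spec

theorem Standing.adm_invB (hP : P.Standing) : P.Adm P.invB (P.ker P.invB) :=
  adm_ker (hP.exists_adm_invExt hP.sb_nonneg hP.sb_lt hP.sc_add_sb P.B).choose_spec

theorem Standing.adm_invI0Bd (hP : P.Standing) : P.Adm P.invI0Bd (P.ker P.invI0Bd) :=
  adm_ker (hP.adm_invBd.add (hP.adm_invB.smul _))

theorem Standing.invBin_mem (hP : P.Standing) : P.invBin ∈ P.T.ZPos P.sc :=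
  hP.invExt_mem hP.sb_nonneg hP.sb_lt hP.sc_add_sb P.b

theorem Standing.invBd_mem (hP : P.Standing) : P.invBd ∈ P.T.ZPos P.sc :=
  hP.invExt_mem hP.sd_nonneg hP.sd_lt hP.sc_add_sd P.bd

theorem Standing.invB_mem (hP : P.Standing) : P.invB ∈ P.T.ZPos P.sc :=
  hP.invExt_mem hP.sb_nonneg hP.sb_lt hP.sc_add_sb P.B

theorem Standing.invI0Bd_mem (hP : P.Standing) : P.invI0Bd ∈ P.T.ZPos P.sc :=
  Submodule.add_mem _ hP.invBd_mem (Submodule.smul_mem _ _ hP.invB_mem)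

theorem Standing.invB_eq (hP : P.Standing) : P.invB = P.G⁻¹ • P.invBin :=
  C0Semigroup.invExt_smul hP.expStable hP.analytic hP.sb_nonneg hP.sb_lt.le _ _

/-- This normalization, CA⁻¹B = -1, is the purpose of dividing by G. It yields K(0) = 1 and the
stationary output 1 for the constant input 1. -/
theorem Standing.out_invB (hP : P.Standing) : P.out P.invB = -1 := by
  have h1 : P.G = -P.out P.invBin := hP.out_neg hP.invBin_mem
  rw [hP.invB_eq, hP.out_smul hP.invBin_mem, ← neg_eq_iff_eq_neg.2 h1, mul_neg,
    inv_mul_cancel₀ hP.G_ne_zero]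

/-- I₀ is designed to remove the stationary effect of the disturbance: CA⁻¹I₀ = CA⁻¹ + (CA⁻¹B)CA⁻¹ =
0. -/
theorem Standing.out_invI0Bd (hP : P.Standing) : P.out P.invI0Bd = 0 := by
  rw [invI0Bd, hP.out_add hP.invBd_mem (Submodule.smul_mem _ _ hP.invB_mem),
    hP.out_smul hP.invB_mem, hP.out_invB]
  ring

/-! ### Mild solutions -/

theorem Standing.integral_adm (hP : P.Standing) {g : Z} {p : ℝ → Z} (hg : P.Adm g p) {t : ℝ}
    (ht : 0 ≤ t) : ∫ τ in (0 : ℝ)..t, P.N (p τ) = P.T.op t g - g := by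
  -- The vector g need not lie in the domain of A, so the identity is verified after applying the
  -- injective operator A⁻¹.
  refine C0Semigroup.inv_injective hP.expStable hP.analytic ?_
  have hp := LocInt.of_integrableOn hg.1 t ht
  have e1 := ((P.T.inv).comp P.N).intervalIntegral_comp_comm hp
  have e2 := P.N.intervalIntegral_comp_comm hp
  rw [← (C0Semigroup.gen_iff hP.expStable hP.analytic).1 (P.T.gen_integral g ht), e2,
    ← ContinuousLinearMap.comp_apply, ← e1]
  refine intervalIntegral.integral_congr_ae (Eventually.of_forall fun τ hτ => ?_)
  rw [uIoc_of_le ht] at hτ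
  exact hg.2 τ hτ.1

/-- Variation of constants in integrated form. A⁻¹ turns the kernel into e^{Aτ}g, so the left side
is the integral of f(σ)e^{A(t-σ)}g. On the right, exchanging integrations gives f(σ)(e^{A(t-σ)}g -
g) by `integral_adm`, and the term f(σ)g restores the difference. -/
theorem Standing.inv_N_cv (hP : P.Standing) {g : Z} {p : ℝ → Z} (hg : P.Adm g p) {f : ℝ → ℝ}
    (hf : ContinuousOn f (Ici 0)) {t : ℝ} (ht : 0 ≤ t) :
    P.T.inv (P.N (cv p f t)) = ∫ s in (0 : ℝ)..t, (P.N (cv p f s) + f s • g) := by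
  have hp := LocInt.of_integrableOn hg.1
  have hNp : LocInt fun τ => P.N (p τ) :=
    LocInt.of_integrableOn (P.N.integrable_comp hg.1)
  have hTg := P.T.continuousOn g
  have e1 : P.T.inv (P.N (cv p f t)) = cv (fun τ => P.T.op τ g) f t := by
    have := map_cv ((P.T.inv).comp P.N) hp hf ht
    rw [ContinuousLinearMap.comp_apply] at this
    rw [this]
    exact cv_congr_left (fun τ hτ => hg.2 τ hτ) ht
  have e2 : cv (fun τ => P.T.op τ g) f t = ∫ σ in (0 : ℝ)..t, f σ • P.T.op (t - σ) g := by
    have := intervalIntegral.integral_comp_sub_left (a := 0) (b := t)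
      (fun σ => f σ • P.T.op (t - σ) g) t
    simpa [cv] using this
  have e3 : ∫ s in (0 : ℝ)..t, P.N (cv p f s) = ∫ s in (0 : ℝ)..t, cv (fun τ => P.N (p τ)) f s := by
    refine intervalIntegral.integral_congr fun s hs => ?_
    rw [uIcc_of_le ht] at hs
    exact map_cv P.N hp hf hs.1
  have e4 : ∀ s, 0 ≤ s → ∫ σ in (0 : ℝ)..s, f σ = cv f (fun _ => 1) s := fun s _ => by simp [cv]
  have e5 : ∫ s in (0 : ℝ)..t, P.N (cv p f s) =
      ∫ σ in (0 : ℝ)..t, (f σ • P.T.op (t - σ) g - f σ • g) := by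
    rw [e3, integral_cv hNp hf ht, cv_congr e4 ht, cv_cv hNp hf continuousOn_const ht]
    refine intervalIntegral.integral_congr fun σ hσ => ?_
    rw [uIcc_of_le ht] at hσ
    have := hP.integral_adm hg (sub_nonneg.2 hσ.2)
    simp only [cv, one_smul, this, smul_sub]
  have i1 : IntervalIntegrable (fun s => P.N (cv p f s)) volume 0 t :=
    LocInt.of_continuousOn (P.N.continuous.comp_continuousOn (continuousOn_cv hp hf)) t ht
  have i2 : IntervalIntegrable (fun s => f s • g) volume 0 t :=
    LocInt.of_continuousOn (hf.smul continuousOn_const) t ht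
  have i3 : IntervalIntegrable (fun σ => f σ • P.T.op (t - σ) g) volume 0 t := by
    refine ContinuousOn.intervalIntegrable ?_
    rw [uIcc_of_le ht]
    exact (hf.mono Icc_subset_Ici_self).smul
      (hTg.comp (by fun_prop) fun σ hσ => sub_nonneg.2 hσ.2)
  rw [e1, e2, intervalIntegral.integral_add i1 i2, e5, intervalIntegral.integral_sub i3 i2]
  abel

theorem Standing.hasDerivWithinAt_inv_cv (hP : P.Standing) {g : Z} {p : ℝ → Z} (hg : P.Adm g p)
    {f : ℝ → ℝ} (hf : ContinuousOn f (Ici 0)) {t : ℝ} (ht : 0 ≤ t) :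
    HasDerivWithinAt (fun t => P.T.inv (P.N (cv p f t))) (P.N (cv p f t) + f t • g) (Ici 0) t := by
  have hc : ContinuousOn (fun s => P.N (cv p f s) + f s • g) (Ici 0) :=
    (P.N.continuous.comp_continuousOn
      (continuousOn_cv (LocInt.of_integrableOn hg.1) hf)).add (hf.smul continuousOn_const)
  exact (hasDerivWithinAt_primitive hc ht).congr (fun s hs => hP.inv_N_cv hg hf hs)
    (hP.inv_N_cv hg hf ht)

theorem Standing.hasDerivWithinAt_inv_op (hP : P.Standing) (x : Z) {t : ℝ} (ht : 0 ≤ t) :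
    HasDerivWithinAt (fun t => P.T.inv (P.T.op t x)) (P.T.op t x) (Ici 0) t := by
  have h1 := ((C0Semigroup.gen_iff hP.expStable hP.analytic).2
    (rfl : P.T.inv x = P.T.inv x)).hasDerivWithinAt ht
  have h2 := fun s (hs : s ∈ Ici (0 : ℝ)) => C0Semigroup.inv_op hP.expStable hP.analytic hs x
  exact h1.congr h2 (h2 t ht)

/-- A⁻¹(z - z') takes values in the domain of A and is a classical solution of the homogeneous
problem, hence zero. -/
theorem Standing.eq_of_hasDerivWithinAt_inv (hP : P.Standing) {z z' F : ℝ → Z}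
    (hz : ∀ t, 0 ≤ t → HasDerivWithinAt (fun t => P.T.inv (z t)) (z t + F t) (Ici 0) t)
    (hz' : ∀ t, 0 ≤ t → HasDerivWithinAt (fun t => P.T.inv (z' t)) (z' t + F t) (Ici 0) t)
    (h0 : z 0 = z' 0) {t : ℝ} (ht : 0 ≤ t) : z t = z' t := by
  have h1 : P.T.inv (z t) - P.T.inv (z' t) = 0 := by
    refine hP.expStable.eq_zero_of_hasDerivWithinAt
      (W := fun t => P.T.inv (z t) - P.T.inv (z' t)) (a := fun t => z t - z' t)
      (fun s hs => ?_) (fun s hs => ?_) (by simp [h0]) ht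
    · have := (hz s hs).fun_sub (hz' s hs)
      rwa [add_sub_add_right_eq_sub] at this
    · simp only [← map_sub]
      exact (C0Semigroup.gen_iff hP.expStable hP.analytic).2 rfl
  exact C0Semigroup.inv_injective hP.expStable hP.analytic (sub_eq_zero.1 h1)

theorem Standing.hasDerivWithinAt_mild (hP : P.Standing) {g₁ g₂ : Z} (h₁ : P.Adm g₁ (P.ker g₁))
    (h₂ : P.Adm g₂ (P.ker g₂)) {f₁ f₂ : ℝ → ℝ} (hf₁ : ContinuousOn f₁ (Ici 0))
    (hf₂ : ContinuousOn f₂ (Ici 0)) (z₀ : Z) {t : ℝ} (ht : 0 ≤ t) :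
    HasDerivWithinAt (fun t => P.T.inv (P.mild g₁ g₂ f₁ f₂ z₀ t))
      (P.mild g₁ g₂ f₁ f₂ z₀ t + (f₁ t • g₁ + f₂ t • g₂)) (Ici 0) t := by
  have h := ((hP.hasDerivWithinAt_inv_op z₀ ht).fun_add (hP.hasDerivWithinAt_inv_cv h₁ hf₁ ht)).fun_add
    (hP.hasDerivWithinAt_inv_cv h₂ hf₂ ht)
  have e : (fun t => P.T.inv (P.mild g₁ g₂ f₁ f₂ z₀ t)) = fun t => P.T.inv (P.T.op t z₀) +
      P.T.inv (P.N (cv (P.ker g₁) f₁ t)) + P.T.inv (P.N (cv (P.ker g₂) f₂ t)) := by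
    funext t
    simp only [mild, map_add]
    abel
  rw [e]
  convert h using 1
  simp only [mild, map_add]
  abel

theorem Standing.eq_mild (hP : P.Standing) {g₁ g₂ : Z} (h₁ : P.Adm g₁ (P.ker g₁))
    (h₂ : P.Adm g₂ (P.ker g₂)) {f₁ f₂ : ℝ → ℝ} (hf₁ : ContinuousOn f₁ (Ici 0))
    (hf₂ : ContinuousOn f₂ (Ici 0)) {z : ℝ → Z}
    (hz : ∀ t, 0 ≤ t → HasDerivWithinAt (fun t => P.T.inv (z t))
      (z t + (f₁ t • g₁ + f₂ t • g₂)) (Ici 0) t) {t : ℝ} (ht : 0 ≤ t) :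
    z t = P.mild g₁ g₂ f₁ f₂ (z 0) t :=
  hP.eq_of_hasDerivWithinAt_inv hz (fun _ hs => hP.hasDerivWithinAt_mild h₁ h₂ hf₁ hf₂ (z 0) hs)
    (P.mild_zero _ _ _ _ _).symm ht

end Plant

namespace Plant

variable {Z : Type*} [NormedAddCommGroup Z] [NormedSpace ℝ Z] {P : Plant Z} {β : ℝ}

/-! ### Solutions of the regularized system -/

/-- The scalar input `v / β - ((1 - β) / β) y` of the regularized system. -/
def inp (β : ℝ) (v y : ℝ → ℝ) (t : ℝ) : ℝ := 1 / β * v t - (1 - β) / β * y t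

theorem continuousOn_inp {v y : ℝ → ℝ} (hv : ContinuousOn v (Ici 0)) (hy : ContinuousOn y (Ici 0)) :
    ContinuousOn (inp β v y) (Ici 0) := (hv.const_mul _).sub (hy.const_mul _)

theorem cv_inp {E : Type*} [NormedAddCommGroup E] [NormedSpace ℝ E] {p : ℝ → E} (hp : LocInt p)
    {v y : ℝ → ℝ} (hv : ContinuousOn v (Ici 0)) (hy : ContinuousOn y (Ici 0)) {t : ℝ}
    (ht : 0 ≤ t) :
    cv p (inp β v y) t = (1 / β) • cv p v t - ((1 - β) / β) • cv p y t := by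
  have h1 : ∀ s, 0 ≤ s → inp β v y s = 1 / β * v s + -((1 - β) / β) * y s := fun s _ => by
    rw [inp]
    ring
  rw [cv_congr h1 ht, cv_add hp (hv.const_mul _) (hy.const_mul _) ht, cv_const_mul, cv_const_mul,
    neg_smul, ← sub_eq_add_neg]

theorem IsBetaSolution.add (hP : P.Standing) {v w v' w' : ℝ → ℝ} {z₀ z₀' : Z} {z z' : ℝ → Z}
    (h : P.IsBetaSolution β v w z₀ z) (h' : P.IsBetaSolution β v' w' z₀' z') :
    P.IsBetaSolution β (fun t => v t + v' t) (fun t => w t + w' t) (z₀ + z₀')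
      (fun t => z t + z' t) := by
  have ho : ∀ t, 0 ≤ t → P.out (z t + z' t) = P.out (z t) + P.out (z' t) :=
    fun t ht => hP.out_add (h.mem t ht) (h'.mem t ht)
  refine ⟨h.continuousOn.add h'.continuousOn,
    fun t ht => Submodule.add_mem _ (h.mem t ht) (h'.mem t ht),
    (h.out_continuousOn.add h'.out_continuousOn).congr fun t ht => ho t ht,
    by rw [h.initial, h'.initial], fun t ht => ?_⟩
  have := (h.equation t ht).fun_add (h'.equation t ht)
  simp only [map_add]
  convert this using 1
  rw [ho t ht]
  module

theorem IsBetaSolution.smul (hP : P.Standing) {v w : ℝ → ℝ} {z₀ : Z} {z : ℝ → Z}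
    (h : P.IsBetaSolution β v w z₀ z) (a : ℝ) :
    P.IsBetaSolution β (fun t => a * v t) (fun t => a * w t) (a • z₀) (fun t => a • z t) := by
  have ho : ∀ t, 0 ≤ t → P.out (a • z t) = a * P.out (z t) :=
    fun t ht => hP.out_smul (h.mem t ht) a
  refine ⟨h.continuousOn.const_smul a, fun t ht => Submodule.smul_mem _ a (h.mem t ht),
    (h.out_continuousOn.const_mul a).congr fun t ht => ho t ht, by rw [h.initial], fun t ht => ?_⟩
  have := (h.equation t ht).fun_const_smul a
  simp only [map_smul]
  convert this using 1
  rw [ho t ht]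
  module

theorem IsBetaSolution.congr {v w v' w' : ℝ → ℝ} {z₀ : Z} {z : ℝ → Z}
    (h : P.IsBetaSolution β v w z₀ z) (hv : ∀ t, 0 ≤ t → v' t = v t)
    (hw : ∀ t, 0 ≤ t → w' t = w t) : P.IsBetaSolution β v' w' z₀ z :=
  ⟨h.continuousOn, h.mem, h.out_continuousOn, h.initial, fun t ht => by
    rw [hv t ht, hw t ht]
    exact h.equation t ht⟩

theorem IsBetaSolution.sub (hP : P.Standing) {v w v' w' : ℝ → ℝ} {z₀ z₀' : Z} {z z' : ℝ → Z}
    (h : P.IsBetaSolution β v w z₀ z) (h' : P.IsBetaSolution β v' w' z₀' z') :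
    P.IsBetaSolution β (fun t => v t - v' t) (fun t => w t - w' t) (z₀ - z₀')
      (fun t => z t - z' t) := by
  have := h.add hP (h'.smul hP (-1))
  simpa [sub_eq_add_neg] using this

theorem IsBetaSolution.shift {v w : ℝ → ℝ} {z₀ : Z} {z : ℝ → Z}
    (h : P.IsBetaSolution β v w z₀ z) {a : ℝ} (ha : 0 ≤ a) :
    P.IsBetaSolution β (fun t => v (a + t)) (fun t => w (a + t)) (z a) (fun t => z (a + t)) := by
  have hm : MapsTo (fun t => a + t) (Ici 0) (Ici 0) := fun t ht => add_nonneg ha ht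
  have hc : ContinuousOn (fun t => a + t) (Ici 0) := by fun_prop
  refine ⟨h.continuousOn.comp hc hm, fun t ht => h.mem _ (hm ht), h.out_continuousOn.comp hc hm,
    by rw [add_zero], fun t ht => ?_⟩
  have h1 := HasDerivWithinAt.scomp t (h.equation (a + t) (hm ht))
    ((hasDerivWithinAt_id t (Ici 0)).const_add a) hm
  rw [one_smul] at h1
  exact h1

theorem Standing.out_eq_obs_unN (hP : P.Standing) {z : Z} (hz : z ∈ P.T.ZPos P.sc) :
    P.out z = hP.obs (P.unN z) := by
  conv_lhs => rw [← N_unN hz]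
  rw [hP.out_N]

theorem Standing.abs_out_le (hP : P.Standing) {z : Z} (hz : z ∈ P.T.ZPos P.sc) :
    |P.out z| ≤ ‖hP.obs‖ * ‖P.unN z‖ := by
  rw [hP.out_eq_obs_unN hz]
  exact hP.obs.le_opNorm _

variable [CompleteSpace Z]

/-- `(-A)^{s_c}` applied to the solution with output `y` and initial value `(-A)^{-s_c} h₀`. -/
def state (P : Plant Z) (β : ℝ) (v w y : ℝ → ℝ) (h₀ : Z) (t : ℝ) : Z :=
  P.T.op t h₀ + (cv (P.ker P.invB) (inp β v y) t + cv (P.ker P.invI0Bd) w t)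

theorem Standing.mild_eq_N_state (hP : P.Standing) (v w y : ℝ → ℝ) (h₀ : Z) {t : ℝ} (ht : 0 ≤ t) :
    P.mild P.invB P.invI0Bd (inp β v y) w (P.N h₀) t = P.N (P.state β v w y h₀ t) := by
  rw [mild, state, map_add P.N (P.T.op t h₀), hP.N_op ht]

theorem Standing.locInt_ker (hP : P.Standing) : LocInt (P.ker P.invB) ∧
    LocInt (P.ker P.invI0Bd) :=
  ⟨LocInt.of_integrableOn hP.adm_invB.1, LocInt.of_integrableOn hP.adm_invI0Bd.1⟩

theorem Standing.continuousOn_state (hP : P.Standing) {v w y : ℝ → ℝ}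
    (hv : ContinuousOn v (Ici 0)) (hw : ContinuousOn w (Ici 0)) (hy : ContinuousOn y (Ici 0))
    (h₀ : Z) : ContinuousOn (P.state β v w y h₀) (Ici 0) :=
  (P.T.continuousOn h₀).add ((continuousOn_cv hP.locInt_ker.1 (continuousOn_inp hv hy)).add
    (continuousOn_cv hP.locInt_ker.2 hw))

/-- `C e^{At} B`. -/
def Standing.kerB (hP : P.Standing) (t : ℝ) : ℝ := hP.obs (P.ker P.invB t)

/-- `C e^{At} I₀ B_d`. -/
def Standing.kerD (hP : P.Standing) (t : ℝ) : ℝ := hP.obs (P.ker P.invI0Bd t)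

theorem Standing.integrableOn_kerB (hP : P.Standing) : IntegrableOn hP.kerB (Ioi 0) :=
  hP.obs.integrable_comp hP.adm_invB.1

theorem Standing.integrableOn_kerD (hP : P.Standing) : IntegrableOn hP.kerD (Ioi 0) :=
  hP.obs.integrable_comp hP.adm_invI0Bd.1

/-- The part of the output that does not depend on the feedback. -/
def Standing.forcing (hP : P.Standing) (β : ℝ) (v w : ℝ → ℝ) (h₀ : Z) (t : ℝ) : ℝ :=
  hP.obs (P.T.op t h₀) + (1 / β * cv hP.kerB v t + cv hP.kerD w t)

theorem Standing.obs_state (hP : P.Standing) {v w y : ℝ → ℝ}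
    (hv : ContinuousOn v (Ici 0)) (hw : ContinuousOn w (Ici 0)) (hy : ContinuousOn y (Ici 0))
    (h₀ : Z) {t : ℝ} (ht : 0 ≤ t) :
    hP.obs (P.state β v w y h₀ t) =
      hP.forcing β v w h₀ t + -((1 - β) / β) * cv hP.kerB y t := by
  have h1 := cv_inp (β := β) (LocInt.of_integrableOn hP.integrableOn_kerB) hv hy ht
  rw [state, map_add, map_add, map_cv hP.obs hP.locInt_ker.1 (continuousOn_inp hv hy) ht,
    map_cv hP.obs hP.locInt_ker.2 hw ht, forcing]
  change _ + (cv hP.kerB (inp β v y) t + cv hP.kerD w t) = _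
  rw [h1, smul_eq_mul, smul_eq_mul]
  ring

theorem Standing.continuousOn_forcing (hP : P.Standing) {v w : ℝ → ℝ}
    (hv : ContinuousOn v (Ici 0)) (hw : ContinuousOn w (Ici 0)) (h₀ : Z) :
    ContinuousOn (hP.forcing β v w h₀) (Ici 0) :=
  (hP.obs.continuous.comp_continuousOn (P.T.continuousOn h₀)).add
    (((continuousOn_cv (LocInt.of_integrableOn hP.integrableOn_kerB) hv).const_mul _).add
      (continuousOn_cv (LocInt.of_integrableOn hP.integrableOn_kerD) hw))

theorem IsBetaSolution.eq_N_state (hP : P.Standing) {v w : ℝ → ℝ} {z₀ : Z} {z : ℝ → Z}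
    (h : P.IsBetaSolution β v w z₀ z) (hv : ContinuousOn v (Ici 0)) (hw : ContinuousOn w (Ici 0))
    {t : ℝ} (ht : 0 ≤ t) :
    z t = P.N (P.state β v w (fun s => P.out (z s)) (P.unN z₀) t) := by
  have hz₀ : z₀ ∈ P.T.ZPos P.sc := h.initial ▸ h.mem 0 le_rfl
  have h1 := hP.eq_mild hP.adm_invB hP.adm_invI0Bd (continuousOn_inp (β := β) hv h.out_continuousOn)
    hw (z := z) (fun t ht => by
      convert h.equation t ht using 1
      rw [inp]
      module) ht
  rw [h.initial] at h1
  rw [← hP.mild_eq_N_state _ _ _ _ ht, N_unN hz₀]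
  exact h1

theorem IsBetaSolution.unN_eq (hP : P.Standing) {v w : ℝ → ℝ} {z₀ : Z} {z : ℝ → Z}
    (h : P.IsBetaSolution β v w z₀ z) (hv : ContinuousOn v (Ici 0)) (hw : ContinuousOn w (Ici 0))
    {t : ℝ} (ht : 0 ≤ t) :
    P.unN (z t) = P.state β v w (fun s => P.out (z s)) (P.unN z₀) t := by
  rw [h.eq_N_state hP hv hw ht, hP.unN_N]

theorem IsBetaSolution.continuousOn_unN (hP : P.Standing) {v w : ℝ → ℝ} {z₀ : Z} {z : ℝ → Z}
    (h : P.IsBetaSolution β v w z₀ z) (hv : ContinuousOn v (Ici 0)) (hw : ContinuousOn w (Ici 0)) :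
    ContinuousOn (fun t => P.unN (z t)) (Ici 0) :=
  (hP.continuousOn_state hv hw h.out_continuousOn _).congr fun _ ht => h.unN_eq hP hv hw ht

/-- The output of the regularized system solves a Volterra equation. -/
theorem IsBetaSolution.out_eq (hP : P.Standing) {v w : ℝ → ℝ} {z₀ : Z} {z : ℝ → Z}
    (h : P.IsBetaSolution β v w z₀ z) (hv : ContinuousOn v (Ici 0)) (hw : ContinuousOn w (Ici 0))
    {t : ℝ} (ht : 0 ≤ t) :
    P.out (z t) = hP.forcing β v w (P.unN z₀) t +
      -((1 - β) / β) * cv hP.kerB (fun s => P.out (z s)) t := by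
  rw [hP.out_eq_obs_unN (h.mem t ht), h.unN_eq hP hv hw ht,
    hP.obs_state hv hw h.out_continuousOn _ ht]

theorem Standing.bc_forcing (hP : P.Standing) {v w : ℝ → ℝ} (hv : Bc v) (hw : Bc w) (h₀ : Z) :
    Bc (hP.forcing β v w h₀) := by
  obtain ⟨M, hM0, hM⟩ := hP.expStable.exists_uniform_bound
  have h1 : Bc fun t => hP.obs (P.T.op t h₀) := by
    refine ⟨hP.obs.continuous.comp_continuousOn (P.T.continuousOn h₀), ‖hP.obs‖ * (M * ‖h₀‖),
      fun t ht => (hP.obs.le_opNorm _).trans (mul_le_mul_of_nonneg_left ?_ (norm_nonneg _))⟩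
    exact ((P.T.op t).le_opNorm _).trans (mul_le_mul_of_nonneg_right (hM t ht) (norm_nonneg _))
  exact h1.add (((Bc.cv hP.integrableOn_kerB hv).const_mul _).add (Bc.cv hP.integrableOn_kerD hw))

/-- The output is found first, from the scalar Volterra equation. Inserting it as feedback into the
mild formula produces a state whose output is the prescribed one. -/
theorem Standing.exists_betaSolution (hP : P.Standing) (β : ℝ) {v w : ℝ → ℝ} (hv : Bc v)
    (hw : Bc w) {z₀ : Z} (hz₀ : z₀ ∈ P.T.ZPos P.sc) : ∃ z, P.IsBetaSolution β v w z₀ z := by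
  obtain ⟨h₀, rfl⟩ := mem_iff.1 hz₀
  obtain ⟨y, hy, hyeq⟩ := exists_volterra_solution hP.integrableOn_kerB (-((1 - β) / β))
    (hP.bc_forcing (β := β) hv hw h₀)
  have hi := continuousOn_inp (β := β) hv.1 hy
  have hmem : ∀ t, 0 ≤ t →
      P.mild P.invB P.invI0Bd (inp β v y) w (P.N h₀) t ∈ P.T.ZPos P.sc := fun t ht => by
    rw [hP.mild_eq_N_state _ _ _ _ ht]
    exact P.N_mem _
  have hout : ∀ t, 0 ≤ t → P.out (P.mild P.invB P.invI0Bd (inp β v y) w (P.N h₀) t) = y t :=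
    fun t ht => by
    rw [hP.mild_eq_N_state _ _ _ _ ht, hP.out_N, hP.obs_state hv.1 hw.1 hy _ ht, ← hyeq t ht]
  refine ⟨P.mild P.invB P.invI0Bd (inp β v y) w (P.N h₀),
    continuousOn_mild hP.adm_invB hP.adm_invI0Bd hi hw.1 _, hmem, hy.congr hout, P.mild_zero _ _ _ _ _,
    fun t ht => ?_⟩
  convert hP.hasDerivWithinAt_mild hP.adm_invB hP.adm_invI0Bd hi hw.1 (P.N h₀) ht using 1
  rw [hout t ht, inp]
  module

/-- Continuous dependence on bounded time intervals, in the norm of `Z^{s_c}`. -/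
theorem Standing.exists_unN_bound (hP : P.Standing) (β : ℝ) : ∃ c : ℝ → ℝ, (∀ T, 0 ≤ c T) ∧
    ∀ (v w : ℝ → ℝ) (z₀ : Z) (z : ℝ → Z), ContinuousOn v (Ici 0) → ContinuousOn w (Ici 0) →
      P.IsBetaSolution β v w z₀ z → ∀ T b : ℝ, 0 ≤ T → 0 ≤ b →
        (∀ t, 0 ≤ t → t ≤ T → |v t| ≤ b ∧ |w t| ≤ b) →
        ∀ t, 0 ≤ t → t ≤ T → ‖P.unN (z t)‖ ≤ c T * (‖P.unN z₀‖ + b) := by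
  obtain ⟨cV, hcV0, hcV⟩ := volterra_bounds hP.integrableOn_kerB (-((1 - β) / β))
  obtain ⟨M, hM0, hM⟩ := hP.expStable.exists_uniform_bound
  set Ik := ∫ τ in Ioi (0 : ℝ), ‖hP.kerB τ‖ with hIk
  set Id := ∫ τ in Ioi (0 : ℝ), ‖hP.kerD τ‖ with hId
  set Ip := ∫ τ in Ioi (0 : ℝ), ‖P.ker P.invB τ‖ with hIp
  set Iq := ∫ τ in Ioi (0 : ℝ), ‖P.ker P.invI0Bd τ‖ with hIq
  have hIk0 : 0 ≤ Ik := integral_nonneg fun _ => norm_nonneg _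
  have hId0 : 0 ≤ Id := integral_nonneg fun _ => norm_nonneg _
  have hIp0 : 0 ≤ Ip := integral_nonneg fun _ => norm_nonneg _
  have hIq0 : 0 ≤ Iq := integral_nonneg fun _ => norm_nonneg _
  set C₁ := ‖hP.obs‖ * M + (|1 / β| * Ik + Id) with hC₁
  have hC₁0 : 0 ≤ C₁ := by positivity
  -- M bounds the free part, and Ip and Iq are the L¹ norms of the two state kernels. Multiplying by
  -- `cV T * C₁` bounds the output through the Volterra estimate, and hence the feedback input.
  refine ⟨fun T => M + (Ip * (|1 / β| + |(1 - β) / β| * (cV T * C₁)) + Iq), fun T => ?_,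
    fun v w z₀ z hv hw h T b hT hb hvw t ht htT => ?_⟩
  · have := hcV0 T
    positivity
  set h₀ := P.unN z₀ with hh₀
  have hop : ∀ s, 0 ≤ s → ‖P.T.op s h₀‖ ≤ M * ‖h₀‖ := fun s hs =>
    ((P.T.op s).le_opNorm _).trans (mul_le_mul_of_nonneg_right (hM s hs) (norm_nonneg _))
  have hfor : ∀ s, 0 ≤ s → s ≤ T → |hP.forcing β v w h₀ s| ≤ C₁ * (‖h₀‖ + b) := by
    intro s hs hsT
    have e1 : |hP.obs (P.T.op s h₀)| ≤ ‖hP.obs‖ * (M * ‖h₀‖) :=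
      (hP.obs.le_opNorm _).trans (mul_le_mul_of_nonneg_left (hop s hs) (norm_nonneg _))
    have e2 : |cv hP.kerB v s| ≤ Ik * b := norm_cv_le_Ioi hP.integrableOn_kerB hs hb
      fun u h0 h1 => (hvw u h0 (h1.trans hsT)).1
    have e3 : |cv hP.kerD w s| ≤ Id * b := norm_cv_le_Ioi hP.integrableOn_kerD hs hb
      fun u h0 h1 => (hvw u h0 (h1.trans hsT)).2
    calc |hP.forcing β v w h₀ s|
        ≤ |hP.obs (P.T.op s h₀)| + (|1 / β * cv hP.kerB v s| + |cv hP.kerD w s|) :=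
          (abs_add_le _ _).trans (add_le_add_right (abs_add_le _ _) _)
      _ ≤ ‖hP.obs‖ * (M * ‖h₀‖) + (|1 / β| * (Ik * b) + Id * b) := by
          rw [abs_mul]
          gcongr
      _ ≤ C₁ * (‖h₀‖ + b) := by
          have e4 : 0 ≤ ‖hP.obs‖ * M * b := by positivity
          have e5 : 0 ≤ (|1 / β| * Ik + Id) * ‖h₀‖ := by positivity
          rw [hC₁]
          linarith
  have hy := (hcV _ _ (hP.continuousOn_forcing (β := β) hv hw h₀) h.out_continuousOn
    (fun s hs => h.out_eq hP hv hw hs) T hT).1 _ hfor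
  have hi : ∀ s, 0 ≤ s → s ≤ t → |inp β v (fun s => P.out (z s)) s| ≤
      (|1 / β| + |(1 - β) / β| * (cV T * C₁)) * (‖h₀‖ + b) := by
    intro s hs hst
    have e1 := hy s hs (hst.trans htT)
    have e2 := (hvw s hs (hst.trans htT)).1
    calc |inp β v (fun s => P.out (z s)) s|
        ≤ |1 / β * v s| + |(1 - β) / β * P.out (z s)| := abs_sub _ _
      _ ≤ |1 / β| * (‖h₀‖ + b) + |(1 - β) / β| * (cV T * (C₁ * (‖h₀‖ + b))) := by
          rw [abs_mul, abs_mul]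
          gcongr
          linarith [norm_nonneg h₀]
      _ = _ := by ring
  have hK : 0 ≤ (|1 / β| + |(1 - β) / β| * (cV T * C₁)) := by
    have := hcV0 T
    positivity
  rw [h.unN_eq hP hv hw ht, ← hh₀, state]
  have e1 := norm_cv_le_Ioi hP.adm_invB.1 ht (mul_nonneg hK (by positivity)) hi
  have e2 := norm_cv_le_Ioi (f := w) hP.adm_invI0Bd.1 ht hb
    fun u h0 h1 => (hvw u h0 (h1.trans htT)).2
  rw [← hIp] at e1
  rw [← hIq] at e2
  calc ‖P.T.op t h₀ + (cv (P.ker P.invB) (inp β v fun s => P.out (z s)) t +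
        cv (P.ker P.invI0Bd) w t)‖
      ≤ M * ‖h₀‖ + (Ip * ((|1 / β| + |(1 - β) / β| * (cV T * C₁)) * (‖h₀‖ + b)) + Iq * b) :=
        (norm_add_le _ _).trans (add_le_add (hop t ht) ((norm_add_le _ _).trans (add_le_add e1 e2)))
    _ ≤ _ := by
        have e4 : 0 ≤ M * b := by positivity
        have e5 : 0 ≤ Iq * ‖h₀‖ := by positivity
        linarith

theorem IsBetaSolution.unique (hP : P.Standing) {v w : ℝ → ℝ} {z₀ : Z} {z z' : ℝ → Z}
    (h : P.IsBetaSolution β v w z₀ z) (h' : P.IsBetaSolution β v w z₀ z') {t : ℝ} (ht : 0 ≤ t) :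
    z t = z' t := by
  obtain ⟨c, -, hc⟩ := hP.exists_unN_bound β
  have h1 := (h.sub hP h').congr (v' := fun _ => 0) (w' := fun _ => 0) (by simp) (by simp)
  have h2 := hc _ _ _ _ continuousOn_const continuousOn_const h1 t 0 ht le_rfl (by simp) t ht le_rfl
  rw [sub_self, hP.unN_zero, norm_zero, add_zero, mul_zero, norm_le_zero_iff] at h2
  have h3 := N_unN (h1.mem t ht)
  rw [h2, map_zero] at h3
  exact sub_eq_zero.1 h3.symm

/-- Smoothing in the mean: the `Z^{s_c}` norm of a free solution is integrable up to `t = 0`, with a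
bound by the norm of `Z`. -/
theorem Standing.exists_integral_unN_bound (hP : P.Standing) (β : ℝ) : ∃ c : ℝ, 0 ≤ c ∧
    ∀ (z₀ : Z) (z : ℝ → Z), P.IsBetaSolution β (fun _ => 0) (fun _ => 0) z₀ z →
      ∫ t in (0 : ℝ)..1, ‖P.unN (z t)‖ ≤ c * ‖z₀‖ := by
  obtain ⟨cV, hcV0, hcV⟩ := volterra_bounds hP.integrableOn_kerB (-((1 - β) / β))
  obtain ⟨c₁, ω, hc₁, hω, hb⟩ := C0Semigroup.exists_norm_powOp_le hP.expStable hP.analytic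
    hP.sc_nonneg (θ := (P.sc + 1) / 2) (by linarith [hP.sc_lt]) (by linarith [hP.sc_lt])
  -- The midpoint of s_c and 1: above s_c for the smoothing estimate, below 1 so that t^{-θ} is
  -- integrable at 0.
  set θ := (P.sc + 1) / 2 with hθ
  have hint := (integrableOn_rpow_mul_exp (s := 1 - θ) (by linarith [hP.sc_lt]) hω).const_mul c₁
  set I := ∫ t in (0 : ℝ)..1, c₁ * (t ^ (1 - θ - 1) * Real.exp (-ω * t)) with hI
  set Ip := ∫ τ in (0 : ℝ)..1, ‖P.ker P.invB τ‖ with hIp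
  have hIp0 : 0 ≤ Ip := intervalIntegral.integral_nonneg zero_le_one fun _ _ => norm_nonneg _
  have hI0 : 0 ≤ I := intervalIntegral.integral_nonneg zero_le_one fun t ht => by
    have := ht.1
    positivity
  have hV := hcV0 1
  refine ⟨I + Ip * (|(1 - β) / β| * (cV 1 * (‖hP.obs‖ * I))), by positivity, fun z₀ z h => ?_⟩
  have hz₀ : z₀ ∈ P.T.ZPos P.sc := h.initial ▸ h.mem 0 le_rfl
  set h₀ := P.unN z₀ with hh₀
  have hc0 : ContinuousOn (fun _ : ℝ => (0 : ℝ)) (Ici 0) := continuousOn_const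
  set y : ℝ → ℝ := fun s => P.out (z s) with hy
  have hyc : ContinuousOn y (Ici 0) := h.out_continuousOn
  have hTc := P.T.continuousOn h₀
  have iT : IntervalIntegrable (fun t => ‖P.T.op t h₀‖) volume 0 1 :=
    LocInt.of_continuousOn hTc.norm 1 zero_le_one
  have e1 : ∫ t in (0 : ℝ)..1, ‖P.T.op t h₀‖ ≤ I * ‖z₀‖ := by
    rw [hI, ← intervalIntegral.integral_mul_const]
    refine intervalIntegral.integral_mono_on_of_le_Ioo zero_le_one iT
      ((LocInt.of_integrableOn hint 1 zero_le_one).mul_const _) fun t ht => ?_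
    -- Here e^{At}(-A)^{s_c}z₀ is rewritten as (-A)^{s_c}e^{At} applied to z₀, so only the Z norm of
    -- z₀ enters.
    have e : P.T.op t h₀ = P.T.powOp P.sc t z₀ := by
      refine hP.N_injective ?_
      rw [hP.N_op ht.1.le, hh₀, N_unN hz₀]
      exact (C0Semigroup.negPow_powOp hP.expStable hP.analytic hP.sc_nonneg hP.sc_lt.le ht.1 z₀).symm
    rw [e]
    refine ((P.T.powOp P.sc t).le_opNorm _).trans
      (mul_le_mul_of_nonneg_right ((hb t ht.1).trans_eq ?_) (norm_nonneg _))
    rw [show 1 - θ - 1 = -θ by ring]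
    ring
  have hz : ∀ (p : ℝ → ℝ) t, cv p (fun _ => 0) t = 0 := fun p t => by simp [cv]
  have e2 : ∫ t in (0 : ℝ)..1, |y t| ≤ cV 1 * (‖hP.obs‖ * (I * ‖z₀‖)) := by
    refine ((hcV _ _ (hP.continuousOn_forcing (β := β) hc0 hc0 h₀) hyc
      (fun s hs => h.out_eq hP hc0 hc0 hs) 1 zero_le_one).2).trans
      (mul_le_mul_of_nonneg_left ?_ hV)
    refine le_trans ?_ (mul_le_mul_of_nonneg_left e1 (norm_nonneg hP.obs))
    rw [← intervalIntegral.integral_const_mul]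
    refine intervalIntegral.integral_mono_on zero_le_one (LocInt.of_continuousOn
      (hP.continuousOn_forcing (β := β) hc0 hc0 h₀).abs 1 zero_le_one) (iT.const_mul _)
      fun t ht => ?_
    simp only [forcing, hz, mul_zero, add_zero]
    exact hP.obs.le_opNorm _
  have hinp := continuousOn_inp (β := β) hc0 hyc
  have e3 : ∫ t in (0 : ℝ)..1, ‖cv (P.ker P.invB) (inp β (fun _ => 0) y) t‖ ≤
      Ip * (|(1 - β) / β| * ∫ t in (0 : ℝ)..1, |y t|) := by
    refine (integral_norm_cv_le hP.locInt_ker.1 hinp zero_le_one).trans_eq ?_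
    have e : ∀ s, |inp β (fun _ => 0) y s| = |(1 - β) / β| * |y s| := fun s => by
      simp [inp, abs_mul]
    simp only [e, intervalIntegral.integral_const_mul, hIp]
  have hcvc := continuousOn_cv hP.locInt_ker.1 hinp
  have icv := LocInt.of_continuousOn hcvc.norm 1 zero_le_one
  have e4 : ∫ t in (0 : ℝ)..1, ‖P.unN (z t)‖ ≤ (∫ t in (0 : ℝ)..1, ‖P.T.op t h₀‖) +
      ∫ t in (0 : ℝ)..1, ‖cv (P.ker P.invB) (inp β (fun _ => 0) y) t‖ := by
    rw [← intervalIntegral.integral_add iT icv]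
    refine intervalIntegral.integral_mono_on zero_le_one (LocInt.of_continuousOn
      (h.continuousOn_unN hP hc0 hc0).norm 1 zero_le_one) (iT.add icv) fun t ht => ?_
    rw [h.unN_eq hP hc0 hc0 ht.1, state]
    have : cv (P.ker P.invI0Bd) (fun _ => 0) t = 0 := by simp [cv]
    rw [this, add_zero]
    exact norm_add_le _ _
  calc ∫ t in (0 : ℝ)..1, ‖P.unN (z t)‖
      ≤ I * ‖z₀‖ + Ip * (|(1 - β) / β| * (cV 1 * (‖hP.obs‖ * (I * ‖z₀‖)))) := by
        refine e4.trans (add_le_add e1 (e3.trans ?_))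
        gcongr
    _ = _ := by ring

/-- The input-output map commutes with convolutions. -/
theorem IsBetaSolution.out_cv (hP : P.Standing) {v w v' w' F : ℝ → ℝ} {z z' : ℝ → Z}
    (h : P.IsBetaSolution β v w 0 z) (hv : ContinuousOn v (Ici 0)) (hw : ContinuousOn w (Ici 0))
    (hF : ContinuousOn F (Ici 0)) (h' : P.IsBetaSolution β v' w' 0 z')
    (hv' : ∀ t, 0 ≤ t → v' t = cv F v t) (hw' : ∀ t, 0 ≤ t → w' t = cv F w t) {t : ℝ}
    (ht : 0 ≤ t) : P.out (z' t) = cv F (fun s => P.out (z s)) t := by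
  obtain ⟨cV, -, hcV⟩ := volterra_bounds hP.integrableOn_kerB (-((1 - β) / β))
  have hkB := LocInt.of_integrableOn hP.integrableOn_kerB
  have hkD := LocInt.of_integrableOn hP.integrableOn_kerD
  have hFL := LocInt.of_continuousOn hF
  set y : ℝ → ℝ := fun s => P.out (z s) with hy
  set y' : ℝ → ℝ := fun s => P.out (z' s) with hy'
  have hyc : ContinuousOn y (Ici 0) := h.out_continuousOn
  have hyc' : ContinuousOn y' (Ici 0) := h'.out_continuousOn
  have cFv := continuousOn_cv hFL hv
  have cFw := continuousOn_cv hFL hw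
  have cFy := continuousOn_cv hFL hyc
  have h'' := h'.congr (v' := cv F v) (w' := cv F w) (fun s hs => (hv' s hs).symm)
    (fun s hs => (hw' s hs).symm)
  have hfor : ∀ (a b : ℝ → ℝ) s, hP.forcing β a b (P.unN 0) s =
      1 / β * cv hP.kerB a s + cv hP.kerD b s := fun a b s => by
    rw [Standing.forcing, hP.unN_zero, map_zero, map_zero, zero_add]
  have ey : ∀ s, 0 ≤ s → y s = 1 / β * cv hP.kerB v s + cv hP.kerD w s +
      -((1 - β) / β) * cv hP.kerB y s := fun s hs => by
    rw [← hfor]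
    exact h.out_eq hP hv hw hs
  have eFy : ∀ s, 0 ≤ s → cv F y s = 1 / β * cv hP.kerB (cv F v) s + cv hP.kerD (cv F w) s +
      -((1 - β) / β) * cv hP.kerB (cv F y) s := fun s hs => by
    have c1 := continuousOn_cv hkB hv
    have c2 := continuousOn_cv hkD hw
    have c3 := continuousOn_cv hkB hyc
    have c4 : ContinuousOn (fun s => 1 / β * cv hP.kerB v s + cv hP.kerD w s) (Ici 0) :=
      (c1.const_mul _).add c2
    rw [cv_congr ey hs, cv_add hFL c4 (c3.const_mul _) hs,
      cv_add hFL (c1.const_mul _) c2 hs, cv_const_mul, cv_const_mul, cv_cv_comm hkB hF hv hs,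
      cv_cv_comm hkD hF hw hs, cv_cv_comm hkB hF hyc hs, smul_eq_mul, smul_eq_mul]
  have ey' : ∀ s, 0 ≤ s → y' s = 1 / β * cv hP.kerB (cv F v) s + cv hP.kerD (cv F w) s +
      -((1 - β) / β) * cv hP.kerB y' s := fun s hs => by
    rw [← hfor]
    exact h''.out_eq hP cFv cFw hs
  -- The output of z' and F * y satisfy the same Volterra equation, because convolutions commute.
  -- Their difference solves the homogeneous one and vanishes.
  have hd : ContinuousOn (fun s => y' s + -1 * cv F y s) (Ici 0) := hyc'.add (cFy.const_mul _)
  have ed : ∀ s, 0 ≤ s → y' s + -1 * cv F y s =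
      0 + -((1 - β) / β) * cv hP.kerB (fun s => y' s + -1 * cv F y s) s := fun s hs => by
    rw [cv_add hkB hyc' (cFy.const_mul _) hs, cv_const_mul, ey' s hs]
    nth_rewrite 1 [eFy s hs]
    rw [smul_eq_mul]
    ring
  have := (hcV (fun _ => 0) _ continuousOn_const hd ed t ht).1 0 (by simp) t ht le_rfl
  rw [mul_zero] at this
  have := abs_nonpos_iff.1 this
  linarith

end Plant

/-! ### Stability of the regularized system in `Z^{s_c}` -/

/-- Induction over the windows [jL, (j+1)L]. The bound 2c is a fixed point of x ↦ x/2 + c. -/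
theorem le_of_half_contraction {f : ℝ → ℝ} {L c m : ℝ} (hL : 0 < L)
    (hstep : ∀ t, 0 ≤ t → f (t + L) ≤ 1 / 2 * f t + c) (hm : ∀ t, 0 ≤ t → t ≤ L → f t ≤ m)
    (hc : 0 ≤ c) (j : ℕ) : ∀ t, j * L ≤ t → t ≤ (j + 1) * L → f t ≤ (1 / 2) ^ j * m + 2 * c := by
  induction j with
  | zero =>
    intro t h0 h1
    have := hm t (by simpa using h0) (by simpa using h1)
    simp only [pow_zero, one_mul]
    linarith
  | succ j ih =>
    intro t h0 h1
    push_cast at h0 h1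
    have hj : (0 : ℝ) ≤ j * L := by positivity
    have h2 := ih (t - L) (by linarith) (by linarith)
    have h3 := hstep (t - L) (by linarith)
    rw [sub_add_cancel] at h3
    rw [pow_succ]
    linarith

theorem exists_nat_mul_le {L t : ℝ} (hL : 0 < L) (ht : 0 ≤ t) :
    ∃ j : ℕ, j * L ≤ t ∧ t ≤ (j + 1) * L := by
  refine ⟨⌊t / L⌋₊, ?_, ?_⟩
  · rw [← le_div_iff₀ hL]
    exact Nat.floor_le (by positivity)
  · rw [← div_le_iff₀ hL]
    exact (Nat.lt_floor_add_one _).le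

theorem bounded_of_half_contraction {f : ℝ → ℝ} {L c m : ℝ} (hL : 0 < L)
    (hstep : ∀ t, 0 ≤ t → f (t + L) ≤ 1 / 2 * f t + c) (hm : ∀ t, 0 ≤ t → t ≤ L → f t ≤ m)
    (hc : 0 ≤ c) (hm0 : 0 ≤ m) : ∀ t, 0 ≤ t → f t ≤ m + 2 * c := by
  intro t ht
  obtain ⟨j, h0, h1⟩ := exists_nat_mul_le hL ht
  have h2 := le_of_half_contraction hL hstep hm hc j t h0 h1
  have h3 : (1 / 2 : ℝ) ^ j ≤ 1 := pow_le_one₀ (by norm_num) (by norm_num)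
  nlinarith

theorem eventually_le_of_half_contraction {f : ℝ → ℝ} {L c m : ℝ} (hL : 0 < L)
    (hstep : ∀ t, 0 ≤ t → f (t + L) ≤ 1 / 2 * f t + c) (hm : ∀ t, 0 ≤ t → t ≤ L → f t ≤ m)
    (hc : 0 ≤ c) {ε : ℝ} (hε : 0 < ε) : ∀ᶠ t in atTop, f t ≤ 2 * c + ε := by
  have h1 : Tendsto (fun n : ℕ => (1 / 2 : ℝ) ^ n * m) atTop (𝓝 0) := by
    simpa using (tendsto_pow_atTop_nhds_zero_of_lt_one (r := (1 / 2 : ℝ)) (by norm_num)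
      (by norm_num)).mul_const m
  obtain ⟨n, hn⟩ := eventually_atTop.1 (h1.eventually (gt_mem_nhds hε))
  filter_upwards [eventually_ge_atTop ((n + 1) * L)] with t ht
  have hnL : 0 ≤ (n + 1) * L := by positivity
  obtain ⟨j, h2, h3⟩ := exists_nat_mul_le hL (hnL.trans ht)
  have hnj : n ≤ j := by
    have : ((n : ℝ) + 1) * L ≤ (j + 1) * L := ht.trans h3
    have := le_of_mul_le_mul_right this hL
    exact_mod_cast (by linarith : (n : ℝ) ≤ j)
  have h4 := le_of_half_contraction hL hstep hm hc j t h2 h3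
  linarith [hn j hnj]

namespace Plant

variable {Z : Type*} [NormedAddCommGroup Z] [NormedSpace ℝ Z] [CompleteSpace Z] {P : Plant Z}
  {β : ℝ} {S : C0Semigroup Z}

theorem Standing.unN_add (hP : P.Standing) {z z' : Z} (hz : z ∈ P.T.ZPos P.sc)
    (hz' : z' ∈ P.T.ZPos P.sc) : P.unN (z + z') = P.unN z + P.unN z' := by
  obtain ⟨h, rfl⟩ := mem_iff.1 hz
  obtain ⟨h', rfl⟩ := mem_iff.1 hz'
  rw [← map_add, hP.unN_N, hP.unN_N, hP.unN_N]

/-- The free solutions of the regularized system are the orbits of the semigroup `e^{A_β t}`. -/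
theorem IsBetaSolution.eq_op (hP : P.Standing) (hS : P.IsBetaSemigroup β S) (hSs : S.ExpStable)
    {z₀ : Z} {z : ℝ → Z} (h : P.IsBetaSolution β (fun _ => 0) (fun _ => 0) z₀ z) {t : ℝ}
    (ht : 0 ≤ t) : z t = S.op t z₀ := by
  have hc0 : ContinuousOn (fun _ : ℝ => (0 : ℝ)) (Ici 0) := continuousOn_const
  have hu := h.continuousOn_unN hP hc0 hc0
  -- The state z need not take values in the domain of A_β, but its primitive does, with A_β ∫₀ˢ z =
  -- z(s) - z₀. As C is unbounded on Z, it is moved under the integral by means of the continuity of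
  -- (-A)^{s_c}z.
  have hgen : ∀ s, 0 ≤ s → S.Gen (∫ σ in (0 : ℝ)..s, z σ) (z s - z₀) := by
    intro s hs
    rw [hS]
    have i1 := LocInt.of_continuousOn hu s hs
    have e1 : ∫ σ in (0 : ℝ)..s, z σ = P.N (∫ σ in (0 : ℝ)..s, P.unN (z σ)) := by
      rw [← P.N.intervalIntegral_comp_comm i1]
      refine intervalIntegral.integral_congr fun σ hσ => ?_
      rw [uIcc_of_le hs] at hσ
      exact (N_unN (h.mem σ hσ.1)).symm
    have e2 : P.out (∫ σ in (0 : ℝ)..s, z σ) = ∫ σ in (0 : ℝ)..s, P.out (z σ) := by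
      rw [e1, hP.out_N, ← hP.obs.intervalIntegral_comp_comm i1]
      refine intervalIntegral.integral_congr fun σ hσ => ?_
      rw [uIcc_of_le hs] at hσ
      exact (hP.out_eq_obs_unN (h.mem σ hσ.1)).symm
    refine ⟨by rw [e1]; exact P.N_mem _, ?_⟩
    have hF : ContinuousOn (fun t => z t - ((1 - β) / β * P.out (z t)) • P.invB) (Ici 0) :=
      h.continuousOn.sub ((h.out_continuousOn.const_mul _).smul continuousOn_const)
    have e3 := integral_derivWithin_Ici (f := fun t => P.T.inv (z t)) (fun t ht => by
      simpa using h.equation t ht) hF hs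
    rw [h.initial] at e3
    have i2 : IntervalIntegrable (fun t => ((1 - β) / β * P.out (z t)) • P.invB) volume 0 s :=
      LocInt.of_continuousOn ((h.out_continuousOn.const_mul _).smul continuousOn_const) s hs
    rw [map_sub, ← e3, intervalIntegral.integral_sub
      (LocInt.of_continuousOn h.continuousOn s hs) i2,
      intervalIntegral.integral_smul_const, intervalIntegral.integral_const_mul, e2]
  have hSc := S.continuousOn z₀
  -- The primitives of z and of the orbit differ by a solution of the homogeneous problem for S.
  -- They therefore agree, and differentiating recovers the pointwise equality.
  have hW : ∀ s, 0 ≤ s → (∫ σ in (0 : ℝ)..s, z σ) - ∫ σ in (0 : ℝ)..s, S.op σ z₀ = 0 :=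
    fun s hs => hSs.eq_zero_of_hasDerivWithinAt
      (W := fun s => (∫ σ in (0 : ℝ)..s, z σ) - ∫ σ in (0 : ℝ)..s, S.op σ z₀)
      (fun s hs => (hasDerivWithinAt_primitive h.continuousOn hs).fun_sub
        (hasDerivWithinAt_primitive hSc hs))
      (fun s hs => by
        have := (hgen s hs).sub (S.gen_integral z₀ hs)
        rwa [sub_sub_sub_cancel_right] at this) (by simp) hs
  have h1 := (hasDerivWithinAt_primitive h.continuousOn ht).fun_sub (hasDerivWithinAt_primitive hSc ht)
  have h2 := (hasDerivWithinAt_const t (Ici 0) (0 : Z)).congr hW (hW t ht)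
  exact sub_eq_zero.1 ((uniqueDiffOn_Ici 0 t ht).eq_deriv _ h1 h2)

/-- Nothing is assumed about e^{A_β t} in Z^{s_c}. The regularity of its orbits is inherited from
the solution built with the Volterra equation. -/
theorem Standing.op_mem (hP : P.Standing) (hS : P.IsBetaSemigroup β S) (hSs : S.ExpStable)
    {z₀ : Z} (hz₀ : z₀ ∈ P.T.ZPos P.sc) :
    P.IsBetaSolution β (fun _ => 0) (fun _ => 0) z₀ (fun t => S.op t z₀) := by
  obtain ⟨z, hz⟩ := hP.exists_betaSolution β (Bc.const 0) (Bc.const 0) hz₀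
  have he : ∀ t, 0 ≤ t → S.op t z₀ = z t := fun t ht => (hz.eq_op hP hS hSs ht).symm
  refine ⟨S.continuousOn z₀, fun t ht => he t ht ▸ hz.mem t ht,
    hz.out_continuousOn.congr fun t ht => by simp only [he t ht], S.op_zero_apply z₀,
    fun t ht => ?_⟩
  have h1 := (hz.equation t ht).congr (f₁ := fun t => P.T.inv (S.op t z₀))
    (fun s hs => by simp only [he s hs]) (by simp only [he t ht])
  simpa only [he t ht] using h1

/-- Free solutions decay exponentially in `Z^{s_c}`. -/
theorem Standing.exists_decay (hP : P.Standing) (hS : P.IsBetaSemigroup β S) (hSs : S.ExpStable) :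
    ∃ c ω : ℝ, 0 ≤ c ∧ 0 < ω ∧ ∀ (z₀ : Z) (z : ℝ → Z),
      P.IsBetaSolution β (fun _ => 0) (fun _ => 0) z₀ z →
      ∀ t, 0 ≤ t → ‖P.unN (z t)‖ ≤ c * Real.exp (-ω * t) * ‖P.unN z₀‖ := by
  obtain ⟨cE, hcE0, hcE⟩ := hP.exists_unN_bound β
  obtain ⟨cL, hcL0, hcL⟩ := hP.exists_integral_unN_bound β
  obtain ⟨M, ω, hM0, hω, hM⟩ := hSs.exists_bound
  have hc0 : ContinuousOn (fun _ : ℝ => (0 : ℝ)) (Ici 0) := continuousOn_const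
  have hE := hcE0 1
  have hloc : ∀ (z₀ : Z) (z : ℝ → Z), P.IsBetaSolution β (fun _ => 0) (fun _ => 0) z₀ z →
      ∀ t, 0 ≤ t → t ≤ 1 → ‖P.unN (z t)‖ ≤ cE 1 * ‖P.unN z₀‖ := fun z₀ z h t h0 h1 => by
    have := hcE _ _ z₀ z hc0 hc0 h 1 0 zero_le_one le_rfl (by simp) t h0 h1
    rwa [add_zero] at this
  -- A unit of time upgrades the Z norm to the Z^{s_c} norm: the value at time 1 is controlled by
  -- the value at every t in [0, 1], and averaging over t brings in the integral bound.
  have hsm : ∀ (z₀ : Z) (z : ℝ → Z), P.IsBetaSolution β (fun _ => 0) (fun _ => 0) z₀ z →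
      ‖P.unN (z 1)‖ ≤ cE 1 * cL * ‖z₀‖ := fun z₀ z h => by
    have h1 : ∀ t ∈ Icc (0 : ℝ) 1, ‖P.unN (z 1)‖ ≤ cE 1 * ‖P.unN (z t)‖ := fun t ht => by
      have := hloc _ _ (h.shift ht.1) (1 - t) (by linarith [ht.2]) (by linarith [ht.1])
      rwa [add_sub_cancel] at this
    have i1 := LocInt.of_continuousOn (h.continuousOn_unN hP hc0 hc0).norm 1 zero_le_one
    have h2 := intervalIntegral.integral_mono_on zero_le_one
      (intervalIntegrable_const (c := ‖P.unN (z 1)‖)) (i1.const_mul (cE 1)) h1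
    rw [intervalIntegral.integral_const, sub_zero, one_smul,
      intervalIntegral.integral_const_mul] at h2
    rw [mul_assoc]
    exact h2.trans (mul_le_mul_of_nonneg_left (hcL z₀ z h) hE)
  refine ⟨(cE 1 + cE 1 * cL * (M * ‖P.N‖)) * Real.exp ω, ω, by positivity, hω,
    fun z₀ z h t ht => ?_⟩
  have hz₀ : z₀ ∈ P.T.ZPos P.sc := h.initial ▸ h.mem 0 le_rfl
  -- Up to time 1 the local bound suffices, since e^{ω}e^{-ωt} ≥ 1. Later, decay in Z acts until t -
  -- 1 and smoothing acts on the last unit interval, whence the factor e^ω.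
  rcases le_total t 1 with h1 | h1
  · have e1 : 1 ≤ Real.exp ω * Real.exp (-ω * t) := by
      rw [← Real.exp_add]
      exact Real.one_le_exp (by nlinarith)
    calc ‖P.unN (z t)‖ ≤ cE 1 * ‖P.unN z₀‖ := hloc z₀ z h t ht h1
      _ ≤ (cE 1 + cE 1 * cL * (M * ‖P.N‖)) * ‖P.unN z₀‖ * 1 := by
          rw [mul_one]
          refine mul_le_mul_of_nonneg_right (le_add_of_nonneg_right (by positivity)) (norm_nonneg _)
      _ ≤ (cE 1 + cE 1 * cL * (M * ‖P.N‖)) * ‖P.unN z₀‖ * (Real.exp ω * Real.exp (-ω * t)) :=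
          mul_le_mul_of_nonneg_left e1 (by positivity)
      _ = _ := by ring
  · have h2 := hsm _ _ (h.shift (sub_nonneg.2 h1))
    rw [sub_add_cancel, h.eq_op hP hS hSs (sub_nonneg.2 h1)] at h2
    have h3 : ‖S.op (t - 1) z₀‖ ≤ M * Real.exp (-ω * (t - 1)) * (‖P.N‖ * ‖P.unN z₀‖) := by
      refine ((S.op _).le_opNorm _).trans (mul_le_mul (hM _ (sub_nonneg.2 h1)) ?_ (norm_nonneg _)
        (by positivity))
      conv_lhs => rw [← N_unN hz₀]
      exact P.N.le_opNorm _
    have e1 : Real.exp (-ω * (t - 1)) = Real.exp ω * Real.exp (-ω * t) := by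
      rw [← Real.exp_add]
      congr 1
      ring
    calc ‖P.unN (z t)‖ ≤ cE 1 * cL * ‖S.op (t - 1) z₀‖ := h2
      _ ≤ cE 1 * cL * (M * Real.exp (-ω * (t - 1)) * (‖P.N‖ * ‖P.unN z₀‖)) :=
          mul_le_mul_of_nonneg_left h3 (by positivity)
      _ = (cE 1 * cL * (M * ‖P.N‖)) * (Real.exp ω * Real.exp (-ω * t) * ‖P.unN z₀‖) := by
          rw [e1]
          ring
      _ ≤ (cE 1 + cE 1 * cL * (M * ‖P.N‖)) * (Real.exp ω * Real.exp (-ω * t) * ‖P.unN z₀‖) :=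
          mul_le_mul_of_nonneg_right (le_add_of_nonneg_left hE) (by positivity)
      _ = _ := by ring

/-- Input-to-state stability in `Z^{s_c}`, over one period. -/
theorem Standing.exists_contraction (hP : P.Standing) (hS : P.IsBetaSemigroup β S)
    (hSs : S.ExpStable) : ∃ L c : ℝ, 0 < L ∧ 0 ≤ c ∧
      ∀ (v w : ℝ → ℝ) (z₀ : Z) (z : ℝ → Z) (b : ℝ), ContinuousOn v (Ici 0) →
        ContinuousOn w (Ici 0) → P.IsBetaSolution β v w z₀ z → 0 ≤ b →
        (∀ t, 0 ≤ t → |v t| ≤ b ∧ |w t| ≤ b) →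
        (∀ t, 0 ≤ t → ‖P.unN (z (t + L))‖ ≤ 1 / 2 * ‖P.unN (z t)‖ + c * b) ∧
        ∀ t, 0 ≤ t → t ≤ L → ‖P.unN (z t)‖ ≤ c * (‖P.unN z₀‖ + b) := by
  obtain ⟨cE, hcE0, hcE⟩ := hP.exists_unN_bound β
  obtain ⟨c, ω, hc0, hω, hc⟩ := hP.exists_decay hS hSs
  obtain ⟨L, hL, hcL⟩ : ∃ L : ℝ, 0 < L ∧ c * Real.exp (-ω * L) ≤ 1 / 2 := by
    have h1 : Tendsto (fun t : ℝ => c * Real.exp (-ω * t)) atTop (𝓝 0) := by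
      have : Tendsto (fun t : ℝ => Real.exp (-ω * t)) atTop (𝓝 0) :=
        Real.tendsto_exp_atBot.comp (tendsto_id.const_mul_atTop_of_neg (neg_lt_zero.2 hω))
      simpa using this.const_mul c
    obtain ⟨L, h2, h3⟩ := ((h1.eventually (gt_mem_nhds (by norm_num : (0 : ℝ) < 1 / 2))).and
      (eventually_gt_atTop 0)).exists
    exact ⟨L, h3, h2.le⟩
  refine ⟨L, cE L, hL, hcE0 L, fun v w z₀ z b hv hw h hb hvw => ⟨fun t ht => ?_, fun t h0 h1 =>
    hcE v w z₀ z hv hw h L b hL.le hb (fun s hs _ => hvw s hs) t h0 h1⟩⟩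
  -- The free solution x started from z(t) is halved after time L. The remainder z(t + ·) - x starts
  -- at 0 and is controlled by the inputs alone.
  obtain ⟨x, hx⟩ := hP.exists_betaSolution β (Bc.const 0) (Bc.const 0) (h.mem t ht)
  have hsh := h.shift ht
  have hd := (hsh.sub hP hx).congr (v' := fun s => v (t + s)) (w' := fun s => w (t + s))
    (by simp) (by simp)
  have hm : MapsTo (fun s => t + s) (Ici 0) (Ici 0) := fun s hs => add_nonneg ht hs
  have hcm : ContinuousOn (fun s => t + s) (Ici 0) := by fun_prop
  have h1 := hcE _ _ _ _ (hv.comp hcm hm) (hw.comp hcm hm) hd L b hL.le hb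
    (fun s hs _ => hvw _ (hm hs)) L hL.le le_rfl
  rw [sub_self, hP.unN_zero, norm_zero, zero_add] at h1
  have h2 := hc _ _ hx L hL.le
  have h3 := hP.unN_add (hd.mem L hL.le) (hx.mem L hL.le)
  rw [sub_add_cancel] at h3
  rw [h3]
  calc ‖P.unN (z (t + L) - x L) + P.unN (x L)‖
      ≤ cE L * b + c * Real.exp (-ω * L) * ‖P.unN (z t)‖ :=
        (norm_add_le _ _).trans (add_le_add h1 h2)
    _ ≤ cE L * b + 1 / 2 * ‖P.unN (z t)‖ := by gcongr
    _ = _ := add_comm _ _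

theorem IsBetaSolution.bc_out (hP : P.Standing) (hS : P.IsBetaSemigroup β S) (hSs : S.ExpStable)
    {v w : ℝ → ℝ} {z₀ : Z} {z : ℝ → Z} (h : P.IsBetaSolution β v w z₀ z) (hv : Bc v) (hw : Bc w) :
    Bc fun t => P.out (z t) := by
  obtain ⟨L, c, hL, hc0, hc⟩ := hP.exists_contraction hS hSs
  obtain ⟨hvc, Mv, hMv⟩ := hv
  obtain ⟨hwc, Mw, hMw⟩ := hw
  set b := max Mv Mw with hb
  have hb0 : 0 ≤ b := (abs_nonneg _).trans ((hMv 0 le_rfl).trans (le_max_left _ _))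
  obtain ⟨h1, h2⟩ := hc v w z₀ z b hvc hwc h hb0 fun t ht =>
    ⟨(hMv t ht).trans (le_max_left _ _), (hMw t ht).trans (le_max_right _ _)⟩
  have h3 := bounded_of_half_contraction hL h1 h2 (by positivity) (by positivity)
  exact ⟨h.out_continuousOn, _, fun t ht => (hP.abs_out_le (h.mem t ht)).trans
    (mul_le_mul_of_nonneg_left (h3 t ht) (norm_nonneg _))⟩

/-- By time invariance the system is restarted at a time a after which both inputs stay below δ. The
contraction estimate then forgets the state at time a. -/
theorem IsBetaSolution.evLe_out (hP : P.Standing) (hS : P.IsBetaSemigroup β S) (hSs : S.ExpStable)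
    {v w : ℝ → ℝ} {z₀ : Z} {z : ℝ → Z} (h : P.IsBetaSolution β v w z₀ z)
    (hvc : ContinuousOn v (Ici 0)) (hwc : ContinuousOn w (Ici 0)) (hv : EvLe v 0) (hw : EvLe w 0) :
    EvLe (fun t => P.out (z t)) 0 := by
  obtain ⟨L, c, hL, hc0, hc⟩ := hP.exists_contraction hS hSs
  intro ε hε
  set δ := ε / ((2 * c + 1) * (‖hP.obs‖ + 1)) with hδ
  have hδ0 : 0 < δ := by positivity
  obtain ⟨a, ha0, ha⟩ : ∃ a, 0 ≤ a ∧ ∀ t, a ≤ t → |v t| ≤ δ ∧ |w t| ≤ δ := by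
    obtain ⟨a, ha⟩ := eventually_atTop.1 ((hv δ hδ0).and (hw δ hδ0))
    simp only [zero_add] at ha
    exact ⟨max a 0, le_max_right _ _, fun t ht => ha t ((le_max_left _ _).trans ht)⟩
  have hm : MapsTo (fun s => a + s) (Ici 0) (Ici 0) := fun s hs => add_nonneg ha0 hs
  have hcm : ContinuousOn (fun s => a + s) (Ici 0) := by fun_prop
  obtain ⟨h1, h2⟩ := hc _ _ _ _ δ (hvc.comp hcm hm) (hwc.comp hcm hm) (h.shift ha0) hδ0.le
    fun t ht => ha (a + t) (le_add_of_nonneg_right ht)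
  have h3 := eventually_le_of_half_contraction hL h1 h2 (by positivity) hδ0
  have h4 := (tendsto_atTop_add_const_right atTop (-a) tendsto_id).eventually h3
  filter_upwards [h4, eventually_ge_atTop 0] with t ht ht0
  simp only [id, add_neg_cancel_comm_assoc] at ht
  refine (hP.abs_out_le (h.mem t ht0)).trans ?_
  have e1 : (2 * c + 1) * (‖hP.obs‖ + 1) * δ = ε := by
    rw [hδ]
    field_simp
  have e2 : ‖hP.obs‖ * ‖P.unN (z t)‖ ≤ ‖hP.obs‖ * (2 * (c * δ) + δ) :=
    mul_le_mul_of_nonneg_left ht (norm_nonneg _)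
  have e3 : 0 ≤ (2 * c + 1) * δ := by positivity
  linarith

/-! ### The kernels `K` and `K_d` -/

theorem Standing.integrableOn_out_op (hP : P.Standing) (hS : P.IsBetaSemigroup β S)
    (hSs : S.ExpStable) {z₀ : Z} (hz₀ : z₀ ∈ P.T.ZPos P.sc) :
    IntegrableOn (fun t => P.out (S.op t z₀)) (Ioi 0) := by
  obtain ⟨c, ω, hc0, hω, hc⟩ := hP.exists_decay hS hSs
  have h := hP.op_mem hS hSs hz₀
  refine Integrable.mono' ((((exp_neg_integrableOn_Ioi 0 hω).const_mul c).mul_const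
    ‖P.unN z₀‖).const_mul ‖hP.obs‖)
    ((h.out_continuousOn.mono Ioi_subset_Ici_self).aestronglyMeasurable measurableSet_Ioi) ?_
  refine (ae_restrict_iff' measurableSet_Ioi).2 (Eventually.of_forall fun t ht => ?_)
  exact (hP.abs_out_le (h.mem t (le_of_lt ht))).trans
    (mul_le_mul_of_nonneg_left (hc _ _ h t (le_of_lt ht)) (norm_nonneg _))

/-- Since CA⁻¹B = -1, A_β⁻¹B = (1 - (1 - β))A⁻¹B = βA⁻¹B, and the factor cancels 1/β. -/
theorem Standing.K_eq (hP : P.Standing) (hβ : 0 < β) (hS : P.IsBetaSemigroup β S)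
    (hSs : S.ExpStable) {t : ℝ} (ht : 0 ≤ t) : P.K β S t = -P.out (S.op t P.invB) := by
  have h1 : P.betaInv β P.invB = β • P.invB := by
    rw [betaInv, hP.out_invB]
    module
  rw [K, h1, map_smul, hP.out_smul ((hP.op_mem hS hSs hP.invB_mem).mem t ht)]
  field_simp

theorem Standing.Kd_eq (hP : P.Standing) (t : ℝ) :
    P.Kd β S t = -P.out (S.op t P.invI0Bd) := by
  have h1 : P.betaInv β P.invI0Bd = P.invI0Bd := by
    rw [betaInv, hP.out_invI0Bd, mul_zero, zero_smul, add_zero]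
  rw [Kd, h1]

theorem Standing.integrableOn_K (hP : P.Standing) (hβ : 0 < β) (hS : P.IsBetaSemigroup β S)
    (hSs : S.ExpStable) : IntegrableOn (P.K β S) (Ioi 0) :=
  (hP.integrableOn_out_op hS hSs hP.invB_mem).neg.congr_fun
    (fun _ ht => (hP.K_eq hβ hS hSs (le_of_lt ht)).symm) measurableSet_Ioi

theorem Standing.integrableOn_Kd (hP : P.Standing) (hS : P.IsBetaSemigroup β S)
    (hSs : S.ExpStable) : IntegrableOn (P.Kd β S) (Ioi 0) :=
  (hP.integrableOn_out_op hS hSs hP.invI0Bd_mem).neg.congr_fun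
    (fun _ _ => (hP.Kd_eq _).symm) measurableSet_Ioi

theorem Standing.bc_K (hP : P.Standing) (hβ : 0 < β) (hS : P.IsBetaSemigroup β S)
    (hSs : S.ExpStable) : Bc (P.K β S) :=
  (((hP.op_mem hS hSs hP.invB_mem).bc_out hP hS hSs (Bc.const 0) (Bc.const 0)).const_mul (-1)).congr
    fun _ ht => by rw [hP.K_eq hβ hS hSs ht, neg_one_mul]

theorem Standing.bc_Kd (hP : P.Standing) (hS : P.IsBetaSemigroup β S)
    (hSs : S.ExpStable) : Bc (P.Kd β S) :=
  (((hP.op_mem hS hSs hP.invI0Bd_mem).bc_out hP hS hSs (Bc.const 0) (Bc.const 0)).const_mul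
    (-1)).congr fun t _ => by rw [hP.Kd_eq t, neg_one_mul]

theorem evLe_zero : EvLe (fun _ => 0) 0 := fun ε hε => Eventually.of_forall fun _ => by
  simpa using hε.le

theorem Standing.evLe_K (hP : P.Standing) (hβ : 0 < β) (hS : P.IsBetaSemigroup β S)
    (hSs : S.ExpStable) : EvLe (P.K β S) 0 :=
  (((hP.op_mem hS hSs hP.invB_mem).evLe_out hP hS hSs continuousOn_const continuousOn_const
    evLe_zero evLe_zero).const_mul_zero (-1)).congr
    fun _ ht => by rw [hP.K_eq hβ hS hSs ht, neg_one_mul]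

theorem Standing.evLe_Kd (hP : P.Standing) (hS : P.IsBetaSemigroup β S)
    (hSs : S.ExpStable) : EvLe (P.Kd β S) 0 :=
  (((hP.op_mem hS hSs hP.invI0Bd_mem).evLe_out hP hS hSs continuousOn_const continuousOn_const
    evLe_zero evLe_zero).const_mul_zero (-1)).congr
    fun t _ => by rw [hP.Kd_eq t, neg_one_mul]

/-- K(0) = -CA⁻¹B = 1 and K is continuous, so |K| exceeds 1/2 near 0. -/
theorem Standing.D_pos (hP : P.Standing) (hβ : 0 < β) (hS : P.IsBetaSemigroup β S)
    (hSs : S.ExpStable) : 0 < P.D β S := by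
  have h0 : P.K β S 0 = 1 := by
    rw [hP.K_eq hβ hS hSs le_rfl, S.op_zero_apply, hP.out_invB, neg_neg]
  have hc := (hP.bc_K hβ hS hSs).1
  have hpos : ∀ᶠ t in 𝓝[≥] (0 : ℝ), 1 / 2 < |P.K β S t| := by
    have := (hc 0 self_mem_Ici).abs
    rw [ContinuousWithinAt, h0, abs_one] at this
    exact this.eventually (lt_mem_nhds (by norm_num))
  obtain ⟨u, hu, hsub⟩ := (mem_nhdsGE_iff_exists_Ico_subset).1 hpos
  have hu0 : (0 : ℝ) < u := hu
  have hi : IntegrableOn (fun t => ‖P.K β S t‖) (Ioi 0) := (hP.integrableOn_K hβ hS hSs).norm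
  calc (0 : ℝ) < ∫ _ in Ioo (0 : ℝ) u, (1 / 2 : ℝ) := by
        simp [hu0, hu0.le]
    _ ≤ ∫ t in Ioo (0 : ℝ) u, ‖P.K β S t‖ := by
        refine setIntegral_mono_on (integrableOn_const (by simp)) (hi.mono_set Ioo_subset_Ioi_self)
          measurableSet_Ioo fun t ht => ?_
        exact le_of_lt (hsub ⟨ht.1.le, ht.2⟩)
    _ ≤ ∫ t in Ioi (0 : ℝ), ‖P.K β S t‖ :=
        setIntegral_mono_set hi (Eventually.of_forall fun _ => norm_nonneg _)
          Ioo_subset_Ioi_self.eventuallyLE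

end Plant

open scoped NNReal BoundedContinuousFunction

/-! ### Signals -/

theorem IsCb.bc {n : ℕ} {φ : ℝ → ℝ} (h : IsCb n φ) : Bc φ := by
  obtain ⟨M, hM⟩ := h.2 0 (Nat.zero_le n)
  exact ⟨h.1.continuousOn, M, fun t ht => by simpa using hM t ht⟩

theorem IsCb.derivWithin {n : ℕ} {φ : ℝ → ℝ} (h : IsCb (n + 1) φ) :
    IsCb n (derivWithin φ (Ici 0)) := by
  refine ⟨?_, fun j hj => ?_⟩
  · exact ((contDiffOn_succ_iff_derivWithin (uniqueDiffOn_Ici 0)).1 h.1).2.2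
  · obtain ⟨M, hM⟩ := h.2 (j + 1) (Nat.succ_le_succ hj)
    refine ⟨M, fun t ht => ?_⟩
    have := hM t ht
    rwa [iteratedDerivWithin_succ'] at this

theorem IsCb.hasDerivWithinAt {n : ℕ} {φ : ℝ → ℝ} (h : IsCb (n + 1) φ) {t : ℝ} (ht : 0 ≤ t) :
    HasDerivWithinAt φ (_root_.derivWithin φ (Ici 0) t) (Ici 0) t :=
  ((h.1.differentiableOn (by simp)) t ht).hasDerivWithinAt

theorem limsup_le_maxLimsup {j n : ℕ} (h : j ≤ n) (φ : ℝ → ℝ) :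
    limsup (fun t => |iteratedDerivWithin j φ (Ici 0) t|) atTop ≤ maxLimsup n φ :=
  Finset.le_sup' (fun j => limsup (fun t => |iteratedDerivWithin j φ (Ici 0) t|) atTop)
    (Finset.mem_range.2 (Nat.lt_succ_of_le h))

theorem IsCb.maxLimsup_nonneg {n : ℕ} {φ : ℝ → ℝ} (h : IsCb n φ) : 0 ≤ maxLimsup n φ := by
  obtain ⟨M, hM⟩ := h.2 0 (Nat.zero_le n)
  exact (limsup_abs_nonneg hM).trans (limsup_le_maxLimsup (Nat.zero_le n) φ)

/-- Convolution with an integrable kernel on the bounded continuous functions. -/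
def convL {k : ℝ → ℝ} (hk : IntegrableOn k (Ioi 0)) : (ℝ≥0 →ᵇ ℝ) →ₗ[ℝ] (ℝ≥0 →ᵇ ℝ) where
  toFun v := (Bc.cv hk (bc_ext v)).toBCF
  map_add' v w := by
    ext t
    exact cv_add (LocInt.of_integrableOn hk) (bc_ext v).1 (bc_ext w).1 t.coe_nonneg
  map_smul' a v := by
    ext t
    exact cv_const_mul k a (ext v) t

theorem ext_convL {k : ℝ → ℝ} (hk : IntegrableOn k (Ioi 0)) (v : ℝ≥0 →ᵇ ℝ) {t : ℝ} (ht : 0 ≤ t) :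
    ext (convL hk v) t = cv k (ext v) t := (Bc.cv hk (bc_ext v)).ext_toBCF ht

theorem ext_add (v w : ℝ≥0 →ᵇ ℝ) (t : ℝ) : ext (v + w) t = ext v t + ext w t := rfl

theorem ext_smul (a : ℝ) (v : ℝ≥0 →ᵇ ℝ) (t : ℝ) : ext (a • v) t = a * ext v t := rfl

theorem eq_of_ext {v w : ℝ≥0 →ᵇ ℝ} (h : ∀ t, 0 ≤ t → ext v t = ext w t) : v = w := by
  ext t
  simpa [Regulation.ext] using h t t.coe_nonneg

/-! ### Stationary states and responses to differentiable inputs -/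

namespace Plant

variable {Z : Type*} [NormedAddCommGroup Z] [NormedSpace ℝ Z] {P : Plant Z} {β : ℝ}
  {S : C0Semigroup Z}

/-- The stationary state for the constant input 1 has output 1, so the coefficient of A⁻¹B in its
equation is -1 - (1 - β)/β + 1/β = 0. -/
theorem Standing.betaSolution_neg_invB [CompleteSpace Z] (hP : P.Standing) (hβ : 0 < β) :
    P.IsBetaSolution β (fun _ => 1) (fun _ => 0) (-P.invB) (fun _ => -P.invB) := by
  refine ⟨continuousOn_const, fun _ _ => Submodule.neg_mem _ hP.invB_mem, continuousOn_const, rfl,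
    fun t _ => ?_⟩
  convert hasDerivWithinAt_const t (Ici 0) (P.T.inv (-P.invB)) using 1
  rw [hP.out_neg hP.invB_mem, hP.out_invB, ← neg_one_smul ℝ P.invB, zero_smul, add_zero, ← sub_smul,
    ← add_smul]
  convert zero_smul ℝ P.invB using 2
  field_simp
  ring

theorem Standing.betaSolution_neg_invI0Bd [CompleteSpace Z] (hP : P.Standing) (β : ℝ) :
    P.IsBetaSolution β (fun _ => 0) (fun _ => 1) (-P.invI0Bd) (fun _ => -P.invI0Bd) := by
  refine ⟨continuousOn_const, fun _ _ => Submodule.neg_mem _ hP.invI0Bd_mem, continuousOn_const,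
    rfl, fun t _ => ?_⟩
  convert hasDerivWithinAt_const t (Ici 0) (P.T.inv (-P.invI0Bd)) using 1
  rw [hP.out_neg hP.invI0Bd_mem, hP.out_invI0Bd]
  simp

variable [CompleteSpace Z]

/-- Duhamel's formula for the output, with the response to a constant input as kernel. -/
theorem IsBetaSolution.out_eq_of_hasDerivWithinAt (hP : P.Standing) {a b : ℝ} {z₁ z : ℝ → Z}
    {φ φ' : ℝ → ℝ} (h₁ : P.IsBetaSolution β (fun _ => a) (fun _ => b) 0 z₁)
    (h : P.IsBetaSolution β (fun t => a * φ t) (fun t => b * φ t) 0 z)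
    (hφ : ∀ t, 0 ≤ t → HasDerivWithinAt φ (φ' t) (Ici 0) t) (hφ' : ContinuousOn φ' (Ici 0))
    {t : ℝ} (ht : 0 ≤ t) :
    P.out (z t) = φ 0 * P.out (z₁ t) + cv φ' (fun s => P.out (z₁ s)) t := by
  -- Subtracting φ(0) times the constant response leaves the inputs a(φ - φ(0)) and b(φ - φ(0)),
  -- which are φ' convolved with the constants a and b; so `out_cv` applies.
  have h2 := h.sub hP (h₁.smul hP (φ 0))
  rw [smul_zero, sub_zero] at h2
  have hcv : ∀ (m : ℝ) s, 0 ≤ s → m * φ s - φ 0 * m = cv φ' (fun _ => m) s := fun m s hs => by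
    rw [cv]
    simp only [smul_eq_mul]
    rw [intervalIntegral.integral_const_mul, integral_derivWithin_Ici hφ hφ' hs]
    ring
  have h3 := h₁.out_cv hP continuousOn_const continuousOn_const hφ' h2 (hcv a) (hcv b) ht
  have h4 := hP.out_add (h2.mem t ht) ((h₁.smul hP (φ 0)).mem t ht)
  rw [sub_add_cancel, h3, hP.out_smul (h₁.mem t ht)] at h4
  rw [h4, add_comm]

theorem cv_const_one_sub {k φ φ' : ℝ → ℝ} (hk : ContinuousOn k (Ici 0))
    (hφ : ∀ t, 0 ≤ t → HasDerivWithinAt φ (φ' t) (Ici 0) t) (hφ' : ContinuousOn φ' (Ici 0))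
    {t : ℝ} (ht : 0 ≤ t) : cv φ' (fun s => 1 + -1 * k s) t = φ t - φ 0 - cv k φ' t := by
  have h1 : cv φ' (fun _ => 1) t = φ t - φ 0 := by
    simp only [cv, one_smul]
    exact integral_derivWithin_Ici hφ hφ' ht
  rw [cv_add (LocInt.of_continuousOn hφ') continuousOn_const (hk.const_mul _) ht, cv_const_mul, h1,
    cv_comm φ' k, smul_eq_mul]
  ring

/-- For an input `r` with derivative `r'`, the error is `r(0) K + K * r'`. -/
theorem IsBetaSolution.sub_out_eq (hP : P.Standing) (hβ : 0 < β) (hS : P.IsBetaSemigroup β S)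
    (hSs : S.ExpStable) {z : ℝ → Z} {φ φ' : ℝ → ℝ}
    (h : P.IsBetaSolution β φ (fun _ => 0) 0 z)
    (hφ : ∀ t, 0 ≤ t → HasDerivWithinAt φ (φ' t) (Ici 0) t) (hφ' : ContinuousOn φ' (Ici 0))
    {t : ℝ} (ht : 0 ≤ t) :
    φ t - P.out (z t) = φ 0 * P.K β S t + cv (P.K β S) φ' t := by
  have h0 := hP.op_mem hS hSs hP.invB_mem
  -- The stationary state plus the free orbit of A⁻¹B starts at 0. It is thus the response to the
  -- constant input 1, and its output is 1 - K.
  have h1 := (hP.betaSolution_neg_invB hβ).add hP h0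
  simp only [add_zero, neg_add_cancel] at h1
  have hout : ∀ s, 0 ≤ s → P.out (-P.invB + S.op s P.invB) = 1 + -1 * P.K β S s := fun s hs => by
    rw [hP.out_add (Submodule.neg_mem _ hP.invB_mem) (h0.mem s hs), hP.out_neg hP.invB_mem,
      hP.out_invB, hP.K_eq hβ hS hSs hs]
    ring
  have h2 := h1.out_eq_of_hasDerivWithinAt hP (h.congr (by simp) (by simp)) hφ hφ' ht
  rw [hout t ht, cv_congr hout ht, cv_const_one_sub (hP.bc_K hβ hS hSs).1 hφ hφ' ht] at h2
  rw [h2]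
  ring

/-- The output caused by a disturbance `d` with derivative `d'` is `-(d(0) K_d + K_d * d')`. -/
theorem IsBetaSolution.out_eq_Kd (hP : P.Standing) (hS : P.IsBetaSemigroup β S)
    (hSs : S.ExpStable) {z : ℝ → Z} {φ φ' : ℝ → ℝ}
    (h : P.IsBetaSolution β (fun _ => 0) φ 0 z)
    (hφ : ∀ t, 0 ≤ t → HasDerivWithinAt φ (φ' t) (Ici 0) t) (hφ' : ContinuousOn φ' (Ici 0))
    {t : ℝ} (ht : 0 ≤ t) :
    P.out (z t) = -(φ 0 * P.Kd β S t + cv (P.Kd β S) φ' t) := by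
  have h0 := hP.op_mem hS hSs hP.invI0Bd_mem
  have h1 := (hP.betaSolution_neg_invI0Bd β).add hP h0
  simp only [add_zero, neg_add_cancel] at h1
  have hout : ∀ s, 0 ≤ s → P.out (-P.invI0Bd + S.op s P.invI0Bd) = -1 * P.Kd β S s :=
    fun s hs => by
    rw [hP.out_add (Submodule.neg_mem _ hP.invI0Bd_mem) (h0.mem s hs), hP.out_neg hP.invI0Bd_mem,
      hP.out_invI0Bd, hP.Kd_eq s]
    ring
  have h2 := h1.out_eq_of_hasDerivWithinAt hP (h.congr (by simp) (by simp)) hφ hφ' ht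
  rw [hout t ht, cv_congr hout ht, cv_const_mul, cv_comm, smul_eq_mul] at h2
  rw [h2]
  ring

/-! ### The error map of the iteration -/

/-- A solution of the regularized system with input `v` and initial value `0`. -/
def Standing.sol (hP : P.Standing) (β : ℝ) (v : ℝ≥0 →ᵇ ℝ) : ℝ → Z :=
  (hP.exists_betaSolution β (bc_ext v) (Bc.const 0) (Submodule.zero_mem _)).choose

theorem Standing.sol_spec (hP : P.Standing) (β : ℝ) (v : ℝ≥0 →ᵇ ℝ) :
    P.IsBetaSolution β (ext v) (fun _ => 0) 0 (hP.sol β v) :=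
  (hP.exists_betaSolution β (bc_ext v) (Bc.const 0) (Submodule.zero_mem _)).choose_spec

/-- The output of the solution with input `v` and initial value `0`. -/
def Standing.resp (hP : P.Standing) (hS : P.IsBetaSemigroup β S) (hSs : S.ExpStable)
    (v : ℝ≥0 →ᵇ ℝ) : ℝ≥0 →ᵇ ℝ :=
  ((hP.sol_spec β v).bc_out hP hS hSs (bc_ext v) (Bc.const 0)).toBCF

/-- By uniqueness, neither the choice of solution in `sol` nor the behaviour of the input at
negative times matters. -/
theorem Standing.ext_resp (hP : P.Standing) (hS : P.IsBetaSemigroup β S) (hSs : S.ExpStable)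
    {v : ℝ≥0 →ᵇ ℝ} {f : ℝ → ℝ} {z : ℝ → Z} (h : P.IsBetaSolution β f (fun _ => 0) 0 z)
    (hf : ∀ t, 0 ≤ t → f t = ext v t) {t : ℝ} (ht : 0 ≤ t) :
    ext (hP.resp hS hSs v) t = P.out (z t) := by
  rw [resp, Bc.ext_toBCF _ ht, (hP.sol_spec β v).unique hP
    (h.congr (fun s hs => (hf s hs).symm) fun _ _ => rfl) ht]

/-- The map from an error signal to the error after one more step of the iteration. -/
def Standing.errMap (hP : P.Standing) (hS : P.IsBetaSemigroup β S) (hSs : S.ExpStable) :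
    (ℝ≥0 →ᵇ ℝ) →ₗ[ℝ] (ℝ≥0 →ᵇ ℝ) where
  toFun v := v - hP.resp hS hSs v
  map_add' v w := by
    have h : hP.resp hS hSs (v + w) = hP.resp hS hSs v + hP.resp hS hSs w :=
      eq_of_ext fun t ht => by
      have h1 := (hP.sol_spec β v).add hP (hP.sol_spec β w)
      simp only [add_zero] at h1
      rw [hP.ext_resp hS hSs h1 (fun _ _ => rfl) ht, ext_add,
        hP.ext_resp hS hSs (hP.sol_spec β v) (fun _ _ => rfl) ht,
        hP.ext_resp hS hSs (hP.sol_spec β w) (fun _ _ => rfl) ht,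
        hP.out_add ((hP.sol_spec β v).mem t ht) ((hP.sol_spec β w).mem t ht)]
    rw [h]
    abel
  map_smul' a v := by
    have h : hP.resp hS hSs (a • v) = a • hP.resp hS hSs v :=
      eq_of_ext fun t ht => by
      have h1 := (hP.sol_spec β v).smul hP a
      simp only [smul_zero, mul_zero] at h1
      rw [hP.ext_resp hS hSs h1 (fun _ _ => rfl) ht, ext_smul,
        hP.ext_resp hS hSs (hP.sol_spec β v) (fun _ _ => rfl) ht,
        hP.out_smul ((hP.sol_spec β v).mem t ht)]
    rw [h, RingHom.id_apply, smul_sub]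

theorem Standing.ext_errMap (hP : P.Standing) (hS : P.IsBetaSemigroup β S) (hSs : S.ExpStable)
    {v : ℝ≥0 →ᵇ ℝ} {f : ℝ → ℝ} {z : ℝ → Z} (h : P.IsBetaSolution β f (fun _ => 0) 0 z)
    (hf : ∀ t, 0 ≤ t → f t = ext v t) {t : ℝ} (ht : 0 ≤ t) :
    ext (hP.errMap hS hSs v) t = f t - P.out (z t) := by
  rw [← hP.ext_resp hS hSs h hf ht, hf t ht]
  rfl

/-- The error map is causal and time invariant, so it commutes with convolution (`out_cv`). This
lets the factors produced by successive differentiations be collected in front of the powers of the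
map. -/
theorem Standing.commute_errMap_convL (hP : P.Standing) (hS : P.IsBetaSemigroup β S)
    (hSs : S.ExpStable) {k : ℝ → ℝ} (hk : IntegrableOn k (Ioi 0)) (hkc : ContinuousOn k (Ici 0)) :
    Commute (hP.errMap hS hSs) (convL hk) := by
  refine LinearMap.ext fun v => eq_of_ext fun t ht => ?_
  have h1 := hP.sol_spec β v
  have h2 := hP.sol_spec β (convL hk v)
  have hkL := LocInt.of_integrableOn hk
  have h3 := h1.out_cv hP (bc_ext v).1 continuousOn_const hkc h2
    (fun s hs => ext_convL hk v hs) (fun s _ => by simp [cv]) ht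
  have h4 : ∀ s, 0 ≤ s → ext (hP.errMap hS hSs v) s = ext v s + -1 * P.out (hP.sol β v s) :=
    fun s hs => by
    rw [hP.ext_errMap hS hSs h1 (fun _ _ => rfl) hs]
    ring
  rw [Module.End.mul_apply, Module.End.mul_apply, hP.ext_errMap hS hSs h2 (fun _ _ => rfl) ht, h3,
    ext_convL hk _ ht, ext_convL hk _ ht, cv_congr h4 ht,
    cv_add hkL (bc_ext v).1 (h1.out_continuousOn.const_mul _) ht, cv_const_mul, smul_eq_mul]
  ring

/-- Signals that tend to 0 stay so under the iteration. Hence terms from initial values, such as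
φ(0)K, never contribute to the limsup. -/
theorem Standing.evLe_errMap_pow (hP : P.Standing) (hS : P.IsBetaSemigroup β S)
    (hSs : S.ExpStable) {v : ℝ≥0 →ᵇ ℝ} (hv : EvLe (ext v) 0) (n : ℕ) :
    EvLe (ext ((hP.errMap hS hSs ^ n) v)) 0 := by
  induction n with
  | zero => simpa using hv
  | succ n ih =>
    rw [pow_succ', Module.End.mul_apply]
    set x := (hP.errMap hS hSs ^ n) v
    have h1 := hP.sol_spec β x
    have h2 := h1.evLe_out hP hS hSs (bc_ext x).1 continuousOn_const ih evLe_zero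
    have h3 := ih.add (h2.const_mul_zero (-1))
    rw [add_zero] at h3
    exact h3.congr fun t ht => by
      rw [hP.ext_errMap hS hSs h1 (fun _ _ => rfl) ht]
      ring

theorem Standing.errMap_eq (hP : P.Standing) (hβ : 0 < β) (hS : P.IsBetaSemigroup β S)
    (hSs : S.ExpStable) {φ φ' : ℝ → ℝ} (hφb : Bc φ) (hφb' : Bc φ')
    (hφ : ∀ t, 0 ≤ t → HasDerivWithinAt φ (φ' t) (Ici 0) t) :
    hP.errMap hS hSs hφb.toBCF = φ 0 • (hP.bc_K hβ hS hSs).toBCF +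
      convL (hP.integrableOn_K hβ hS hSs) hφb'.toBCF := by
  refine eq_of_ext fun t ht => ?_
  have h1 := hP.sol_spec β hφb.toBCF
  have h2 := h1.congr (v' := φ) (w' := fun _ => 0) (fun s hs => (hφb.ext_toBCF hs).symm)
    fun _ _ => rfl
  rw [hP.ext_errMap hS hSs h2 (fun s hs => (hφb.ext_toBCF hs).symm) ht,
    h2.sub_out_eq hP hβ hS hSs hφ hφb'.1 ht, ext_add, ext_smul, ext_convL _ _ ht, Bc.ext_toBCF _ ht,
    cv_congr (fun s hs => hφb'.ext_toBCF hs) ht]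

/-- The core induction: each application of the error map replaces the signal by its derivative and
costs one factor D, the L¹ norm of K. -/
theorem Standing.evLe_errMap_pow_of_isCb (hP : P.Standing) (hβ : 0 < β)
    (hS : P.IsBetaSemigroup β S) (hSs : S.ExpStable) (n : ℕ) : ∀ {φ : ℝ → ℝ} (hφ : IsCb n φ),
      EvLe (ext ((hP.errMap hS hSs ^ n) hφ.bc.toBCF))
        (P.D β S ^ n * limsup (fun t => |iteratedDerivWithin n φ (Ici 0) t|) atTop) := by
  induction n with
  | zero =>
    intro φ hφ
    obtain ⟨M, hM⟩ := hφ.2 0 le_rfl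
    simp only [iteratedDerivWithin_zero] at hM
    simp only [pow_zero, iteratedDerivWithin_zero, one_mul]
    exact (EvLe.of_bounded hM).congr fun t ht => hφ.bc.ext_toBCF ht
  | succ n ih =>
    intro φ hφ
    have hφ' := hφ.derivWithin
    have hK := hP.integrableOn_K hβ hS hSs
    have hc := (hP.commute_errMap_convL hS hSs hK (hP.bc_K hβ hS hSs).1).pow_left n
    have hnn : 0 ≤ P.D β S ^ n *
        limsup (fun t => |iteratedDerivWithin n (derivWithin φ (Ici 0)) (Ici 0) t|) atTop := by
      obtain ⟨M, hM⟩ := hφ'.2 n le_rfl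
      exact mul_nonneg (pow_nonneg (hP.D_pos hβ hS hSs).le n) (limsup_abs_nonneg hM)
    have h1 := EvLe.cv hK (bc_ext _) hnn (ih hφ')
    have h2 := hP.evLe_errMap_pow hS hSs (v := (hP.bc_K hβ hS hSs).toBCF)
      ((hP.evLe_K hβ hS hSs).congr fun t ht => Bc.ext_toBCF _ ht) n
    have h3 := (h2.const_mul_zero (φ 0)).add h1
    have e : (∫ τ in Ioi (0 : ℝ), |P.K β S τ|) * (P.D β S ^ n * limsup
        (fun t => |iteratedDerivWithin n (derivWithin φ (Ici 0)) (Ici 0) t|) atTop) =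
        P.D β S ^ (n + 1) * limsup (fun t => |iteratedDerivWithin (n + 1) φ (Ici 0) t|) atTop := by
      rw [iteratedDerivWithin_succ', pow_succ, D]
      ring
    rw [zero_add, e] at h3
    refine h3.congr fun t ht => ?_
    -- With R the error map, Rⁿ⁺¹φ = Rⁿ(φ(0)K + K * φ') = φ(0)RⁿK + K * Rⁿφ', where commutation
    -- moves Rⁿ past the convolution.
    rw [pow_succ, Module.End.mul_apply, hP.errMap_eq hβ hS hSs hφ.bc hφ'.bc
      fun t ht => hφ.hasDerivWithinAt ht, map_add, map_smul, ← Module.End.mul_apply, hc.eq,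
      Module.End.mul_apply, ext_add, ext_smul, ext_convL hK _ ht]

end Plant

namespace Plant

variable {Z : Type*} [NormedAddCommGroup Z] [NormedSpace ℝ Z] {P : Plant Z} {β : ℝ}
  {S : C0Semigroup Z} {r d : ℝ → ℝ} {z₀ : Z} {z : ℕ → ℝ → Z}

/-! ### The errors of the iteration -/

theorem IsBetaIteration.mem (h : P.IsBetaIteration β r d z₀ z) (j : ℕ) {t : ℝ} (ht : 0 ≤ t) :
    z j t ∈ P.T.ZPos P.sc := by
  cases j with
  | zero => exact h.zero.mem t ht
  | succ j => exact (h.succ j).mem t ht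

theorem err_eq_sub_sum (r : ℝ → ℝ) (z : ℕ → ℝ → Z) (n : ℕ) (t : ℝ) :
    P.err r z n t = r t - ∑ j ∈ Finset.range (n + 1), P.out (z j t) := by
  induction n with
  | zero => simp [err]
  | succ n ih =>
    simp only [err, ih, Finset.sum_range_succ _ (n + 1)]
    ring

theorem IsBetaIteration.err_eq (hP : P.Standing) (h : P.IsBetaIteration β r d z₀ z) (n : ℕ) {t : ℝ}
    (ht : 0 ≤ t) : P.err r z n t = r t - P.out (∑ j ∈ Finset.range (n + 1), z j t) := by
  rw [hP.out_sum (fun j => h.mem j ht), err_eq_sub_sum]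

theorem Dd_nonneg (P : Plant Z) (β : ℝ) (S : C0Semigroup Z) : 0 ≤ P.Dd β S :=
  integral_nonneg fun _ => abs_nonneg _

variable [CompleteSpace Z]

theorem IsBetaIteration.bc_err (hP : P.Standing) (hS : P.IsBetaSemigroup β S) (hSs : S.ExpStable)
    (h : P.IsBetaIteration β r d z₀ z) (hr : Bc r) (hd : Bc d) (n : ℕ) : Bc (P.err r z n) := by
  induction n with
  | zero => exact hr.sub (h.zero.bc_out hP hS hSs hr hd)
  | succ n ih => exact ih.sub ((h.succ n).bc_out hP hS hSs ih (Bc.const 0))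

theorem IsBetaIteration.bc_out (hP : P.Standing) (hS : P.IsBetaSemigroup β S) (hSs : S.ExpStable)
    (h : P.IsBetaIteration β r d z₀ z) (hr : Bc r) (hd : Bc d) (j : ℕ) :
    Bc fun t => P.out (z j t) := by
  cases j with
  | zero => exact h.zero.bc_out hP hS hSs hr hd
  | succ j => exact (h.succ j).bc_out hP hS hSs (h.bc_err hP hS hSs hr hd j) (Bc.const 0)

theorem IsBetaIteration.toBCF_err (hP : P.Standing) (hS : P.IsBetaSemigroup β S)
    (hSs : S.ExpStable) (h : P.IsBetaIteration β r d z₀ z) (hr : Bc r) (hd : Bc d) (n : ℕ) :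
    (h.bc_err hP hS hSs hr hd n).toBCF =
      (hP.errMap hS hSs ^ n) (h.bc_err hP hS hSs hr hd 0).toBCF := by
  induction n with
  | zero => rfl
  | succ n ih =>
    rw [pow_succ', Module.End.mul_apply, ← ih]
    refine eq_of_ext fun t ht => ?_
    rw [hP.ext_errMap hS hSs (h.succ n) (fun s hs => (Bc.ext_toBCF _ hs).symm) ht,
      Bc.ext_toBCF _ ht, err]

/-- The first error is the sum of the contributions of the initial value, the reference signal and
the disturbance. -/
theorem IsBetaIteration.toBCF_err_zero (hP : P.Standing) (hS : P.IsBetaSemigroup β S)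
    (hSs : S.ExpStable) (h : P.IsBetaIteration β r d z₀ z) (hz₀ : z₀ ∈ P.T.ZPos P.sc) (hr : Bc r)
    (hd : Bc d) {d' : ℝ → ℝ} (hd' : Bc d')
    (hdd : ∀ t, 0 ≤ t → HasDerivWithinAt d (d' t) (Ici 0) t) :
    (h.bc_err hP hS hSs hr hd 0).toBCF = (-1 : ℝ) •
        ((hP.op_mem hS hSs hz₀).bc_out hP hS hSs (Bc.const 0) (Bc.const 0)).toBCF +
      hP.errMap hS hSs hr.toBCF + (d 0 • (hP.bc_Kd hS hSs).toBCF +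
        convL (hP.integrableOn_Kd hS hSs) hd'.toBCF) := by
  have h0 := hP.op_mem hS hSs hz₀
  obtain ⟨zr, hzr⟩ := hP.exists_betaSolution β hr (Bc.const 0) (Submodule.zero_mem _)
  obtain ⟨zd, hzd⟩ := hP.exists_betaSolution β (Bc.const 0) hd (Submodule.zero_mem _)
  have h1 := (h0.add hP hzr).add hP hzd
  simp only [zero_add, add_zero] at h1
  refine eq_of_ext fun t ht => ?_
  have h2 := h.zero.unique hP h1 ht
  rw [Bc.ext_toBCF _ ht]
  simp only [err]
  rw [h2, hP.out_add ((h0.add hP hzr).mem t ht) (hzd.mem t ht),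
    hP.out_add (h0.mem t ht) (hzr.mem t ht), hzd.out_eq_Kd hP hS hSs hdd hd'.1 ht, ext_add, ext_add,
    ext_smul, Bc.ext_toBCF _ ht,
    hP.ext_errMap hS hSs hzr (fun s hs => (hr.ext_toBCF hs).symm) ht, ext_add, ext_smul,
    Bc.ext_toBCF _ ht, ext_convL _ _ ht, cv_congr (fun s hs => hd'.ext_toBCF hs) ht]
  ring

/-- Rⁿ is applied to the decomposition of e₀. The free orbit and the multiple of K_d tend to 0; the
reference receives Rⁿ⁺¹; the disturbance becomes K_d * Rⁿd', so one of its n + 1 factors is D_d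
instead of D. -/
theorem IsBetaIteration.evLe_err (hP : P.Standing) (hβ : 0 < β) (hS : P.IsBetaSemigroup β S)
    (hSs : S.ExpStable) (h : P.IsBetaIteration β r d z₀ z) (hz₀ : z₀ ∈ P.T.ZPos P.sc) {n : ℕ}
    (hr : IsCb (n + 1) r) (hd : IsCb (n + 1) d) :
    EvLe (P.err r z n)
      (P.D β S ^ (n + 1) * limsup (fun t => |iteratedDerivWithin (n + 1) r (Ici 0) t|) atTop +
        P.Dd β S * (P.D β S ^ n *
          limsup (fun t => |iteratedDerivWithin (n + 1) d (Ici 0) t|) atTop)) := by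
  have hd' := hd.derivWithin
  have hKd := hP.integrableOn_Kd hS hSs
  have hc := (hP.commute_errMap_convL hS hSs hKd (hP.bc_Kd hS hSs).1).pow_left n
  have hnn : 0 ≤ P.D β S ^ n *
      limsup (fun t => |iteratedDerivWithin n (derivWithin d (Ici 0)) (Ici 0) t|) atTop := by
    obtain ⟨M, hM⟩ := hd'.2 n le_rfl
    exact mul_nonneg (pow_nonneg (hP.D_pos hβ hS hSs).le n) (limsup_abs_nonneg hM)
  have h0 := hP.op_mem hS hSs hz₀
  have e0 := hP.evLe_errMap_pow hS hSs
    (v := (h0.bc_out hP hS hSs (Bc.const 0) (Bc.const 0)).toBCF)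
    ((h0.evLe_out hP hS hSs continuousOn_const continuousOn_const evLe_zero evLe_zero).congr
      fun t ht => Bc.ext_toBCF _ ht) n
  have er := hP.evLe_errMap_pow_of_isCb hβ hS hSs (n + 1) hr
  have ed := EvLe.cv hKd (bc_ext _) hnn (hP.evLe_errMap_pow_of_isCb hβ hS hSs n hd')
  have ek := hP.evLe_errMap_pow hS hSs (v := (hP.bc_Kd hS hSs).toBCF)
    ((hP.evLe_Kd hS hSs).congr fun t ht => Bc.ext_toBCF _ ht) n
  have e1 := ((e0.const_mul_zero (-1)).add er).add ((ek.const_mul_zero (d 0)).add ed)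
  rw [zero_add, zero_add, ← iteratedDerivWithin_succ'] at e1
  refine e1.congr fun t ht => ?_
  rw [← (h.bc_err hP hS hSs hr.bc hd.bc n).ext_toBCF ht, h.toBCF_err hP hS hSs hr.bc hd.bc,
    h.toBCF_err_zero hP hS hSs hz₀ hr.bc hd.bc hd'.bc fun t ht => hd.hasDerivWithinAt ht, map_add,
    map_add, map_add, map_smul, map_smul, pow_succ, ← Module.End.mul_apply _ (convL hKd), hc.eq,
    Module.End.mul_apply, Module.End.mul_apply, ext_add, ext_add, ext_add, ext_smul, ext_smul,
    ext_convL hKd _ ht]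

theorem Standing.Cn_nonneg (hP : P.Standing) (hβ : 0 < β) (hS : P.IsBetaSemigroup β S)
    (hSs : S.ExpStable) {n : ℕ} (hr : IsCb n r) (hd : IsCb n d) : 0 ≤ P.Cn β S r d n :=
  add_nonneg hr.maxLimsup_nonneg
    (mul_nonneg (div_nonneg (P.Dd_nonneg β S) (hP.D_pos hβ hS hSs).le) hd.maxLimsup_nonneg)

theorem IsBetaIteration.limsup_err_le (hP : P.Standing) (hβ : 0 < β) (hS : P.IsBetaSemigroup β S)
    (hSs : S.ExpStable) (h : P.IsBetaIteration β r d z₀ z) (hz₀ : z₀ ∈ P.T.ZPos P.sc) {n : ℕ}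
    (hr : IsCb (n + 1) r) (hd : IsCb (n + 1) d) :
    limsup (fun t => |P.err r z n t|) atTop ≤ P.D β S ^ (n + 1) * P.Cn β S r d (n + 1) := by
  have hD := hP.D_pos hβ hS hSs
  have hDd := P.Dd_nonneg β S
  refine (h.evLe_err hP hβ hS hSs hz₀ hr hd).limsup_le.trans ?_
  -- The quotient D_d/D in C_{n+1} turns Dⁿ⁺¹ into D_d Dⁿ, which uses D ≠ 0.
  have e : P.D β S ^ (n + 1) * P.Cn β S r d (n + 1) = P.D β S ^ (n + 1) * maxLimsup (n + 1) r +
      P.Dd β S * (P.D β S ^ n * maxLimsup (n + 1) d) := by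
    rw [Cn]
    field_simp
    ring
  rw [e]
  have h1 := limsup_le_maxLimsup le_rfl (n := n + 1) r
  have h2 := limsup_le_maxLimsup le_rfl (n := n + 1) d
  gcongr

/-! ### Existence of the iteration -/

theorem Standing.exists_betaIteration (hP : P.Standing) (hS : P.IsBetaSemigroup β S)
    (hSs : S.ExpStable) (hz₀ : z₀ ∈ P.T.ZPos P.sc) (hr : Bc r) (hd : Bc d) :
    ∃ z : ℕ → ℝ → Z, P.IsBetaIteration β r d z₀ z := by
  obtain ⟨x, hx⟩ := hP.exists_betaSolution β hr hd hz₀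
  have step : ∀ e : {e : ℝ → ℝ // Bc e}, ∃ y, P.IsBetaSolution β e.1 (fun _ => 0) 0 y :=
    fun e => hP.exists_betaSolution β e.2 (Bc.const 0) (Submodule.zero_mem _)
  choose y hy using step
  -- The recursion carries boundedness and continuity of the error, which the existence of the next
  -- state requires.
  let E : ℕ → {e : ℝ → ℝ // Bc e} := fun n => Nat.rec
    ⟨fun t => r t - P.out (x t), hr.sub (hx.bc_out hP hS hSs hr hd)⟩
    (fun _ e => ⟨fun t => e.1 t - P.out (y e t),
      e.2.sub ((hy e).bc_out hP hS hSs e.2 (Bc.const 0))⟩) n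
  let z : ℕ → ℝ → Z := fun n => Nat.casesOn n x fun j => y (E j)
  have he : ∀ j, P.err r z j = (E j).1 := fun j => by
    induction j with
    | zero => rfl
    | succ j ih =>
      rw [err, ih]
  exact ⟨z, hx, fun j => by
    rw [he]
    exact hy (E j)⟩

/-! ### The regulated system -/

theorem bc_sum {f : ℕ → ℝ → ℝ} (hf : ∀ j, Bc (f j)) (n : ℕ) :
    Bc fun t => ∑ j ∈ Finset.range n, f j t := by
  induction n with
  | zero => simpa using Bc.const 0
  | succ n ih => simpa only [Finset.sum_range_succ] using ih.add (hf n)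

theorem IsBetaIteration.bc_totalCtrl (hP : P.Standing) (hS : P.IsBetaSemigroup β S)
    (hSs : S.ExpStable) (h : P.IsBetaIteration β r d z₀ z) (hr : Bc r) (hd : Bc d) (n : ℕ) :
    Bc (P.totalCtrl β r d z n) := by
  refine bc_sum (fun j => ?_) (n + 1)
  have ho := (h.bc_out hP hS hSs hr hd j).const_mul ((1 - β) / β)
  cases j with
  | zero => exact (((hr.const_mul _).sub ho).add (hd.const_mul _)).const_mul _
  | succ j => exact (((h.bc_err hP hS hSs hr hd j).const_mul _).sub ho).const_mul _

/-- The total state of the iteration solves the control system driven by the total control. -/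
theorem IsBetaIteration.isSolution (hP : P.Standing) (h : P.IsBetaIteration β r d z₀ z) (n : ℕ) :
    P.IsSolution (P.totalCtrl β r d z n) d z₀
      (fun t => ∑ j ∈ Finset.range (n + 1), z j t) := by
  induction n with
  | zero =>
    simp only [zero_add, Finset.sum_range_one]
    refine ⟨h.zero.continuousOn, h.zero.initial, fun t ht => ?_⟩
    convert h.zero.equation t ht using 1
    -- Since B = B_in G⁻¹ and I₀B_d = B_d + B(CA⁻¹B_d), every feedback term has range in that of
    -- B_in. The control u⁰ collects their coefficients, including the disturbance term CA⁻¹B_d d.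
    rw [totalCtrl, invI0Bd, hP.invB_eq]
    simp only [zero_add, Finset.sum_range_one, ctrl]
    module
  | succ n ih =>
    simp only [Finset.sum_range_succ _ (n + 1)]
    refine ⟨ih.continuousOn.add (h.succ n).continuousOn, ?_, fun t ht => ?_⟩
    · rw [ih.initial, (h.succ n).initial, add_zero]
    · simp only [map_add]
      convert (ih.equation t ht).fun_add ((h.succ n).equation t ht) using 1
      rw [totalCtrl, Finset.sum_range_succ _ (n + 1), ← totalCtrl, ctrl, hP.invB_eq]
      module

theorem Standing.exists_isSolution (hP : P.Standing) {u : ℝ → ℝ} (hu : ContinuousOn u (Ici 0))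
    (hd : ContinuousOn d (Ici 0)) (z₀ : Z) : ∃ z, P.IsSolution u d z₀ z :=
  ⟨P.mild P.invBin P.invBd u d z₀, continuousOn_mild hP.adm_invBin hP.adm_invBd hu hd z₀,
    P.mild_zero _ _ _ _ _, fun t ht => by
      rw [add_assoc]
      exact hP.hasDerivWithinAt_mild hP.adm_invBin hP.adm_invBd hu hd z₀ ht⟩

theorem IsSolution.eq_add_op (hP : P.Standing) {u : ℝ → ℝ} {x₀ x₀' : Z} {x x' : ℝ → Z}
    (h : P.IsSolution u d x₀ x) (h' : P.IsSolution u d x₀' x') {t : ℝ} (ht : 0 ≤ t) :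
    x' t = x t + P.T.op t (x₀' - x₀) := by
  refine hP.eq_of_hasDerivWithinAt_inv (F := fun t => u t • P.invBin + d t • P.invBd)
    (z := x') (z' := fun t => x t + P.T.op t (x₀' - x₀))
    (fun s hs => ?_) (fun s hs => ?_) ?_ ht
  · rw [← add_assoc]
    exact h'.equation s hs
  · simp only [map_add]
    convert (h.equation s hs).fun_add (hP.hasDerivWithinAt_inv_op (x₀' - x₀) hs) using 1
    abel
  · rw [P.T.op_zero_apply, h.initial, h'.initial]
    abel

theorem Standing.op_eq_N (hP : P.Standing) {t : ℝ} (ht : 0 < t) (x : Z) :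
    P.T.op t x = P.N (P.T.powOp P.sc t x) :=
  (C0Semigroup.negPow_powOp hP.expStable hP.analytic hP.sc_nonneg hP.sc_lt.le ht x).symm

/-- C is unbounded on Z, so decay in Z is not enough. After a unit of time the state lies in
Z^{s_c}, and e^{A(t-1)} then decays on (-A)^{s_c}e^{A}x. -/
theorem Standing.tendsto_out_op (hP : P.Standing) (x : Z) :
    Tendsto (fun t => P.out (P.T.op t x)) atTop (𝓝 0) := by
  have h1 := (hP.obs.continuous.tendsto 0).comp ((hP.expStable.tendsto_op_atTop
    (P.T.powOp P.sc 1 x)).comp (tendsto_atTop_add_const_right atTop (-1) tendsto_id))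
  rw [map_zero] at h1
  refine h1.congr' ?_
  filter_upwards [eventually_ge_atTop 1] with t ht
  have ht' : 0 ≤ t + -1 := by linarith
  have h2 := P.T.op_add_apply ht' zero_le_one x
  rw [neg_add_cancel_right] at h2
  rw [h2, hP.op_eq_N one_pos, ← hP.N_op ht', hP.out_N]
  rfl

/-- The control does not depend on the initial state x₀. A solution from x₀ differs from the sum of
the iterates by e^{At}(x₀ - z₀), which lies in Z^{s_c} for t > 0 and has vanishing output at
infinity. -/
theorem IsBetaIteration.solvesPracticalRegulation (hP : P.Standing) (hS : P.IsBetaSemigroup β S)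
    (hSs : S.ExpStable) (h : P.IsBetaIteration β r d z₀ z) (hr : Bc r) (hd : Bc d) {n : ℕ} {ε : ℝ}
    (hε : limsup (fun t => |P.err r z n t|) atTop ≤ ε) :
    P.SolvesPracticalRegulation r d ε (P.totalCtrl β r d z n) := by
  have hu := h.bc_totalCtrl hP hS hSs hr hd n
  refine ⟨hu.1, hu.2, fun x₀ => ⟨hP.exists_isSolution hu.1 hd.1 x₀, fun x hx => ?_⟩⟩
  have hs := h.isSolution hP n
  have hmem : ∀ t, 0 ≤ t → ∑ j ∈ Finset.range (n + 1), z j t ∈ P.T.ZPos P.sc :=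
    fun t ht => Submodule.sum_mem _ fun j _ => h.mem j ht
  have hop : ∀ t, 0 < t → P.T.op t (x₀ - z₀) ∈ P.T.ZPos P.sc := fun t ht => by
    rw [hP.op_eq_N ht]
    exact P.N_mem _
  obtain ⟨M, hM⟩ := (h.bc_err hP hS hSs hr hd n).2
  have h1 := (EvLe.of_bounded hM).add
    ((EvLe.of_tendsto (hP.tendsto_out_op (x₀ - z₀))).const_mul_zero (-1))
  have h2 : EvLe (fun t => r t - P.out (x t)) (limsup (fun t => |P.err r z n t|) atTop) := by
    rw [add_zero] at h1
    intro δ hδ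
    filter_upwards [h1 δ hδ, eventually_gt_atTop 0] with t h3 ht
    rw [hs.eq_add_op hP hx ht.le, hP.out_add (hmem t ht.le) (hop t ht)]
    rw [h.err_eq hP n ht.le] at h3
    convert h3 using 2
    ring
  refine ⟨fun t ht => ?_, h2.isBoundedUnder, h2.limsup_le.trans hε⟩
  rw [hs.eq_add_op hP hx ht.le]
  exact Submodule.add_mem _ (hmem t ht.le) (hop t ht)

end Plant

/-- Behaviour of the bounds `A (D α)ⁿ` when `A αⁿ` dominates a nonnegative sequence. -/
theorem geometric_bound {D A α : ℝ} {c : ℕ → ℝ} (hD : 0 < D) (hc : ∀ n, 0 ≤ c n)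
    (h : ∀ n, c n ≤ A * α ^ n) (h1 : D * α < 1) :
    (∀ n, A * (D * α) ^ (n + 1) ≤ A * (D * α) ^ n) ∧
      Tendsto (fun n : ℕ => A * (D * α) ^ n) atTop (𝓝 0) := by
  -- The sign of α is not prescribed. The cases n = 0 and n = 1 give A ≥ 0 and Aα ≥ 0, so a negative
  -- α forces A = 0.
  have hA : 0 ≤ A := by simpa using (hc 0).trans (h 0)
  have hAα : 0 ≤ A * α := by simpa using (hc 1).trans (h 1)
  rcases lt_or_ge α 0 with hα | hα
  · have : A = 0 := le_antisymm (by nlinarith) hA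
    simp [this]
  · have h0 : 0 ≤ D * α := mul_nonneg hD.le hα
    refine ⟨fun n => mul_le_mul_of_nonneg_left
      (pow_le_pow_of_le_one h0 h1.le (Nat.le_succ n)) hA, ?_⟩
    simpa using (tendsto_pow_atTop_nhds_zero_of_lt_one h0 h1).const_mul A

end

end Regulation

/-! ### The main theorem -/

theorem mainTheorem2 {Z : Type*} [NormedAddCommGroup Z] [InnerProductSpace ℝ Z] [CompleteSpace Z]
    (P : Regulation.Plant Z) (hP : P.Standing)
    (β : ℝ) (hβ₀ : 0 < β) (hβ₁ : β < 1)
    (S : Regulation.C0Semigroup Z) (hS : P.IsBetaSemigroup β S) (hSstable : S.ExpStable)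
    (z₀ : Z) (hz₀ : z₀ ∈ P.T.ZPos P.sc)
    (r d : ℝ → ℝ) (hr : Regulation.IsCb 0 r) (hd : Regulation.IsCb 0 d) :
    -- the constants `D > 0` and `D_d` are well defined, and the β-iteration has a solution
    (IntegrableOn (P.K β S) (Ioi 0) ∧ IntegrableOn (P.Kd β S) (Ioi 0) ∧ 0 < P.D β S) ∧
    (∃ z : ℕ → ℝ → Z, P.IsBetaIteration β r d z₀ z) ∧
    ∀ z : ℕ → ℝ → Z, P.IsBetaIteration β r d z₀ z →
      (∀ n : ℕ, ∀ t : ℝ, 0 ≤ t →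
        P.err r z n t = r t - P.out (∑ j ∈ Finset.range (n + 1), z j t)) ∧
      -- the error estimate
      (∀ n : ℕ, Regulation.IsCb (n + 1) r → Regulation.IsCb (n + 1) d →
        IsBoundedUnder (· ≤ ·) atTop (fun t => |P.err r z n t|) ∧
        limsup (fun t => |P.err r z n t|) atTop ≤
          P.D β S ^ (n + 1) * P.Cn β S r d (n + 1)) ∧
      -- convergence, and solution of the practical regulation problem
      ((∀ N : ℕ, Regulation.IsCb N r ∧ Regulation.IsCb N d) →
        ∀ A α : ℝ, (∀ n : ℕ, P.Cn β S r d n ≤ A * α ^ n) → P.D β S * α < 1 →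
          (∀ n : ℕ, limsup (fun t => |P.err r z n t|) atTop ≤ A * (P.D β S * α) ^ (n + 1) ∧
            A * (P.D β S * α) ^ (n + 1) ≤ A * (P.D β S * α) ^ n) ∧
          Tendsto (fun n : ℕ => A * (P.D β S * α) ^ n) atTop (𝓝 0) ∧
          Tendsto (fun n : ℕ => limsup (fun t => |P.err r z n t|) atTop) atTop (𝓝 0) ∧
          ∀ ε : ℝ, 0 < ε → ∃ N : ℕ, ∀ n : ℕ, N ≤ n →
            P.SolvesPracticalRegulation r d ε (P.totalCtrl β r d z n)) := by
  have hD := hP.D_pos hβ₀ hS hSstable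
  refine ⟨⟨hP.integrableOn_K hβ₀ hS hSstable, hP.integrableOn_Kd hS hSstable, hD⟩,
    hP.exists_betaIteration hS hSstable hz₀ hr.bc hd.bc, fun z h =>
    ⟨fun n t ht => h.err_eq hP n ht, fun n hr' hd' =>
      ⟨(h.evLe_err hP hβ₀ hS hSstable hz₀ hr' hd').isBoundedUnder,
        h.limsup_err_le hP hβ₀ hS hSstable hz₀ hr' hd'⟩, fun hN A α hC hα => ?_⟩⟩
  obtain ⟨hmono, htend⟩ := Regulation.geometric_bound hD
    (fun n => hP.Cn_nonneg hβ₀ hS hSstable (hN n).1 (hN n).2) hC hα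
  have hle : ∀ n, limsup (fun t => |P.err r z n t|) atTop ≤ A * (P.D β S * α) ^ (n + 1) :=
    fun n => by
    refine (h.limsup_err_le hP hβ₀ hS hSstable hz₀ (hN (n + 1)).1 (hN (n + 1)).2).trans ?_
    refine (mul_le_mul_of_nonneg_left (hC (n + 1)) (pow_nonneg hD.le _)).trans_eq ?_
    rw [mul_pow]
    ring
  have hlim : Tendsto (fun n : ℕ => limsup (fun t => |P.err r z n t|) atTop) atTop (𝓝 0) := by
    refine squeeze_zero (fun n => ?_) (fun n => (hle n).trans (hmono n)) htend
    obtain ⟨M, hM⟩ := (h.bc_err hP hS hSstable hr.bc hd.bc n).2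
    exact Regulation.limsup_abs_nonneg hM
  refine ⟨fun n => ⟨hle n, hmono n⟩, htend, hlim, fun ε hε => ?_⟩
  obtain ⟨N, hN'⟩ := eventually_atTop.1 (hlim.eventually (gt_mem_nhds hε))
  exact ⟨N, fun n hn =>
    h.solvesPracticalRegulation hP hS hSstable hr.bc hd.bc (hN' n hn).le⟩
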